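/- Let $N\ge 1$, $l\ge 0$ be integers with $N+l\ge 3$, let $p>1$ and $\gamma\ge 0$ be real, and write points of $\mathbb R^{N+l}$ as $z=(x,y)$, $x\in\mathbb R^N$, $y\in\mathbb R^l$. Let $\nabla_\gamma u=(\nabla_x u,|x|^\gamma\nabla_y u)$ and $\Delta^p_\gamma u=\operatorname{div}_\gamma(|\nabla_\gamma u|^{p-2}\nabla_\gamma u)$ with $\operatorname{div}_\gamma(P,Q)=\operatorname{div}_xP+|x|^\gamma\operatorname{div}_yQ$ (and $|\xi|^{p-2}\xi=0$ at $\xi=0$). Let $f:\mathbb R^{N+l}\times\mathbb R\to\mathbb R$ be continuous, $F(z,s)=\int_0^s f(z,t)\,dt$, and let $\Omega\subset\mathbb R^{N+l}$ be open. Let $W^{1,p}_\lambda(\Omega)$ be the space of $u\in L^p(\Omega)$ whose distributional derivatives $\partial u/\partial x_i$ and $|x|^\gamma\partial u/\partial y_j$ are in $L^p(\Omega)$, with norm $\big(\int_\Omega|\nabla_\gamma u|^p+|u|^p\,dz\big)^{1/p}$, and let $W^{1,p}_{\lambda,0}(\Omega)$ be the closure of $C_0^\infty(\Omega)$ in it.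 Let $u\in W^{1,p}_{\lambda,0}(\Omega)\cap C^1(\overline\Omega)$ be a weak solution of $$-\Delta_\gamma^p u=f(z,u)\ \text{ in }\Omega,\qquad u=0\ \text{ on }\partial\Omega,$$ that is, for every $\varphi\in W^{1,p}_{\lambda,0}(\Omega)$ the function $f(z,u)\varphi$ is integrable on $\Omega$ and $$\int_\Omega|\nabla_\gamma u|^{p-2}\nabla_\gamma u\cdot\nabla_\gamma\varphi\,dz=\int_\Omega f(z,u)\varphi\,dz .$$ Assume that for every $z\in\Omega$ the function $F(\cdot,u(z))$ is differentiable at $z$, with gradient denoted $\nabla_zF(z,u)$, and that $\langle\nabla_zF(z,u),z\rangle$ is integrable on $\Omega$. If $\Omega$ is unbounded, assume also that $F(z,u)$ is integrable on $\Omega$. Then $\nabla\big(F(z,u(z))\big)=\nabla_zF(z,u)+f(z,u)\nabla u$ in $\Omega$, the functions $f(z,u)u$, $F(z,u)$ and $|\nabla_\gamma u|^{p-2}\gamma|x|^{2\gamma}|\nabla_yu|^2$ are integrable on $\Omega$, and the following hold. 1. If $\Omega$ has a $C^1$ boundary with unit outward normal $\nu$, and, in case $\Omega$ is unbounded, $|\nabla_\gamma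 u|^p\langle z,\nu\rangle$ is integrable on $\partial\Omega$ with respect to surface measure $dS$, then $|\nabla_\gamma u|^p\langle z,\nu\rangle$ is integrable on $\partial\Omega$ and $$\Big(-\frac{N+l}{p}+1\Big)\int_\Omega f(z,u)u\,dz+\Big(\frac1p-1\Big)\int_{\partial\Omega}|\nabla_\gamma u|^p\langle z,\nu\rangle\,dS-\int_\Omega|\nabla_\gamma u|^{p-2}\gamma|x|^{2\gamma}|\nabla_yu|^2\,dz$$ $$=-(N+l)\int_\Omega F(z,u)\,dz-\int_\Omega\langle\nabla_zF(z,u),z\rangle\,dz .$$ 2. If $\Omega=\mathbb R^{N+l}$, then $$\Big(-\frac{N+l}{p}+1\Big)\int_{\mathbb R^{N+l}} f(z,u)u\,dz-\int_{\mathbb R^{N+l}}|\nabla_\gamma u|^{p-2}\gamma|x|^{2\gamma}|\nabla_yu|^2\,dz=-(N+l)\int_{\mathbb R^{N+l}}F(z,u)\,dz-\int_{\mathbb R^{N+l}}\langle\nabla_zF(z,u),z\rangle\,dz .$$ -/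

import Mathlib

open MeasureTheory Set Filter Topology
open scoped ENNReal ContDiff InnerProductSpace

namespace Grushin

/-- The space of points `z = (x, y)` with `x ∈ ℝ^N`, `y ∈ ℝ^l`, carrying the Euclidean norm:
`z (Sum.inl i) = x_i` and `z (Sum.inr j) = y_j`. -/
abbrev Space (N l : ℕ) : Type := EuclideanSpace ℝ (Fin N ⊕ Fin l)

variable {N l : ℕ}

/-- The component `x` of `z = (x, y)`. -/
noncomputable def xPart (z : Space N l) : EuclideanSpace ℝ (Fin N) :=
  WithLp.toLp 2 fun i => z (Sum.inl i)

/-- The component `y` of `z = (x, y)`. -/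
noncomputable def yPart (z : Space N l) : EuclideanSpace ℝ (Fin l) :=
  WithLp.toLp 2 fun j => z (Sum.inr j)

/-- The anisotropic dilation `(a, b) ↦ (a, |x|^γ b)` attached to the point `z = (x, y)`. -/
noncomputable def weight (γ : ℝ) (z v : Space N l) : Space N l :=
  WithLp.toLp 2 (Sum.elim (fun i => v (Sum.inl i)) fun j => ‖xPart z‖ ^ γ * v (Sum.inr j))

/-- The Grushin gradient `∇_γ u = (∇_x u, |x|^γ ∇_y u)`. -/
noncomputable def grushinGrad (γ : ℝ) (u : Space N l → ℝ) (z : Space N l) : Space N l :=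
  weight γ z (gradient u z)

/-- Test functions: `φ ∈ C_0^∞(Ω)`. -/
structure IsTestFunction (Ω : Set (Space N l)) (φ : Space N l → ℝ) : Prop where
  smooth : ContDiff ℝ ∞ φ
  compact : HasCompactSupport φ
  subset : tsupport φ ⊆ Ω

/-- `u` belongs to `W^{1,p}_λ(Ω)` and its weak Grushin gradient is `G`: both `u` and `G` are in
`L^p(Ω)`, and the components of `G` are the distributional derivatives `∂u/∂x_i` and
`|x|^γ ∂u/∂y_j` on `Ω` (as `|x|^γ` does not depend on `y`, the formal adjoint of `|x|^γ ∂/∂y_j` is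
its negative; the vector identity below holds componentwise). -/
structure MemW (p γ : ℝ) (Ω : Set (Space N l)) (u : Space N l → ℝ)
    (G : Space N l → Space N l) : Prop where
  memLp : MemLp u (ENNReal.ofReal p) (volume.restrict Ω)
  memLp_grad : MemLp G (ENNReal.ofReal p) (volume.restrict Ω)
  weak_grad : ∀ φ : Space N l → ℝ, IsTestFunction Ω φ →
    ∫ z in Ω, u z • grushinGrad γ φ z = -∫ z in Ω, φ z • G z

/-- `u` belongs to `W^{1,p}_{λ,0}(Ω)`, the closure of `C_0^∞(Ω)` in `W^{1,p}_λ(Ω)`, and its weak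
Grushin gradient is `G`. Convergence in the norm `(∫_Ω |∇_γ v|^p + |v|^p)^{1/p}` is convergence of
the functions and of their Grushin gradients in `L^p(Ω)`. -/
structure MemWZero (p γ : ℝ) (Ω : Set (Space N l)) (u : Space N l → ℝ)
    (G : Space N l → Space N l) : Prop extends MemW p γ Ω u G where
  approx : ∃ φ : ℕ → Space N l → ℝ, (∀ n, IsTestFunction Ω (φ n)) ∧
    Tendsto (fun n => eLpNorm (fun z => φ n z - u z) (ENNReal.ofReal p) (volume.restrict Ω))
      atTop (𝓝 0) ∧
    Tendsto (fun n => eLpNorm (fun z => grushinGrad γ (φ n) z - G z) (ENNReal.ofReal p)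
      (volume.restrict Ω)) atTop (𝓝 0)

/-- `u ∈ W^{1,p}_{λ,0}(Ω)` is a weak solution of `-Δ_γ^p u = f(z, u)` in `Ω`, `u = 0` on `∂Ω`:
for every `φ ∈ W^{1,p}_{λ,0}(Ω)` the integral of `f(z, u) φ` over `Ω` exists and
`∫_Ω |∇_γ u|^{p-2} ∇_γ u · ∇_γ φ = ∫_Ω f(z, u) φ`. -/
def IsWeakSolution (p γ : ℝ) (f : Space N l → ℝ → ℝ) (Ω : Set (Space N l))
    (u : Space N l → ℝ) : Prop :=
  ∃ G : Space N l → Space N l, MemWZero p γ Ω u G ∧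
    ∀ (φ : Space N l → ℝ) (H : Space N l → Space N l), MemWZero p γ Ω φ H →
      IntegrableOn (fun z => f z (u z) * φ z) Ω ∧
      ∫ z in Ω, ‖G z‖ ^ (p - 2) * ⟪G z, H z⟫_ℝ = ∫ z in Ω, f z (u z) * φ z

/-- `F(z, s) = ∫_0^s f(z, t) dt`. -/
noncomputable def primitive (f : Space N l → ℝ → ℝ) (z : Space N l) (s : ℝ) : ℝ :=
  ∫ t in (0 : ℝ)..s, f z t

/-- `(∇_z F)(z, s)`, the gradient of `F(z, s)` in its first variable, `s` being fixed. -/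
noncomputable def gradPrimitive (f : Space N l → ℝ → ℝ) (z : Space N l) (s : ℝ) : Space N l :=
  gradient (fun w => primitive f w s) z

/-- `u ∈ C^1(Ω̄)`: `u` is `C^1` in the open set `Ω`, continuous on `Ω̄`, and `∇u` extends
continuously to `Ω̄`. -/
def IsC1OnClosure (Ω : Set (Space N l)) (u : Space N l → ℝ) : Prop :=
  ContDiffOn ℝ 1 u Ω ∧ ContinuousOn u (closure Ω) ∧
    ∃ V : Space N l → Space N l, ContinuousOn V (closure Ω) ∧ ∀ z ∈ Ω, V z = gradient u z

/-- The Grushin gradient `∇_γ u` on `Ω̄`, where `∇u` is extended from `Ω` to `Ω̄` by continuity. -/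
noncomputable def grushinGradClosure (γ : ℝ) (Ω : Set (Space N l)) (u : Space N l → ℝ)
    (z : Space N l) : Space N l :=
  weight γ z (extendFrom Ω (gradient u) z)

/-- Near `z ∈ ∂Ω` the set `Ω` is `{ρ < 0}` for a `C^1` function `ρ` without critical points that
vanishes at `z`, and `n = ∇ρ(z) / |∇ρ(z)|`. -/
def IsOuterUnitNormal (Ω : Set (Space N l)) (z n : Space N l) : Prop :=
  ∃ (U : Set (Space N l)) (ρ : Space N l → ℝ), IsOpen U ∧ z ∈ U ∧ ContDiffOn ℝ 1 ρ U ∧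
    (∀ w ∈ U, gradient ρ w ≠ 0) ∧ Ω ∩ U = {w ∈ U | ρ w < 0} ∧ ρ z = 0 ∧
    n = ‖gradient ρ z‖⁻¹ • gradient ρ z

/-- `Ω` has a boundary of class `C^1` and lies locally on one side of it. -/
def HasC1Boundary (Ω : Set (Space N l)) : Prop :=
  ∀ z ∈ frontier Ω, ∃ n, IsOuterUnitNormal Ω z n

open Classical in
/-- The outer unit normal `ν(z)` of `Ω` at a boundary point `z` (unique where it exists). -/
noncomputable def outerNormal (Ω : Set (Space N l)) (z : Space N l) : Space N l :=
  if h : ∃ n, IsOuterUnitNormal Ω z n then h.choose else 0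

/-- The surface measure `dS`: the Hausdorff measure of dimension `N + l - 1`, normalised so that it
is Lebesgue measure on hyperplanes. -/
noncomputable def surfaceMeasure (N l : ℕ) : Measure (Space N l) :=
  Measure.euclideanHausdorffMeasure (N + l - 1)

/-- The integrand `|∇_γ u|^{p-2} γ |x|^{2γ} |∇_y u|^2`. -/
noncomputable def degenerateTerm (p γ : ℝ) (u : Space N l → ℝ) (z : Space N l) : ℝ :=
  ‖grushinGrad γ u z‖ ^ (p - 2) *
    (γ * ‖xPart z‖ ^ (2 * γ) * ‖yPart (gradient u z)‖ ^ 2)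

/-- The boundary integrand `|∇_γ u|^p ⟨z, ν⟩`. -/
noncomputable def boundaryTerm (p γ : ℝ) (Ω : Set (Space N l)) (u : Space N l → ℝ)
    (z : Space N l) : ℝ :=
  ‖grushinGradClosure γ Ω u z‖ ^ p * ⟪z, outerNormal Ω z⟫_ℝ

end Grushin

/-! ### Powers of the norm and convexity of the energy density -/

section NormPower

variable {E : Type*} [NormedAddCommGroup E]

/-! The classical derivation multiplies the equation by the radial derivative `⟨∇u, z⟩` and
integrates by parts, which needs second derivatives. Here `u` is only `C^1`, so the multiplier is
replaced by an inner variation. For `η` with compact support in `Ω` and small `t > 0`, the weak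
equation is tested with `u ∘ Φ_t - u`, where `Φ_t(z) = (1 + t η(z)) z`. Convexity of `L(ξ) = |ξ|^p /
p` bounds the left-hand side by `∫ L(∇_γ(u ∘ Φ_t)) - L(∇_γ u)`. The change of variables `Φ_t` turns
the second term into the integral of `L(∇_γ u) ∘ Φ_t` times the Jacobian, and convexity bounds the
resulting difference by `t` times an explicit density that is continuous in `(t, z)`. Dividing by
`t` and letting `t → 0` gives an inequality; at `t = 0` the density is odd in `η`, so `-η` gives the
reverse one (`integral_variationDensity_zero`). The degenerate term with the factor `γ` appears
because `|x|^γ` is multiplied by `(1 + t η)^γ` under `Φ_t`.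

The right-hand side contains `f(z, u) ⟨∇u, z⟩`, the radial derivative of `F(z, u(z))` minus `⟨∇_z F,
z⟩`. As `∇_z F` need not be continuous, it is integrated by `integral_fderiv_apply_self_eq`, which
asks only for differentiability and an integrable radial derivative. The outcome,
`IsWeakSolution.integral_pohozaev`, says that `div b = -α` weakly in `Ω` for the continuous field `b
= ⟨∇u, z⟩ |∇_γ u|^(p-2) (∇_x u, |x|^(2γ) ∇_y u) + (F(z, u) - |∇_γ u|^p / p) z`, with `α` the
function `pohozaevSource`.

Since `b` extends continuously to the closure, the divergence theorem `HasC1Boundary.hasFlux` holds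
up to the boundary. It is obtained from cutoffs that depend on the height below a local graph and
from the area formula for graphs. On the boundary `u = 0`; this is deduced from membership in the
closure of the test functions, with a separate argument at characteristic points. Hence `∇u` is
normal there, and `⟨b, ν⟩ = (1 - 1/p) |∇_γ u|^p ⟨z, ν⟩`.

Finally `η` is replaced by cutoffs at the anisotropic scales `|x| ~ R`, `|y| ~ R^(1+γ)`. These are
matched to the weight, so that `⟨b, ∇η⟩` is dominated, uniformly in `R`, by a multiple of `|∇_γ u|^p
+ |F(z, u)|`, and dominated convergence removes them. Testing the equation with `u` itself replaces
`∫ |∇_γ u|^p` by `∫ f(z, u) u`. The whole space is the case of an empty boundary. -/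

theorem norm_rpow_sub_two_mul_sq {p : ℝ} (hp : p ≠ 0) (ξ : E) :
    ‖ξ‖ ^ (p - 2) * ‖ξ‖ ^ 2 = ‖ξ‖ ^ p := by
  by_cases h : ξ = 0
  · simp [h, Real.zero_rpow hp]
  · rw [← Real.rpow_natCast, ← Real.rpow_add (norm_pos_iff.2 h)]
    congr 1
    norm_num

theorem norm_rpow_sub_two_mul_norm {p : ℝ} (hp : 1 < p) (ξ : E) :
    ‖ξ‖ ^ (p - 2) * ‖ξ‖ = ‖ξ‖ ^ (p - 1) := by
  by_cases h : ξ = 0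
  · simp [h, Real.zero_rpow (by linarith : p - 1 ≠ 0)]
  · rw [← Real.rpow_add_one (norm_ne_zero_iff.2 h)]
    congr 1
    ring

theorem norm_rpow_sub_one_mul_norm {p : ℝ} (hp : 1 < p) (ξ : E) :
    ‖ξ‖ ^ (p - 1) * ‖ξ‖ = ‖ξ‖ ^ p := by
  rw [← norm_rpow_sub_two_mul_norm hp, mul_assoc, ← sq, norm_rpow_sub_two_mul_sq (by linarith)]

variable [InnerProductSpace ℝ E]

/-- Only the origin needs care: for `p < 2` the scalar factor is unbounded near it, but the product
has norm at most `‖ξ‖ ^ (p - 1)`, which tends to zero. -/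
theorem continuous_norm_rpow_sub_two_smul {p : ℝ} (hp : 1 < p) :
    Continuous fun ξ : E => ‖ξ‖ ^ (p - 2) • ξ := by
  rw [continuous_iff_continuousAt]
  intro ξ
  by_cases h : ξ = 0
  · subst h
    have h1 : Tendsto (fun ξ : E => ‖ξ‖ ^ (p - 1)) (𝓝 0) (𝓝 0) := by
      have : ContinuousAt (fun ξ : E => ‖ξ‖ ^ (p - 1)) 0 :=
        continuous_norm.continuousAt.rpow_const (Or.inr (by linarith))
      simpa [ContinuousAt, Real.zero_rpow (by linarith : p - 1 ≠ 0)] using this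
    have h2 : ∀ ξ : E, ‖‖ξ‖ ^ (p - 2) • ξ‖ ≤ ‖ξ‖ ^ (p - 1) := by
      intro ξ
      rw [norm_smul, Real.norm_of_nonneg (by positivity)]
      by_cases h : ξ = 0
      · simp [h, Real.zero_rpow (by linarith : p - 1 ≠ 0)]
      · rw [show p - 1 = (p - 2) + 1 by ring, Real.rpow_add_one (norm_ne_zero_iff.2 h)]
    simpa [ContinuousAt] using squeeze_zero_norm h2 h1
  · exact (continuous_norm.continuousAt.rpow_const (Or.inl (norm_ne_zero_iff.2 h))).smul
      continuousAt_id

/-- Convexity of `ξ ↦ ‖ξ‖ ^ p / p`. -/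
theorem norm_rpow_sub_two_mul_inner_sub_le {p : ℝ} (hp : 1 < p) (ξ ζ : E) :
    ‖ξ‖ ^ (p - 2) * ⟪ξ, ζ - ξ⟫_ℝ ≤ (‖ζ‖ ^ p - ‖ξ‖ ^ p) / p := by
  have hq := Real.HolderConjugate.conjExponent hp
  -- Young's inequality for `‖ζ‖` and `‖ξ‖ ^ (p - 1)`; the conjugate exponent turns the second
  -- factor into `‖ξ‖ ^ p`.
  have h1 := Real.young_inequality_of_nonneg (norm_nonneg ζ)
    (Real.rpow_nonneg (norm_nonneg ξ) (p - 1)) hq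
  rw [← Real.rpow_mul (norm_nonneg ξ), hq.sub_one_mul_conj] at h1
  have h2 : ‖ξ‖ ^ (p - 2) * ⟪ξ, ζ⟫_ℝ ≤ ‖ζ‖ * ‖ξ‖ ^ (p - 1) := by
    calc ‖ξ‖ ^ (p - 2) * ⟪ξ, ζ⟫_ℝ ≤ ‖ξ‖ ^ (p - 2) * (‖ξ‖ * ‖ζ‖) := by
          gcongr; exact real_inner_le_norm _ _
      _ = _ := by rw [← mul_assoc, norm_rpow_sub_two_mul_norm hp, mul_comm]
  have h3 : p.conjExponent⁻¹ = 1 - p⁻¹ := by linarith [hq.inv_add_inv_eq_one]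
  rw [inner_sub_right, mul_sub, real_inner_self_eq_norm_sq,
    norm_rpow_sub_two_mul_sq (by linarith)]
  rw [div_eq_mul_inv _ p.conjExponent, h3] at h1
  have : (‖ζ‖ ^ p - ‖ξ‖ ^ p) / p = ‖ζ‖ ^ p / p - ‖ξ‖ ^ p * p⁻¹ := by ring
  linarith

end NormPower

/-! ### Integrals of radial derivatives -/

section Dilation

variable {E : Type*} [NormedAddCommGroup E] [NormedSpace ℝ E] [FiniteDimensional ℝ E]
  [MeasurableSpace E] [BorelSpace E] (μ : Measure E) [μ.IsAddHaarMeasure]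

/-- If `g` is differentiable with compact support, then `div (g(z) z) = n g(z) + Dg(z) z`
integrates to zero as soon as the radial derivative `Dg(z) z` is integrable. -/
theorem integral_fderiv_apply_self_eq {g : E → ℝ} (hg : Differentiable ℝ g)
    (hc : HasCompactSupport g) (hn : 0 < Module.finrank ℝ E)
    (hm : Integrable (fun z => fderiv ℝ g z z) μ) :
    ∫ z, fderiv ℝ g z z ∂μ = -(Module.finrank ℝ E : ℝ) * ∫ z, g z ∂μ := by
  set n := Module.finrank ℝ E
  set m : E → ℝ := fun z => fderiv ℝ g z z with hmdef
  have hmm : Measurable m := by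
    have h := measurable_fderiv ℝ g
    have h2 : Measurable fun z => ((fderiv ℝ g z, z) : (E →L[ℝ] ℝ) × E) := h.prodMk measurable_id
    have h3 : Measurable fun q : (E →L[ℝ] ℝ) × E => q.1 q.2 :=
      (isBoundedBilinearMap_apply (𝕜 := ℝ) (E := E) (F := ℝ)).continuous.measurable
    exact h3.comp h2
  have hgi : Integrable g μ := hg.continuous.integrable_of_hasCompactSupport hc
  -- The function `m (e^s z)` is integrated over `E × (0, 1]` in both orders. In `s` it is a
  -- derivative, which gives `g (e z) - g z`; in `z` scaling gives `e^(-ns) ∫ m`. Comparing the two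
  -- yields `(1 - e^(-n)) (∫ m + n ∫ g) = 0`. No continuity of the derivative of `g` is needed.
  have hder : ∀ z : E, ∀ s : ℝ, HasDerivAt (fun s => g (Real.exp s • z)) (m (Real.exp s • z)) s := by
    intro z s
    have h1 : HasDerivAt (fun s : ℝ => Real.exp s • z) (Real.exp s • z) s :=
      (Real.hasDerivAt_exp s).smul_const z
    exact (hg (Real.exp s • z)).hasFDerivAt.comp_hasDerivAt s h1
  let ν : Measure ℝ := volume.restrict (Ioc 0 1)
  have hscale : ∀ s : ℝ, ∀ f : E → ℝ, ∫ z, f (Real.exp s • z) ∂μ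
      = Real.exp (-(n * s)) * ∫ z, f z ∂μ := by
    intro s f
    rw [Measure.integral_comp_smul, smul_eq_mul]
    congr 1
    rw [abs_of_pos (by positivity), ← Real.exp_nat_mul, ← Real.exp_neg]
  have hint : Integrable (fun q : E × ℝ => m (Real.exp q.2 • q.1)) (μ.prod ν) := by
    have hmeas : AEStronglyMeasurable (fun q : E × ℝ => m (Real.exp q.2 • q.1)) (μ.prod ν) := by
      refine (hmm.comp ?_).aestronglyMeasurable
      exact ((Real.continuous_exp.comp continuous_snd).smul continuous_fst).measurable
    rw [integrable_prod_iff' hmeas]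
    constructor
    · filter_upwards with s
      exact hm.comp_smul (Real.exp_pos s).ne'
    · have : (fun s : ℝ => ∫ z, ‖m (Real.exp s • z)‖ ∂μ)
          = fun s => Real.exp (-(n * s)) * ∫ z, ‖m z‖ ∂μ :=
        funext fun s => hscale s fun z => ‖m z‖
      simp only [this]
      have hcont : Continuous fun s : ℝ => Real.exp (-(n * s)) * ∫ z, ‖m z‖ ∂μ := by fun_prop
      exact (hcont.integrableOn_Icc (a := 0) (b := 1)).mono_set Ioc_subset_Icc_self
  have hn' : (0 : ℝ) < n := by exact_mod_cast hn
  have hswap := integral_integral_swap (f := fun (z : E) (s : ℝ) => m (Real.exp s • z)) hint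
  have hleft : ∫ z, ∫ s, m (Real.exp s • z) ∂ν ∂μ = ∫ z, (g (Real.exp 1 • z) - g z) ∂μ := by
    refine integral_congr_ae ?_
    filter_upwards [hint.prod_right_ae] with z hz
    have := intervalIntegral.integral_eq_sub_of_hasDerivAt (a := 0) (b := 1)
      (fun s _ => hder z s) ((intervalIntegrable_iff_integrableOn_Ioc_of_le zero_le_one).2 hz)
    rw [intervalIntegral.integral_of_le zero_le_one] at this
    simpa using this
  have hright : ∫ s, ∫ z, m (Real.exp s • z) ∂μ ∂ν
      = (1 - Real.exp (-n)) / n * ∫ z, m z ∂μ := by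
    simp_rw [hscale _ m]
    rw [integral_mul_const]
    congr 1
    have h1 : ∀ s ∈ uIcc (0 : ℝ) 1,
        HasDerivAt (fun s : ℝ => -Real.exp (-(n * s)) / n) (Real.exp (-(n * s))) s := by
      intro s _
      have h2 : HasDerivAt (fun s : ℝ => -(n * s)) (-(n : ℝ)) s := by
        simpa [Pi.neg_def] using ((hasDerivAt_id s).const_mul (n : ℝ)).neg
      have h3 := (h2.exp.neg.div_const (n : ℝ))
      have h4 : Real.exp (-(n * s)) = -(Real.exp (-(n * s)) * -(n : ℝ)) / n := by field_simp
      rw [h4]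
      exact h3
    have := intervalIntegral.integral_eq_sub_of_hasDerivAt h1
      ((by fun_prop : Continuous fun s : ℝ => Real.exp (-(n * s))).intervalIntegrable 0 1)
    rw [intervalIntegral.integral_of_le zero_le_one] at this
    rw [this]
    simp
    ring
  rw [hleft, hright, integral_sub (hgi.comp_smul (Real.exp_pos 1).ne') hgi, hscale 1 g] at hswap
  have he : (1 : ℝ) - Real.exp (-n) ≠ 0 := by
    have : Real.exp (-n) < 1 := by rw [Real.exp_lt_one_iff]; linarith
    linarith
  have h5 : (1 - Real.exp (-n)) * ((∫ z, m z ∂μ) + n * ∫ z, g z ∂μ) = 0 := by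
    rw [mul_one] at hswap
    field_simp at hswap
    linear_combination -hswap
  have := (mul_eq_zero.1 h5).resolve_left he
  linarith

end Dilation

/-! ### Approximation of compactly supported functions in `C^1` -/

section Mollification

variable {E : Type*} [NormedAddCommGroup E] [InnerProductSpace ℝ E] [FiniteDimensional ℝ E]
  [MeasurableSpace E] [BorelSpace E]

/-- A compactly supported `C^1` function is approximated in `C^1` by smooth functions supported
in a fixed compact neighbourhood of its support. -/
theorem exists_contDiff_approx {Ω : Set E} (hΩ : IsOpen Ω) {φ : E → ℝ}
    (hφ : ContDiff ℝ 1 φ) (hc : HasCompactSupport φ) (hs : tsupport φ ⊆ Ω) :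
    ∃ K : Set E, IsCompact K ∧ K ⊆ Ω ∧ ∀ ε > 0, ∃ ψ : E → ℝ, ContDiff ℝ ∞ ψ ∧ tsupport ψ ⊆ K ∧
      ∀ x, |ψ x - φ x| ≤ ε ∧ ‖fderiv ℝ ψ x - fderiv ℝ φ x‖ ≤ ε := by
  obtain ⟨δ, hδ, hδΩ⟩ := IsCompact.exists_cthickening_subset_open hc hΩ hs
  refine ⟨Metric.cthickening δ (tsupport φ), IsCompact.cthickening hc, hδΩ, fun ε hε => ?_⟩
  have hu1 : UniformContinuous φ := hc.uniformContinuous_of_continuous hφ.continuous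
  have hf1 : Continuous (fderiv ℝ φ) := hφ.continuous_fderiv one_ne_zero
  have hu2 : UniformContinuous (fderiv ℝ φ) :=
    (hc.fderiv ℝ).uniformContinuous_of_continuous hf1
  obtain ⟨δ₁, hδ₁, h1⟩ := Metric.uniformContinuous_iff.1 hu1 ε hε
  obtain ⟨δ₂, hδ₂, h2⟩ := Metric.uniformContinuous_iff.1 hu2 ε hε
  -- The mollification radius: at most `δ` to keep the support in the thickening, at most `δ₁` and
  -- `δ₂` for the moduli of continuity of `φ` and of its derivative.
  set r := min δ (min δ₁ δ₂) with hr
  have hrpos : 0 < r := by positivity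
  let χ : ContDiffBump (0 : E) := ⟨r / 2, r, by positivity, by linarith⟩
  have hloc : LocallyIntegrable φ volume := hφ.continuous.locallyIntegrable
  have hχc : HasCompactSupport (χ.normed volume) := χ.hasCompactSupport_normed
  refine ⟨convolution (χ.normed volume) φ (ContinuousLinearMap.lsmul ℝ ℝ) volume, ?_, ?_, ?_⟩
  · exact hχc.contDiff_convolution_left _ χ.contDiff_normed hloc
  · have hsub : Function.support (convolution (χ.normed volume) φ
        (ContinuousLinearMap.lsmul ℝ ℝ) volume) ⊆ Metric.cthickening δ (tsupport φ) := by
      refine (support_convolution_subset (L := ContinuousLinearMap.lsmul ℝ ℝ)).trans ?_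
      rw [χ.support_normed_eq]
      rintro _ ⟨a, ha, b, hb, rfl⟩
      refine Metric.mem_cthickening_of_dist_le _ b _ _ (subset_tsupport _ hb) ?_
      have : ‖a‖ < r := by simpa using ha
      simpa [dist_eq_norm] using this.le.trans (min_le_left _ _)
    exact closure_minimal hsub Metric.isClosed_cthickening
  · intro x
    constructor
    · have := ContDiffBump.dist_normed_convolution_le (φ := χ) (μ := volume) (x₀ := x) (ε := ε)
        (g := φ) hφ.continuous.aestronglyMeasurable (fun y hy => (h1 (lt_of_lt_of_le
          (Metric.mem_ball.1 hy) ((min_le_right _ _).trans (min_le_left _ _)))).le)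
      simpa [Real.dist_eq] using this
    · have hder := HasCompactSupport.hasFDerivAt_convolution_right (μ := (volume : Measure E))
        (f := χ.normed volume) (ContinuousLinearMap.lsmul ℝ ℝ) hc
        (χ.continuous_normed.locallyIntegrable) hφ x
      rw [hder.fderiv]
      have := ContDiffBump.dist_normed_convolution_le (φ := χ) (μ := volume) (x₀ := x) (ε := ε)
        (g := fderiv ℝ φ) hf1.aestronglyMeasurable (fun y hy => (h2 (lt_of_lt_of_le
          (Metric.mem_ball.1 hy) ((min_le_right _ _).trans (min_le_right _ _)))).le)
      rw [dist_eq_norm] at this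
      exact this

end Mollification

/-! ### The area formula for `C^1` graphs -/

section LocalComparison

variable {X : Type*} [TopologicalSpace X] [SecondCountableTopology X] [MeasurableSpace X]
  [OpensMeasurableSpace X]

/-- An inequality between measures of small sets extends to all sets. -/
theorem measure_le_of_locally_le {σ τ : Measure X} {B : Set X}
    (h : ∀ x ∈ B, ∃ W, IsOpen W ∧ x ∈ W ∧ ∀ S, MeasurableSet S → S ⊆ W → σ S ≤ τ S)
    {S : Set X} (hS : MeasurableSet S) (hSB : S ⊆ B) : σ S ≤ τ S := by
  choose! W hWo hxW hW using h
  -- By the Lindelöf property countably many of the sets `W x` cover `B`; made disjoint, they allow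
  -- the local inequalities to be summed.
  obtain ⟨t, htB, htc, ht⟩ := TopologicalSpace.countable_cover_nhdsWithin
    (s := B) (f := W) fun x hx => mem_nhdsWithin_of_mem_nhds ((hWo x hx).mem_nhds (hxW x hx))
  rcases t.eq_empty_or_nonempty with rfl | hne
  · have : S = ∅ := by
      rw [← subset_empty_iff]
      simpa using hSB.trans ht
    simp [this]
  obtain ⟨a, rfl⟩ := htc.exists_eq_range hne
  have haB : ∀ n, a n ∈ B := fun n => htB (mem_range_self n)
  let D : ℕ → Set X := disjointed fun n => W (a n)
  have hDm : ∀ n, MeasurableSet (D n) :=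
    MeasurableSet.disjointed fun n => (hWo _ (haB n)).measurableSet
  have hDd : Pairwise (Function.onFun Disjoint fun n => S ∩ D n) := fun i j hij =>
    (disjoint_disjointed _ hij).mono inter_subset_right inter_subset_right
  have hSU : S = ⋃ n, S ∩ D n := by
    rw [← inter_iUnion, iUnion_disjointed, eq_comm, inter_eq_left]
    refine hSB.trans (ht.trans ?_)
    simp
  rw [hSU, measure_iUnion hDd fun n => hS.inter (hDm n),
    measure_iUnion hDd fun n => hS.inter (hDm n)]
  exact ENNReal.tsum_le_tsum fun n => hW _ (haB n) _ (hS.inter (hDm n))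
    (inter_subset_right.trans (disjointed_subset _ _))

end LocalComparison

theorem LipschitzOnWith.euclideanHausdorffMeasure_image_le {X Y : Type*}
    [EMetricSpace X] [EMetricSpace Y] [MeasurableSpace X] [BorelSpace X] [MeasurableSpace Y]
    [BorelSpace Y] {C : NNReal} {f : X → Y} {s : Set X} (h : LipschitzOnWith C f s) (d : ℕ) :
    μHE[d] (f '' s) ≤ (C : ℝ≥0∞) ^ d * μHE[d] s := by
  simp_rw [Measure.euclideanHausdorffMeasure_def, Measure.smul_apply, ENNReal.smul_def, smul_eq_mul]
  rw [mul_left_comm]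
  gcongr
  simpa using h.hausdorffMeasure_image_le (d := d) (by positivity)

section Split

set_option linter.unusedSectionVars false

variable {K E : Type*} [NormedAddCommGroup K] [InnerProductSpace ℝ K] [FiniteDimensional ℝ K]
  [CompleteSpace K] [MeasurableSpace K] [BorelSpace K]
  [NormedAddCommGroup E] [InnerProductSpace ℝ E] [FiniteDimensional ℝ E]
  [MeasurableSpace E] [BorelSpace E]

/-- `S` identifies `E` with the orthogonal sum of `K` and a line. -/
def IsOrthoSplit (S : (K × ℝ) ≃L[ℝ] E) : Prop :=
  ∀ a b, ⟪S a, S b⟫_ℝ = ⟪a.1, b.1⟫_ℝ + a.2 * b.2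

theorem IsOrthoSplit.norm_sq {S : (K × ℝ) ≃L[ℝ] E} (hS : IsOrthoSplit S) (a : K × ℝ) :
    ‖S a‖ ^ 2 = ‖a.1‖ ^ 2 + a.2 ^ 2 := by
  rw [← real_inner_self_eq_norm_sq, hS, real_inner_self_eq_norm_sq]
  ring

/-- The product `K × ℝ` carries the sup norm, so `S` is not an isometry on it. It becomes one on the
`L²` product, and the passage between the two products preserves volume. -/
theorem IsOrthoSplit.measurePreserving {S : (K × ℝ) ≃L[ℝ] E} (hS : IsOrthoSplit S) :
    MeasurePreserving S := by
  let L : WithLp 2 (K × ℝ) ≃ₗᵢ[ℝ] E :=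
    { toLinearEquiv := (WithLp.linearEquiv 2 ℝ (K × ℝ)).trans S.toLinearEquiv
      norm_map' := fun x => by
        have h := hS.norm_sq (WithLp.ofLp x)
        have h2 := WithLp.prod_norm_sq_eq_of_L2 x
        simp only [Real.norm_eq_abs, sq_abs] at h2
        rw [← abs_of_nonneg (norm_nonneg x), ← abs_norm (((WithLp.linearEquiv 2 ℝ (K × ℝ)).trans
          S.toLinearEquiv) x), ← sq_eq_sq_iff_abs_eq_abs, h2]
        exact h }
  exact L.measurePreserving.comp (WithLp.volume_preserving_toLp K ℝ)

/-- An orthonormal basis of the hyperplane orthogonal to `e` supplies the first factor, and `e`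
spans the second. -/
theorem exists_isOrthoSplit {m : ℕ} (hm : Module.finrank ℝ E = m + 1) {e : E} (he : ‖e‖ = 1) :
    ∃ S : (EuclideanSpace ℝ (Fin m) × ℝ) ≃L[ℝ] E, IsOrthoSplit S ∧ S (0, 1) = e := by
  have he0 : e ≠ 0 := by rintro rfl; simp at he
  have : Fact (Module.finrank ℝ E = m + 1) := ⟨hm⟩
  have hrank : Module.finrank ℝ (ℝ ∙ e)ᗮ = m := Submodule.finrank_orthogonal_span_singleton he0
  let b : EuclideanSpace ℝ (Fin m) ≃ₗᵢ[ℝ] (ℝ ∙ e)ᗮ :=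
    ((stdOrthonormalBasis ℝ (ℝ ∙ e)ᗮ).reindex (finCongr hrank)).repr.symm
  let A : (EuclideanSpace ℝ (Fin m) × ℝ) →ₗ[ℝ] E :=
    ((ℝ ∙ e)ᗮ.subtype ∘ₗ b.toLinearEquiv.toLinearMap).coprod (LinearMap.toSpanSingleton ℝ E e)
  have hA : ∀ a, A a = (b a.1 : E) + a.2 • e := fun a => rfl
  have hbe : ∀ k, ⟪(b k : E), e⟫_ℝ = 0 := fun k =>
    Submodule.mem_orthogonal_singleton_iff_inner_left.1 (b k).2
  have hinner : ∀ a c, ⟪A a, A c⟫_ℝ = ⟪a.1, c.1⟫_ℝ + a.2 * c.2 := by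
    intro a c
    have h1 : ⟪(b a.1 : E), (b c.1 : E)⟫_ℝ = ⟪a.1, c.1⟫_ℝ := by
      rw [← Submodule.coe_inner, b.inner_map_map]
    have h2 : ⟪e, (b c.1 : E)⟫_ℝ = 0 := by rw [real_inner_comm, hbe]
    rw [hA, hA, inner_add_left, inner_add_right, inner_add_right, inner_smul_left, inner_smul_right,
      inner_smul_left, inner_smul_right, hbe, h1, h2, real_inner_self_eq_norm_sq, he]
    simp
  have hinj : Function.Injective A := by
    rw [injective_iff_map_eq_zero]
    intro a ha
    have := hinner a a
    rw [ha, inner_zero_left, real_inner_self_eq_norm_sq] at this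
    have h1 : ‖a.1‖ ^ 2 = 0 := by nlinarith [sq_nonneg ‖a.1‖, mul_self_nonneg a.2]
    have h2 : a.2 * a.2 = 0 := by nlinarith [sq_nonneg ‖a.1‖, mul_self_nonneg a.2]
    exact Prod.ext (by simpa using h1) (by simpa using h2)
  have hbij : Function.Bijective A := by
    refine ⟨hinj, (LinearMap.injective_iff_surjective_of_finrank_eq_finrank ?_).1 hinj⟩
    simp [hm]
  refine ⟨(LinearEquiv.ofBijective A hbij).toContinuousLinearEquiv, fun a c => hinner a c, ?_⟩
  change A (0, 1) = e
  simp [hA]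

/-- The volume distortion of the graph of the linear form `⟨a, ·⟩`. -/
theorem IsOrthoSplit.normDet_graph {S : (K × ℝ) ≃L[ℝ] E} (hS : IsOrthoSplit S) (a : K) (A : K →ₗ[ℝ] E)
    (hA : ∀ v, A v = S (v, ⟪a, v⟫_ℝ)) : A.normDet = √(1 + ‖a‖ ^ 2) := by
  let b := stdOrthonormalBasis ℝ K
  have h := A.normDet_sq_eq_det_gram b
  -- The Gram matrix is a rank-one perturbation of the identity, so its determinant follows from the
  -- matrix determinant lemma.
  have hg : Matrix.gram ℝ (fun i => A (b i))
      = 1 + Matrix.replicateCol Unit (fun i => ⟪a, b i⟫_ℝ)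
        * Matrix.replicateRow Unit (fun i => ⟪a, b i⟫_ℝ) := by
    ext i j
    rw [Matrix.gram_apply, hA, hA, hS]
    simp [Matrix.mul_apply, Matrix.one_apply, b.inner_eq_ite]
  rw [hg, Matrix.det_one_add_replicateCol_mul_replicateRow] at h
  have h2 : (fun i => ⟪a, b i⟫_ℝ) ⬝ᵥ (fun i => ⟪a, b i⟫_ℝ) = ‖a‖ ^ 2 := by
    rw [← b.sum_sq_inner_right a]
    simp [dotProduct, sq, real_inner_comm]
  rw [h2] at h
  rw [← h]
  simp [Real.sqrt_sq A.normDet_nonneg]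

/-- The density of the surface measure of the graph of `g`. -/
noncomputable def graphDensity (g : K → ℝ) (k : K) : ℝ := √(1 + ‖gradient g k‖ ^ 2)

theorem graphDensity_pos (g : K → ℝ) (k : K) : 0 < graphDensity g k :=
  Real.sqrt_pos.2 (by positivity)

theorem gradient_continuousOn {F : Type*} [NormedAddCommGroup F] [InnerProductSpace ℝ F]
    [CompleteSpace F] {B : Set F} (hB : IsOpen B) {g : F → ℝ}
    (hg : ContDiffOn ℝ 1 g B) : ContinuousOn (gradient g) B :=
  (InnerProductSpace.toDual ℝ F).symm.continuous.comp_continuousOn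
    (hg.continuousOn_fderiv_of_isOpen hB le_rfl)

theorem graphDensity_continuousOn {B : Set K} (hB : IsOpen B) {g : K → ℝ}
    (hg : ContDiffOn ℝ 1 g B) : ContinuousOn (graphDensity g) B :=
  Real.continuous_sqrt.comp_continuousOn
    (continuousOn_const.add ((gradient_continuousOn hB hg).norm.pow 2))

/-- Near `k₀` the graph map is so close to its linearisation `A` that the maps between the two
images are `κ`-Lipschitz in both directions, and the measure of an image under `A` is known exactly.
The exponent `d + 1` collects a factor `κ ^ d` from the Lipschitz maps and a factor `κ` from the
oscillation of the density. -/
theorem IsOrthoSplit.graph_locally {S : (K × ℝ) ≃L[ℝ] E} (hS : IsOrthoSplit S) {B : Set K}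
    (hB : IsOpen B) {g : K → ℝ} (hg : ContDiffOn ℝ 1 g B) {k₀ : K} (hk₀ : k₀ ∈ B)
    {κ : NNReal} (hκ : 1 < κ) :
    ∃ W, IsOpen W ∧ k₀ ∈ W ∧ ∀ T, MeasurableSet T → T ⊆ W →
      μHE[Module.finrank ℝ K] ((fun k => S (k, g k)) '' T)
        ≤ (κ : ℝ≥0∞) ^ (Module.finrank ℝ K + 1) * ∫⁻ k in T, ENNReal.ofReal (graphDensity g k) ∧
      ∫⁻ k in T, ENNReal.ofReal (graphDensity g k)
        ≤ (κ : ℝ≥0∞) ^ (Module.finrank ℝ K + 1)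
          * μHE[Module.finrank ℝ K] ((fun k => S (k, g k)) '' T) := by
  set d := Module.finrank ℝ K
  set Γ : K → E := fun k => S (k, g k) with hΓ
  have hκ0 : (0 : ℝ) < κ := by positivity
  have hκ1 : (1 : ℝ) < κ := by exact_mod_cast hκ
  let A : K →L[ℝ] E := (S : (K × ℝ) →L[ℝ] E).comp
    ((ContinuousLinearMap.id ℝ K).prod (fderiv ℝ g k₀))
  have hA : ∀ v, A v = S (v, ⟪gradient g k₀, v⟫_ℝ) := fun v => by
    rw [inner_gradient_left]; rfl
  have hAn : ∀ v, ‖v‖ ≤ ‖A v‖ := fun v => by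
    have := hS.norm_sq (v, ⟪gradient g k₀, v⟫_ℝ)
    rw [← hA] at this
    refine le_of_sq_le_sq ?_ (norm_nonneg _)
    simp only at this
    nlinarith [sq_nonneg ⟪gradient g k₀, v⟫_ℝ]
  have hgs : HasStrictFDerivAt g (fderiv ℝ g k₀) k₀ :=
    (hg.contDiffAt (hB.mem_nhds hk₀)).hasStrictFDerivAt one_ne_zero
  have hΓs : HasStrictFDerivAt Γ A k₀ :=
    S.hasStrictFDerivAt.comp k₀ ((hasStrictFDerivAt_id k₀).prodMk hgs)
  -- Chosen so that `1 + δ ≤ κ` and `1 - δ = κ⁻¹`, as required for the two Lipschitz bounds.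
  set δ : ℝ := 1 - (κ : ℝ)⁻¹ with hδ
  have hκi : (κ : ℝ)⁻¹ < 1 := inv_lt_one_of_one_lt₀ hκ1
  have hδ0 : 0 < δ := by linarith
  obtain ⟨s, hs, hsA⟩ := hΓs.approximates_deriv_on_nhds (c := δ.toNNReal)
    (Or.inr (Real.toNNReal_pos.2 hδ0))
  have hJc : ContinuousAt (graphDensity g) k₀ :=
    (graphDensity_continuousOn hB hg).continuousAt (hB.mem_nhds hk₀)
  have hJ0 := graphDensity_pos g k₀
  have hJ1 : ∀ᶠ k in 𝓝 k₀, graphDensity g k < κ * graphDensity g k₀ :=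
    hJc.eventually_lt continuousAt_const (by nlinarith)
  have hJ2 : ∀ᶠ k in 𝓝 k₀, graphDensity g k₀ < κ * graphDensity g k :=
    continuousAt_const.eventually_lt (hJc.const_mul _) (by nlinarith)
  obtain ⟨W, hWsub, hWo, hkW⟩ := mem_nhds_iff.1 (inter_mem hs (hJ1.and hJ2))
  -- As `A` does not contract distances, an error relative to `‖x - y‖` is also an error relative to
  -- `‖A x - A y‖`.
  have hsA' : ∀ x ∈ W, ∀ y ∈ W, ‖Γ x - Γ y - (A x - A y)‖ ≤ δ * ‖A x - A y‖ := by
    intro x hx y hy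
    have h := hsA x (hWsub hx).1 y (hWsub hy).1
    rw [map_sub, Real.coe_toNNReal _ hδ0.le] at h
    refine h.trans ?_
    rw [← map_sub]
    exact mul_le_mul_of_nonneg_left (hAn _) hδ0.le
  let Q : E → K := fun z => (S.symm z).1
  have hQΓ : ∀ k, Q (Γ k) = k := fun k => by simp [Q, Γ]
  have hQA : ∀ k, Q (A k) = k := fun k => by simp [Q, hA]
  have hvol : ∀ T : Set K, μHE[d] (A '' T) = ENNReal.ofReal (graphDensity g k₀) * volume T := by
    intro T
    have := A.toLinearMap.euclideanHausdorffMeasure_image_eq_normDet_mul_volume T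
    rw [hS.normDet_graph (gradient g k₀) A.toLinearMap hA] at this
    exact this
  refine ⟨W, hWo, hkW, fun T hTm hTW => ?_⟩
  have hlip1 : LipschitzOnWith κ (fun z => Γ (Q z)) (A '' T) := by
    refine LipschitzOnWith.of_dist_le_mul ?_
    rintro _ ⟨x, hx, rfl⟩ _ ⟨y, hy, rfl⟩
    rw [hQA, hQA, dist_eq_norm, dist_eq_norm]
    have h1 := hsA' x (hTW hx) y (hTW hy)
    have h2 : ‖Γ x - Γ y‖ ≤ ‖Γ x - Γ y - (A x - A y)‖ + ‖A x - A y‖ := by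
      simpa using norm_add_le (Γ x - Γ y - (A x - A y)) (A x - A y)
    have h3 : 1 + δ ≤ κ := by
      have : (κ : ℝ) * (κ : ℝ)⁻¹ = 1 := mul_inv_cancel₀ hκ0.ne'
      nlinarith
    nlinarith [norm_nonneg (A x - A y)]
  have hlip2 : LipschitzOnWith κ (fun z => A (Q z)) (Γ '' T) := by
    refine LipschitzOnWith.of_dist_le_mul ?_
    rintro _ ⟨x, hx, rfl⟩ _ ⟨y, hy, rfl⟩
    rw [hQΓ, hQΓ, dist_eq_norm, dist_eq_norm]
    have h1 := hsA' x (hTW hx) y (hTW hy)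
    have h2 : ‖A x - A y‖ ≤ ‖Γ x - Γ y - (A x - A y)‖ + ‖Γ x - Γ y‖ := by
      have := norm_sub_norm_le (A x - A y) (Γ x - Γ y)
      rw [norm_sub_rev (A x - A y)] at this
      linarith
    have h3 : (κ : ℝ)⁻¹ * ‖A x - A y‖ ≤ ‖Γ x - Γ y‖ := by
      rw [show (κ : ℝ)⁻¹ = 1 - δ by simp [hδ]]; linarith
    rwa [inv_mul_le_iff₀ hκ0] at h3
  have him1 : (fun z => Γ (Q z)) '' (A '' T) = Γ '' T := by
    rw [image_image]; simp only [hQA]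
  have him2 : (fun z => A (Q z)) '' (Γ '' T) = A '' T := by
    rw [image_image]; simp only [hQΓ]
  have hint1 : ENNReal.ofReal (graphDensity g k₀) * volume T
      ≤ κ * ∫⁻ k in T, ENNReal.ofReal (graphDensity g k) := by
    rw [← setLIntegral_const, ← lintegral_const_mul' _ _ (by simp)]
    refine setLIntegral_mono_ae' hTm (Eventually.of_forall fun k hk => ?_)
    rw [← ENNReal.ofReal_coe_nnreal, ← ENNReal.ofReal_mul (by positivity)]
    exact ENNReal.ofReal_le_ofReal (hWsub (hTW hk)).2.2.le
  have hint2 : ∫⁻ k in T, ENNReal.ofReal (graphDensity g k)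
      ≤ κ * (ENNReal.ofReal (graphDensity g k₀) * volume T) := by
    rw [← setLIntegral_const, ← lintegral_const_mul' _ _ (by simp)]
    refine setLIntegral_mono_ae' hTm (Eventually.of_forall fun k hk => ?_)
    rw [← ENNReal.ofReal_coe_nnreal, ← ENNReal.ofReal_mul (by positivity)]
    exact ENNReal.ofReal_le_ofReal (hWsub (hTW hk)).2.1.le
  constructor
  · have h := hlip1.euclideanHausdorffMeasure_image_le d
    rw [him1, hvol] at h
    refine h.trans ?_
    rw [pow_succ, mul_assoc]
    gcongr
  · have h := hlip2.euclideanHausdorffMeasure_image_le d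
    rw [him2, hvol] at h
    refine hint2.trans ?_
    rw [pow_succ', mul_assoc]
    gcongr

theorem ENNReal.le_of_forall_one_lt_pow_mul {a b : ℝ≥0∞} {d : ℕ}
    (h : ∀ κ : NNReal, 1 < κ → a ≤ (κ : ℝ≥0∞) ^ d * b) : a ≤ b := by
  by_cases hb : b = ⊤
  · simp [hb]
  have h1 : Tendsto (fun n : ℕ => ((1 + 1 / ((n : NNReal) + 1) : NNReal) : ℝ≥0∞)) atTop
      (𝓝 ((1 : NNReal) : ℝ≥0∞)) := by
    rw [ENNReal.tendsto_coe]
    simpa using tendsto_const_nhds.add (tendsto_one_div_add_atTop_nhds_zero_nat (𝕜 := NNReal))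
  have h2 := ENNReal.Tendsto.mul_const (b := b) (ENNReal.Tendsto.pow h1 (n := d)) (Or.inr hb)
  simp only [ENNReal.coe_one, one_pow, one_mul] at h2
  refine ge_of_tendsto h2 (Eventually.of_forall fun n => h _ ?_)
  exact lt_add_of_pos_right _ (by positivity)

/-- The area formula for graphs. -/
theorem IsOrthoSplit.map_restrict_graph {S : (K × ℝ) ≃L[ℝ] E} (hS : IsOrthoSplit S) {B : Set K}
    (hB : IsOpen B) {g : K → ℝ} (hg : ContDiffOn ℝ 1 g B) :
    (μHE[Module.finrank ℝ K].restrict ((fun k => S (k, g k)) '' B)).map (fun z => (S.symm z).1)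
      = (volume.restrict B).withDensity fun k => ENNReal.ofReal (graphDensity g k) := by
  set d := Module.finrank ℝ K
  set Γ : K → E := fun k => S (k, g k) with hΓ
  have hQ : Measurable fun z : E => (S.symm z).1 :=
    (continuous_fst.comp S.symm.continuous).measurable
  ext T hT
  have h1 : (μHE[d].restrict (Γ '' B)).map (fun z : E => (S.symm z).1) T
      = μHE[d] (Γ '' (T ∩ B)) := by
    rw [Measure.map_apply hQ hT, Measure.restrict_apply (hQ hT)]
    congr 1
    ext z
    constructor
    · rintro ⟨hz, k, hk, rfl⟩
      exact ⟨k, ⟨by simpa [Γ] using hz, hk⟩, rfl⟩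
    · rintro ⟨k, ⟨hkT, hkB⟩, rfl⟩
      exact ⟨by simpa [Γ] using hkT, k, hkB, rfl⟩
  rw [h1, withDensity_apply _ hT, Measure.restrict_restrict hT]
  have hcoe : ∀ κ : NNReal, ((κ : ℝ≥0∞) ^ (d + 1)) = ((κ ^ (d + 1) : NNReal) : ℝ≥0∞) := by simp
  have hΓ1 : ∀ T, MeasurableSet T → T ⊆ B →
      (μHE[d].restrict (Γ '' B)).map (fun z : E => (S.symm z).1) T = μHE[d] (Γ '' T) := by
    intro T hT hTB
    rw [Measure.map_apply hQ hT, Measure.restrict_apply (hQ hT)]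
    congr 1
    ext z
    constructor
    · rintro ⟨hz, k, hk, rfl⟩
      exact ⟨k, by simpa [Γ] using hz, rfl⟩
    · rintro ⟨k, hkT, rfl⟩
      exact ⟨by simpa [Γ] using hkT, k, hTB hkT, rfl⟩
  set σ := (μHE[d].restrict (Γ '' B)).map (fun z : E => (S.symm z).1)
  set τ := (volume : Measure K).withDensity fun k => ENNReal.ofReal (graphDensity g k)
  have hτ : ∀ T, MeasurableSet T → τ T = ∫⁻ k in T, ENNReal.ofReal (graphDensity g k) :=
    fun T hT => withDensity_apply _ hT
  have hTB := hT.inter hB.measurableSet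
  rw [← hΓ1 _ hTB inter_subset_right, ← hτ _ hTB]
  -- For each `κ > 1` the two measures agree locally up to the factor `κ ^ (d + 1)`, hence on all of
  -- `B`; then `κ` tends to `1`.
  refine le_antisymm (ENNReal.le_of_forall_one_lt_pow_mul (d := d + 1) fun κ hκ => ?_)
    (ENNReal.le_of_forall_one_lt_pow_mul (d := d + 1) fun κ hκ => ?_)
  · refine (measure_le_of_locally_le (σ := σ) (τ := (κ : ℝ≥0∞) ^ (d + 1) • τ) (B := B) ?_ hTB
      inter_subset_right).trans (by simp)
    intro k hk
    obtain ⟨W, hWo, hkW, hW⟩ := hS.graph_locally hB hg hk hκ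
    refine ⟨W ∩ B, hWo.inter hB, ⟨hkW, hk⟩, fun T hT hTW => ?_⟩
    rw [Measure.smul_apply, smul_eq_mul, hΓ1 T hT (hTW.trans inter_subset_right), hτ T hT]
    exact (hW T hT (hTW.trans inter_subset_left)).1
  · refine (measure_le_of_locally_le (σ := τ) (τ := (κ : ℝ≥0∞) ^ (d + 1) • σ) (B := B) ?_ hTB
      inter_subset_right).trans (by simp)
    intro k hk
    obtain ⟨W, hWo, hkW, hW⟩ := hS.graph_locally hB hg hk hκ
    refine ⟨W ∩ B, hWo.inter hB, ⟨hkW, hk⟩, fun T hT hTW => ?_⟩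
    rw [Measure.smul_apply, smul_eq_mul, hΓ1 T hT (hTW.trans inter_subset_right), hτ T hT]
    exact (hW T hT (hTW.trans inter_subset_left)).2

/-- On the graph, the graph map inverts the projection to `K`, so pushing the projected measure
forward again recovers the original one. -/
theorem IsOrthoSplit.restrict_graph {S : (K × ℝ) ≃L[ℝ] E} (hS : IsOrthoSplit S) {B : Set K}
    (hB : IsOpen B) {g : K → ℝ} (hg : ContDiffOn ℝ 1 g B)
    (hm : MeasurableSet ((fun k => S (k, g k)) '' B)) :
    μHE[Module.finrank ℝ K].restrict ((fun k => S (k, g k)) '' B)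
      = ((volume.restrict B).withDensity fun k => ENNReal.ofReal (graphDensity g k)).map
        fun k => S (k, g k) := by
  rw [← hS.map_restrict_graph hB hg]
  set μ := (μHE[Module.finrank ℝ K] : Measure E).restrict ((fun k => S (k, g k)) '' B) with hμ
  have hQ : Measurable fun z : E => (S.symm z).1 :=
    (continuous_fst.comp S.symm.continuous).measurable
  have hΓm : AEMeasurable (fun k => S (k, g k)) (μ.map fun z => (S.symm z).1) := by
    rw [hμ, hS.map_restrict_graph hB hg]
    have h1 : AEMeasurable (fun k => S (k, g k)) (volume.restrict B) :=
      (S.continuous.comp_continuousOn (continuousOn_id.prodMk hg.continuousOn)).aemeasurable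
        hB.measurableSet
    exact h1.mono_ac (withDensity_absolutelyContinuous _ _)
  rw [AEMeasurable.map_map_of_aemeasurable hΓm hQ.aemeasurable]
  have : ((fun k => S (k, g k)) ∘ fun z => (S.symm z).1) =ᵐ[μ] id := by
    rw [hμ]
    filter_upwards [ae_restrict_mem hm] with z hz
    obtain ⟨k, hk, rfl⟩ := hz
    simp
  rw [Measure.map_congr this, Measure.map_id]

end Split

section GraphIntegral

set_option linter.unusedSectionVars false

variable {K E : Type*} [NormedAddCommGroup K] [InnerProductSpace ℝ K] [FiniteDimensional ℝ K]
  [CompleteSpace K] [MeasurableSpace K] [BorelSpace K]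
  [NormedAddCommGroup E] [InnerProductSpace ℝ E] [FiniteDimensional ℝ E]
  [MeasurableSpace E] [BorelSpace E]

theorem IsOrthoSplit.integral_graph {S : (K × ℝ) ≃L[ℝ] E} (hS : IsOrthoSplit S) {B : Set K}
    (hB : IsOpen B) {g : K → ℝ} (hg : ContDiffOn ℝ 1 g B)
    (hm : MeasurableSet ((fun k => S (k, g k)) '' B)) {F : E → ℝ}
    (hF : AEStronglyMeasurable F
      (μHE[Module.finrank ℝ K].restrict ((fun k => S (k, g k)) '' B))) :
    (IntegrableOn F ((fun k => S (k, g k)) '' B) μHE[Module.finrank ℝ K] ↔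
      IntegrableOn (fun k => graphDensity g k * F (S (k, g k))) B) ∧
    ∫ z in (fun k => S (k, g k)) '' B, F z ∂μHE[Module.finrank ℝ K]
      = ∫ k in B, graphDensity g k * F (S (k, g k)) := by
  have hd : AEMeasurable (fun k => ENNReal.ofReal (graphDensity g k)) (volume.restrict B) :=
    ((graphDensity_continuousOn hB hg).aemeasurable hB.measurableSet).ennreal_ofReal
  have hΓ : AEMeasurable (fun k => S (k, g k))
      ((volume.restrict B).withDensity fun k => ENNReal.ofReal (graphDensity g k)) :=
    ((S.continuous.comp_continuousOn (continuousOn_id.prodMk hg.continuousOn)).aemeasurable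
        hB.measurableSet).mono_ac (withDensity_absolutelyContinuous _ _)
  have hr := hS.restrict_graph hB hg hm
  have hpos : ∀ k, (ENNReal.ofReal (graphDensity g k)).toReal = graphDensity g k := fun k =>
    ENNReal.toReal_ofReal (graphDensity_pos g k).le
  rw [hr] at hF
  rw [IntegrableOn, hr]
  constructor
  · rw [integrable_map_measure hF hΓ, integrable_withDensity_iff_integrable_smul₀' hd (by simp)]
    simp [hpos, IntegrableOn]
  · rw [integral_map hΓ hF, integral_withDensity_eq_integral_toReal_smul₀ hd (by simp)]
    simp [hpos]

end GraphIntegral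

/-! ### Outer normals and boundary charts -/

namespace Grushin

variable {N l : ℕ}

section Normal

variable {Ω : Set (Space N l)} {z n : Space N l}

theorem IsOuterUnitNormal.norm_eq (h : IsOuterUnitNormal Ω z n) : ‖n‖ = 1 := by
  obtain ⟨U, ρ, -, hz, -, hne, -, -, rfl⟩ := h
  rw [norm_smul, norm_inv, norm_norm]
  exact inv_mul_cancel₀ (norm_ne_zero_iff.2 (hne z hz))

/-- The sign of `⟨n, v⟩` is that of the derivative of the defining function along `v`, so it decides
whether short steps along `v` enter `Ω`. Thus `Ω` itself determines this sign, whichever defining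
function is used. -/
theorem IsOuterUnitNormal.eventually_mem_iff (h : IsOuterUnitNormal Ω z n) {v : Space N l}
    (hv : ⟪n, v⟫_ℝ ≠ 0) : ∀ᶠ t : ℝ in 𝓝[>] 0, (z + t • v ∈ Ω ↔ ⟪n, v⟫_ℝ < 0) := by
  obtain ⟨U, ρ, hU, hz, hρ, hne, hΩ, hρz, rfl⟩ := h
  have hg0 : 0 < ‖gradient ρ z‖⁻¹ := inv_pos.2 (norm_pos_iff.2 (hne z hz))
  rw [inner_smul_left, RCLike.conj_to_real] at hv ⊢
  have hneg : ∀ {c x : ℝ}, 0 < c → (c * x < 0 ↔ x < 0) := fun hc =>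
    ⟨fun h => by nlinarith, fun h => by nlinarith⟩
  rw [hneg hg0]
  have hc : ⟪gradient ρ z, v⟫_ℝ ≠ 0 := fun h => hv (by rw [h, mul_zero])
  have hd : HasDerivAt (fun t : ℝ => ρ (z + t • v)) ⟪gradient ρ z, v⟫_ℝ 0 := by
    rw [inner_gradient_left]
    have h1 : HasFDerivAt ρ (fderiv ℝ ρ z) (z + (0 : ℝ) • v) := by
      rw [zero_smul, add_zero]
      exact ((hρ.contDiffAt (hU.mem_nhds hz)).differentiableAt one_ne_zero).hasFDerivAt
    have h2 : HasDerivAt (fun t : ℝ => z + t • v) v 0 := by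
      simpa using ((hasDerivAt_id (0 : ℝ)).smul_const v).const_add z
    exact h1.comp_hasDerivAt 0 h2
  have hslope := (hasDerivAt_iff_tendsto_slope.1 hd).mono_left
    (nhdsWithin_mono 0 (fun t (ht : (0 : ℝ) < t) => ht.ne') : 𝓝[>] (0 : ℝ) ≤ 𝓝[≠] 0)
  have hUev : ∀ᶠ t : ℝ in 𝓝[>] 0, z + t • v ∈ U := by
    have : ContinuousAt (fun t : ℝ => z + t • v) 0 := by fun_prop
    exact (this.eventually (by simpa using hU.mem_nhds hz)).filter_mono nhdsWithin_le_nhds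
  have hsl : ∀ t : ℝ, slope (fun t : ℝ => ρ (z + t • v)) 0 t = t⁻¹ * ρ (z + t • v) := fun t => by
    simp [slope_def_field, hρz, div_eq_inv_mul]
  have hmem : ∀ t : ℝ, z + t • v ∈ U → (z + t • v ∈ Ω ↔ ρ (z + t • v) < 0) := fun t ht => by
    have := Set.ext_iff.1 hΩ (z + t • v)
    simpa [ht] using this
  rcases hc.lt_or_gt with hlt | hgt
  · filter_upwards [hUev, hslope.eventually_lt_const hlt, self_mem_nhdsWithin] with t h1 h2 h3
    rw [hsl, hneg (inv_pos.2 h3)] at h2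
    exact iff_of_true ((hmem t h1).2 h2) hlt
  · filter_upwards [hUev, hslope.eventually_const_lt hgt, self_mem_nhdsWithin] with t h1 h2 h3
    rw [hsl, mul_pos_iff_of_pos_left (inv_pos.2 h3)] at h2
    exact iff_of_false (fun hm => lt_asymm h2 ((hmem t h1).1 hm)) (not_lt.2 hgt.le)

/-- For two distinct unit normals the direction `n' - n` would point strictly into `Ω` according to
`n` and strictly out of it according to `n'`. -/
theorem IsOuterUnitNormal.unique {n' : Space N l} (h : IsOuterUnitNormal Ω z n)
    (h' : IsOuterUnitNormal Ω z n') : n = n' := by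
  by_contra hne
  have h1 : ⟪n, n'⟫_ℝ < 1 := by
    have := (inner_lt_one_iff_real_of_norm_eq_one h.norm_eq h'.norm_eq).2 hne
    exact this
  have e1 : ⟪n, n' - n⟫_ℝ < 0 := by
    rw [inner_sub_right, real_inner_self_eq_norm_sq, h.norm_eq]; linarith
  have e2 : 0 < ⟪n', n' - n⟫_ℝ := by
    rw [inner_sub_right, real_inner_self_eq_norm_sq, h'.norm_eq, real_inner_comm]; linarith
  obtain ⟨t, ht1, ht2⟩ := ((h.eventually_mem_iff e1.ne).and (h'.eventually_mem_iff e2.ne')).exists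
  exact absurd (ht2.1 (ht1.2 e1)) (not_lt.2 e2.le)

theorem IsOuterUnitNormal.outerNormal_eq (h : IsOuterUnitNormal Ω z n) : outerNormal Ω z = n := by
  have hex : ∃ n, IsOuterUnitNormal Ω z n := ⟨n, h⟩
  rw [outerNormal, dif_pos hex]
  exact hex.choose_spec.unique h

end Normal

/-- In the box `S (B × (a, b))` the set `Ω` is the subgraph `{t < g k}` of a `C^1` function. -/
structure IsChart (Ω : Set (Space N l)) {m : ℕ}
    (S : (EuclideanSpace ℝ (Fin m) × ℝ) ≃L[ℝ] Space N l)
    (B : Set (EuclideanSpace ℝ (Fin m))) (g : EuclideanSpace ℝ (Fin m) → ℝ) (a b : ℝ) : Prop where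
  ortho : IsOrthoSplit S
  isOpen : IsOpen B
  contDiffOn : ContDiffOn ℝ 1 g B
  mem_Ioo : ∀ k ∈ B, g k ∈ Ioo a b
  mem_iff : ∀ k ∈ B, ∀ t ∈ Ioo a b, S (k, t) ∈ Ω ↔ t < g k

theorem finrank_space {m : ℕ} (hm : N + l = m + 1) : Module.finrank ℝ (Space N l) = m + 1 := by
  simp [hm]

/-- With `n` as vertical axis the defining function has positive vertical derivative at `z`. The
implicit function theorem writes its zero set as a graph. In a box where the vertical derivative
stays positive, the function increases along vertical segments, so that `Ω` is exactly the part
below the graph. -/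
theorem IsOuterUnitNormal.exists_isChart {m : ℕ} (hm : N + l = m + 1) {Ω : Set (Space N l)}
    {z n : Space N l} (h : IsOuterUnitNormal Ω z n) :
    ∃ (S : (EuclideanSpace ℝ (Fin m) × ℝ) ≃L[ℝ] Space N l) (B : Set (EuclideanSpace ℝ (Fin m)))
      (g : EuclideanSpace ℝ (Fin m) → ℝ) (a b : ℝ), IsChart Ω S B g a b ∧ S (0, 1) = n ∧
      (S.symm z).1 ∈ B ∧ (S.symm z).2 = g (S.symm z).1 := by
  have hn1 := h.norm_eq
  obtain ⟨S, hS, hSn⟩ := exists_isOrthoSplit (finrank_space hm) hn1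
  obtain ⟨U, ρ, hU, hz, hρ, hne, hΩ, hρz, hn⟩ := h
  set w := S.symm z with hw
  have hSw : S w = z := by simp [hw]
  set f : EuclideanSpace ℝ (Fin m) × ℝ → ℝ := fun w => ρ (S w) with hf
  have hfd : ∀ w, S w ∈ U → HasFDerivAt f ((fderiv ℝ ρ (S w)).comp
      (S : (EuclideanSpace ℝ (Fin m) × ℝ) →L[ℝ] Space N l)) w := fun w hw =>
    ((hρ.contDiffAt (hU.mem_nhds hw)).differentiableAt one_ne_zero).hasFDerivAt.comp w
      S.hasFDerivAt
  have hft : ∀ w, S w ∈ U → fderiv ℝ f w (0, 1) = ⟪gradient ρ (S w), n⟫_ℝ := fun w hw => by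
    rw [(hfd w hw).fderiv, inner_gradient_left, ← hSn]; rfl
  have hpos : 0 < ⟪gradient ρ z, n⟫_ℝ := by
    rw [hn, inner_smul_right, real_inner_self_eq_norm_sq]
    have := norm_pos_iff.2 (hne z hz)
    positivity
  have hcdf : ContDiffAt ℝ 1 f w := by
    have : ContDiffAt ℝ 1 ρ (S w) := by rw [hSw]; exact hρ.contDiffAt (hU.mem_nhds hz)
    exact this.comp w S.contDiff.contDiffAt
  have hinv : (fderiv ℝ f w ∘L .inr ℝ (EuclideanSpace ℝ (Fin m)) ℝ).IsInvertible := by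
    have h1 : fderiv ℝ f w (0, 1) ≠ 0 := by
      rw [hft w (by rwa [hSw]), hSw]; exact hpos.ne'
    refine ⟨ContinuousLinearEquiv.smulLeft (Units.mk0 _ h1), ?_⟩
    ext
    simp [Units.smul_def]
  set g := hcdf.implicitFunction one_ne_zero hinv with hg
  have hgw : g w.1 = w.2 := hcdf.implicitFunction_apply_self one_ne_zero hinv
  have hgc : ContDiffAt ℝ 1 g w.1 := hcdf.contDiffAt_implicitFunction one_ne_zero hinv
  have hfw : f w = 0 := by simp [hf, hSw, hρz]
  have hgradc : ContinuousAt (fun w => ⟪gradient ρ (S w), n⟫_ℝ) w := by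
    have : ContinuousAt (gradient ρ) (S w) := by
      rw [hSw]; exact (gradient_continuousOn hU hρ).continuousAt (hU.mem_nhds hz)
    exact (this.comp S.continuous.continuousAt).inner continuousAt_const
  have hev : ∀ᶠ v in 𝓝 w, (f v = 0 ↔ g v.1 = v.2) ∧ S v ∈ U ∧ 0 < ⟪gradient ρ (S v), n⟫_ℝ := by
    refine ((hcdf.eventually_apply_eq_iff_implicitFunction one_ne_zero hinv).mono
      fun v hv => by rwa [hfw] at hv).and ((S.continuous.continuousAt.eventually
        (by rw [hSw]; exact hU.mem_nhds hz)).and ?_)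
    exact hgradc.eventually_const_lt (by simpa only [hSw] using hpos)
  rw [← Prod.mk.eta (p := w), nhds_prod_eq] at hev
  obtain ⟨p1, hp1, p2, hp2, hp⟩ := eventually_prod_iff.1 hev
  obtain ⟨δ, hδ, hδp⟩ := Metric.eventually_nhds_iff.1 hp2
  have hgI : ∀ᶠ k in 𝓝 w.1, g k ∈ Ioo (w.2 - δ) (w.2 + δ) :=
    hgc.continuousAt.eventually (Ioo_mem_nhds (by linarith) (by linarith))
  obtain ⟨B, hB, hBo, hwB⟩ := eventually_nhds_iff.1
    (hp1.and (hgI.and (hgc.eventually (by simp))))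
  refine ⟨S, B, g, w.2 - δ, w.2 + δ, ⟨hS, hBo, fun k hk => (hB k hk).2.2.contDiffWithinAt,
    fun k hk => (hB k hk).2.1, fun k hk t ht => ?_⟩, hSn, hwB, hgw.symm⟩
  have hall : ∀ s ∈ Ioo (w.2 - δ) (w.2 + δ), (f (k, s) = 0 ↔ g k = s) ∧ S (k, s) ∈ U ∧
      0 < ⟪gradient ρ (S (k, s)), n⟫_ℝ := fun s hs => by
    refine hp (hB k hk).1 (hδp ?_)
    rw [Real.dist_eq, abs_lt]
    constructor <;> linarith [hs.1, hs.2]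
  have hder : ∀ s ∈ Ioo (w.2 - δ) (w.2 + δ),
      HasDerivAt (fun s => f (k, s)) ⟪gradient ρ (S (k, s)), n⟫_ℝ s := fun s hs => by
    have h1 := (hfd (k, s) (hall s hs).2.1)
    have h2 : HasDerivAt (fun s : ℝ => (k, s)) ((0 : EuclideanSpace ℝ (Fin m)), (1 : ℝ)) s :=
      (hasDerivAt_const s k).prodMk (hasDerivAt_id s)
    have h3 := h1.comp_hasDerivAt s h2
    rwa [← h1.fderiv, hft _ (hall s hs).2.1] at h3
  have hmono : StrictMonoOn (fun s => f (k, s)) (Ioo (w.2 - δ) (w.2 + δ)) := by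
    refine strictMonoOn_of_deriv_pos (convex_Ioo _ _)
      (fun s hs => (hder s hs).continuousAt.continuousWithinAt) fun s hs => ?_
    rw [interior_Ioo] at hs
    rw [(hder s hs).deriv]
    exact (hall s hs).2.2
  have hgk := (hB k hk).2.1
  have hf0 : f (k, g k) = 0 := (hall _ hgk).1.2 rfl
  have hmemΩ : S (k, t) ∈ Ω ↔ f (k, t) < 0 := by
    have := Set.ext_iff.1 hΩ (S (k, t))
    simpa [(hall t ht).2.1] using this
  rw [hmemΩ, ← hf0]
  exact hmono.lt_iff_lt ht hgk

namespace IsChart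

variable {Ω : Set (Space N l)} {m : ℕ} {S : (EuclideanSpace ℝ (Fin m) × ℝ) ≃L[ℝ] Space N l}
  {B : Set (EuclideanSpace ℝ (Fin m))} {g : EuclideanSpace ℝ (Fin m) → ℝ} {a b : ℝ}

theorem isOpen_box (h : IsChart Ω S B g a b) : IsOpen (S '' (B ×ˢ Ioo a b)) :=
  S.toHomeomorph.isOpenMap _ (h.isOpen.prod isOpen_Ioo)

theorem mem_box {k : EuclideanSpace ℝ (Fin m)} {t : ℝ} :
    S (k, t) ∈ S '' (B ×ˢ Ioo a b) ↔ k ∈ B ∧ t ∈ Ioo a b := by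
  rw [S.injective.mem_set_image, mem_prod]

theorem frontier_inter_box (h : IsChart Ω S B g a b) (hΩ : IsOpen Ω) :
    frontier Ω ∩ S '' (B ×ˢ Ioo a b) = (fun k => S (k, g k)) '' B := by
  have hgB := h.contDiffOn.continuousOn
  ext z
  constructor
  · rintro ⟨hz, ⟨k, t⟩, ⟨hk, ht⟩, rfl⟩
    simp only at hk ht
    refine ⟨k, hk, ?_⟩
    rcases lt_trichotomy t (g k) with hlt | heq | hgt
    · have hmem : S (k, t) ∈ Ω ∩ frontier Ω := ⟨(h.mem_iff k hk t ht).2 hlt, hz⟩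
      rw [hΩ.inter_frontier_eq] at hmem
      exact absurd hmem (notMem_empty _)
    · rw [heq]
    · exfalso
      have hcl := frontier_subset_closure hz
      have hnhd : ∀ᶠ v in 𝓝 (k, t), v.1 ∈ B ∧ v.2 ∈ Ioo a b ∧ g v.1 < v.2 := by
        have e1 : ContinuousAt (fun v : EuclideanSpace ℝ (Fin m) × ℝ => g v.1) (k, t) :=
          ContinuousAt.comp (f := Prod.fst) (hgB.continuousAt (h.isOpen.mem_nhds hk))
            continuousAt_fst
        exact (continuousAt_fst.eventually (h.isOpen.mem_nhds hk)).and
          ((continuousAt_snd.eventually (isOpen_Ioo.mem_nhds ht)).and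
            (e1.eventually_lt continuousAt_snd hgt))
      have hnhd2 : ∀ᶠ z in 𝓝 (S (k, t)), z ∉ Ω := by
        have hs : ContinuousAt S.symm (S (k, t)) := S.symm.continuous.continuousAt
        rw [ContinuousAt, S.symm_apply_apply] at hs
        filter_upwards [hs.eventually hnhd] with z hz hzΩ
        have := (h.mem_iff _ hz.1 _ hz.2.1).1 (by simpa using hzΩ)
        exact absurd this (not_lt.2 hz.2.2.le)
      obtain ⟨y, hy1, hy2⟩ := mem_closure_iff_nhds.1 hcl _ hnhd2
      exact hy1 hy2
  · rintro ⟨k, hk, rfl⟩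
    have hgk := h.mem_Ioo k hk
    refine ⟨?_, mem_box.2 ⟨hk, hgk⟩⟩
    rw [hΩ.frontier_eq]
    refine ⟨?_, fun hc => lt_irrefl _ ((h.mem_iff k hk _ hgk).1 hc)⟩
    have hcont : ContinuousWithinAt (fun t => S (k, t)) (Iio (g k)) (g k) :=
      (S.continuous.comp (by fun_prop)).continuousWithinAt
    refine mem_closure_of_tendsto hcont ?_
    filter_upwards [self_mem_nhdsWithin, mem_nhdsWithin_of_mem_nhds (isOpen_Ioo.mem_nhds hgk)]
      with t h1 h2
    exact (h.mem_iff k hk t h2).2 h1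

/-- The signed height `t - g k` below the graph. -/
theorem hasGradientAt_height (h : IsChart Ω S B g a b) {w : Space N l} (hw : (S.symm w).1 ∈ B) :
    HasGradientAt (fun w => (S.symm w).2 - g (S.symm w).1)
      (S (-gradient g (S.symm w).1, 1)) w := by
  rw [hasGradientAt_iff_hasFDerivAt]
  have hg : HasFDerivAt g (fderiv ℝ g (S.symm w).1) (S.symm w).1 :=
    ((h.contDiffOn.contDiffAt (h.isOpen.mem_nhds hw)).differentiableAt one_ne_zero).hasFDerivAt
  have h1 : HasFDerivAt (fun w => (S.symm w).1) ((ContinuousLinearMap.fst ℝ _ _).comp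
      (S.symm : Space N l →L[ℝ] EuclideanSpace ℝ (Fin m) × ℝ)) w :=
    hasFDerivAt_fst.comp w S.symm.hasFDerivAt
  have h2 : HasFDerivAt (fun w => (S.symm w).2) ((ContinuousLinearMap.snd ℝ _ _).comp
      (S.symm : Space N l →L[ℝ] EuclideanSpace ℝ (Fin m) × ℝ)) w :=
    hasFDerivAt_snd.comp w S.symm.hasFDerivAt
  refine (h2.sub (hg.comp w h1)).congr_fderiv ?_
  ext v
  have hv : v = S (S.symm v) := by simp
  conv_rhs => rw [hv]
  rw [InnerProductSpace.toDual_apply_apply, h.ortho]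
  simp only [inner_neg_left, inner_gradient_left]
  simp
  ring

/-- The height `t - g k` over the graph serves as defining function; the norm of its gradient is the
area density of the graph. -/
theorem isOuterUnitNormal (h : IsChart Ω S B g a b) {k : EuclideanSpace ℝ (Fin m)} (hk : k ∈ B) :
    IsOuterUnitNormal Ω (S (k, g k)) ((graphDensity g k)⁻¹ • S (-gradient g k, 1)) := by
  have hgrad : ∀ w ∈ S '' (B ×ˢ Ioo a b), gradient (fun w => (S.symm w).2 - g (S.symm w).1) w
      = S (-gradient g (S.symm w).1, 1) := by
    rintro _ ⟨v, hv, rfl⟩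
    exact (h.hasGradientAt_height (by simpa using hv.1)).gradient
  have hmem : S (k, g k) ∈ S '' (B ×ˢ Ioo a b) := mem_box.2 ⟨hk, h.mem_Ioo k hk⟩
  refine ⟨S '' (B ×ˢ Ioo a b), fun w => (S.symm w).2 - g (S.symm w).1, h.isOpen_box, hmem,
    ?_, ?_, ?_, by simp, ?_⟩
  · have h1 : ContDiffOn ℝ 1 (fun w => (S.symm w).1) (S '' (B ×ˢ Ioo a b)) :=
      (contDiff_fst.comp S.symm.contDiff).contDiffOn
    refine (contDiff_snd.comp S.symm.contDiff).contDiffOn.sub (h.contDiffOn.comp h1 ?_)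
    rintro _ ⟨v, hv, rfl⟩
    simpa using hv.1
  · intro w hw h0
    rw [hgrad w hw] at h0
    have := congrArg Prod.snd ((S.map_eq_zero_iff).1 h0)
    simp at this
  · ext w
    constructor
    · rintro ⟨hw, ⟨k, t⟩, ⟨hk, ht⟩, rfl⟩
      refine ⟨mem_box.2 ⟨hk, ht⟩, ?_⟩
      have := (h.mem_iff k hk t ht).1 hw
      simpa using this
    · rintro ⟨⟨⟨k, t⟩, ⟨hk, ht⟩, rfl⟩, hw⟩
      refine ⟨(h.mem_iff k hk t ht).2 (by simpa using hw), mem_box.2 ⟨hk, ht⟩⟩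
  · rw [hgrad _ hmem]
    simp only [ContinuousLinearEquiv.symm_apply_apply]
    congr 2
    rw [graphDensity, ← Real.sqrt_sq (norm_nonneg (S _)), h.ortho.norm_sq]
    simp [add_comm]

theorem outerNormal_eq (h : IsChart Ω S B g a b) {k : EuclideanSpace ℝ (Fin m)} (hk : k ∈ B) :
    outerNormal Ω (S (k, g k)) = (graphDensity g k)⁻¹ • S (-gradient g k, 1) :=
  (h.isOuterUnitNormal hk).outerNormal_eq

end IsChart

end Grushin

/-! ### Functions and gradients off the support -/

section Support

theorem contDiff_of_tsupport {E : Type*} [NormedAddCommGroup E] [NormedSpace ℝ E]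
    {n : WithTop ℕ∞} {f : E → ℝ}
    (h : ∀ x ∈ tsupport f, ContDiffAt ℝ n f x) : ContDiff ℝ n f := by
  rw [contDiff_iff_contDiffAt]
  intro x
  by_cases hx : x ∈ tsupport f
  · exact h x hx
  · exact contDiffAt_const.congr_of_eventuallyEq (notMem_tsupport_iff_eventuallyEq.1 hx)

variable {E : Type*} [NormedAddCommGroup E] [InnerProductSpace ℝ E] [CompleteSpace E]

theorem gradient_eq_zero_of_notMem_tsupport {f : E → ℝ} {x : E} (hx : x ∉ tsupport f) :
    gradient f x = 0 := by
  rw [gradient, image_eq_zero_of_notMem_tsupport fun h => hx (tsupport_fderiv_subset ℝ h), map_zero]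

theorem ContDiff.continuous_gradient {f : E → ℝ} (hf : ContDiff ℝ 1 f) :
    Continuous (gradient f) :=
  (InnerProductSpace.toDual ℝ E).symm.continuous.comp (hf.continuous_fderiv one_ne_zero)

end Support

/-! ### A one-dimensional cutoff profile -/

section Transition

/-- A smooth transition from `0` on `(-∞, 1]` to `1` on `[2, ∞)`. -/
noncomputable def cutoffTransition (s : ℝ) : ℝ := Real.smoothTransition (s - 1)

theorem contDiff_cutoffTransition : ContDiff ℝ ∞ cutoffTransition :=
  Real.smoothTransition.contDiff.comp (contDiff_id.sub contDiff_const)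

theorem cutoffTransition_eq_zero {s : ℝ} (hs : s ≤ 1) : cutoffTransition s = 0 :=
  Real.smoothTransition.zero_of_nonpos (by linarith)

theorem cutoffTransition_eq_one {s : ℝ} (hs : 2 ≤ s) : cutoffTransition s = 1 :=
  Real.smoothTransition.one_of_one_le (by linarith)

theorem continuous_deriv_cutoffTransition : Continuous (deriv cutoffTransition) :=
  contDiff_cutoffTransition.continuous_deriv (by simp)

theorem deriv_cutoffTransition_eq_zero_of_le {s : ℝ} (hs : s ≤ 1) :
    deriv cutoffTransition s = 0 := by
  have h : ∀ s ∈ Iio (1 : ℝ), deriv cutoffTransition s = 0 := fun s hs => by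
    have : cutoffTransition =ᶠ[𝓝 s] fun _ => 0 := by
      filter_upwards [Iio_mem_nhds hs] with t ht
      exact cutoffTransition_eq_zero (le_of_lt ht)
    rw [this.deriv_eq, deriv_const]
  -- The endpoint is included because the derivative is continuous.
  have hc : closure (Iio (1 : ℝ)) ⊆ {s | deriv cutoffTransition s = 0} :=
    closure_minimal h (isClosed_eq continuous_deriv_cutoffTransition continuous_const)
  rw [closure_Iio] at hc
  exact hc hs

theorem deriv_cutoffTransition_eq_zero_of_ge {s : ℝ} (hs : 2 ≤ s) :
    deriv cutoffTransition s = 0 := by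
  have h : ∀ s ∈ Ioi (2 : ℝ), deriv cutoffTransition s = 0 := fun s hs => by
    have : cutoffTransition =ᶠ[𝓝 s] fun _ => 1 := by
      filter_upwards [Ioi_mem_nhds hs] with t ht
      exact cutoffTransition_eq_one (le_of_lt ht)
    rw [this.deriv_eq, deriv_const]
  have hc : closure (Ioi (2 : ℝ)) ⊆ {s | deriv cutoffTransition s = 0} :=
    closure_minimal h (isClosed_eq continuous_deriv_cutoffTransition continuous_const)
  rw [closure_Ioi] at hc
  exact hc hs

theorem hasCompactSupport_deriv_cutoffTransition :
    HasCompactSupport (deriv cutoffTransition) := by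
  refine HasCompactSupport.intro (isCompact_Icc (a := (1 : ℝ)) (b := 2)) fun s hs => ?_
  rw [mem_Icc, not_and_or, not_le, not_le] at hs
  rcases hs with hs | hs
  · exact deriv_cutoffTransition_eq_zero_of_le hs.le
  · exact deriv_cutoffTransition_eq_zero_of_ge hs.le

theorem integral_deriv_cutoffTransition : ∫ s, deriv cutoffTransition s = 1 := by
  have h1 : ∫ s in (1 : ℝ)..2, deriv cutoffTransition s = 1 := by
    rw [intervalIntegral.integral_deriv_eq_sub
      (fun s _ => (contDiff_cutoffTransition.differentiable (by simp)).differentiableAt)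
      (continuous_deriv_cutoffTransition.intervalIntegrable _ _),
      cutoffTransition_eq_zero le_rfl, cutoffTransition_eq_one le_rfl, sub_zero]
  rw [← h1, intervalIntegral.integral_of_le (by norm_num),
    setIntegral_eq_integral_of_forall_compl_eq_zero]
  intro s hs
  rw [mem_Ioc, not_and_or, not_lt, not_le] at hs
  rcases hs with hs | hs
  · exact deriv_cutoffTransition_eq_zero_of_le hs
  · exact deriv_cutoffTransition_eq_zero_of_ge hs.le

theorem cutoffTransition_mem_Icc (s : ℝ) : cutoffTransition s ∈ Icc (0 : ℝ) 1 :=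
  ⟨Real.smoothTransition.nonneg _, Real.smoothTransition.le_one _⟩

end Transition

/-! ### Flux through a boundary chart -/

namespace Grushin

variable {N l : ℕ}

namespace IsChart

variable {Ω : Set (Space N l)} {m : ℕ} {S : (EuclideanSpace ℝ (Fin m) × ℝ) ≃L[ℝ] Space N l}
  {B : Set (EuclideanSpace ℝ (Fin m))} {g : EuclideanSpace ℝ (Fin m) → ℝ} {a b : ℝ}

/-- Only the part of the boundary inside the box contributes, and that part is a graph, to which the
area formula applies. -/
theorem integral_frontier (h : IsChart Ω S B g a b) (hm : N + l = m + 1) (hΩ : IsOpen Ω)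
    {F : Space N l → ℝ} (hF : ContinuousOn F ((fun k => S (k, g k)) '' B))
    (hF0 : ∀ z ∉ S '' (B ×ˢ Ioo a b), F z = 0)
    (hint : IntegrableOn (fun k => graphDensity g k * F (S (k, g k))) B) :
    IntegrableOn F (frontier Ω) (surfaceMeasure N l) ∧
    ∫ z in frontier Ω, F z ∂surfaceMeasure N l
      = ∫ k in B, graphDensity g k * F (S (k, g k)) := by
  have hμ : surfaceMeasure N l
      = μHE[Module.finrank ℝ (EuclideanSpace ℝ (Fin m))] := by
    rw [surfaceMeasure, hm, finrank_euclideanSpace, Fintype.card_fin, Nat.add_sub_cancel]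
  have hfr := h.frontier_inter_box hΩ
  have hmeas : MeasurableSet ((fun k => S (k, g k)) '' B) := by
    rw [← hfr]
    exact isClosed_frontier.measurableSet.inter h.isOpen_box.measurableSet
  have hsub : (fun k => S (k, g k)) '' B ⊆ frontier Ω := by
    rw [← hfr]; exact inter_subset_left
  have hzero : ∀ z ∈ frontier Ω \ (fun k => S (k, g k)) '' B, F z = 0 := by
    rintro z ⟨hz, hz'⟩
    rw [← hfr] at hz'
    exact hF0 z fun hb => hz' ⟨hz, hb⟩
  rw [hμ]
  have hI := h.ortho.integral_graph h.isOpen h.contDiffOn hmeas (hF.aestronglyMeasurable hmeas)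
  refine ⟨(hI.1.2 hint).of_forall_sdiff_eq_zero isClosed_frontier.measurableSet hzero, ?_⟩
  rw [← hI.2]
  exact setIntegral_eq_of_subset_of_forall_sdiff_eq_zero isClosed_frontier.measurableSet hsub hzero

/-- Cutoffs approaching `1` from inside a chart produce the flux through the boundary. -/
theorem exists_tendsto_flux (h : IsChart Ω S B g a b) (hm : N + l = m + 1) (hΩ : IsOpen Ω)
    {β : Space N l → Space N l} (hβ : Continuous β) {η : Space N l → ℝ} (hη : ContDiff ℝ 1 η)
    (hc : HasCompactSupport η) (hs : tsupport η ⊆ S '' (B ×ˢ Ioo a b)) :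
    IntegrableOn (fun z => η z * ⟪β z, outerNormal Ω z⟫_ℝ) (frontier Ω) (surfaceMeasure N l) ∧
    ∃ χ : ℕ → Space N l → ℝ, (∀ n z, χ n z ∈ Icc (0 : ℝ) 1) ∧
      (∀ z ∈ Ω, z ∈ tsupport η → ∀ᶠ n in atTop, χ n z = 1) ∧
      (∀ n, ContDiff ℝ 1 fun z => η z * χ n z) ∧
      (∀ n, tsupport (fun z => η z * χ n z) ⊆ Ω) ∧
      Tendsto (fun n => ∫ z in Ω, ⟪β z, gradient (fun z => η z * χ n z) z⟫_ℝ) atTop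
        (𝓝 ((∫ z in Ω, ⟪β z, gradient η z⟫_ℝ)
          - ∫ z in frontier Ω, η z * ⟪β z, outerNormal Ω z⟫_ℝ ∂surfaceMeasure N l)) := by
  set V : Set (Space N l) := S '' (B ×ˢ Ioo a b) with hV
  have hVo : IsOpen V := h.isOpen_box
  set Q : Space N l → EuclideanSpace ℝ (Fin m) := fun z => (S.symm z).1 with hQ
  have hQc : Continuous Q := continuous_fst.comp S.symm.continuous
  have hQB : ∀ z ∈ V, Q z ∈ B := by
    rintro _ ⟨v, hv, rfl⟩; simpa [Q] using hv.1
  have hgradB : ContinuousOn (gradient g) B := gradient_continuousOn h.isOpen h.contDiffOn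
  set d : Space N l → ℝ := fun z => g (Q z) - (S.symm z).2 with hd
  have hdV : ContDiffOn ℝ 1 d V := by
    have h1 : ContDiffOn ℝ 1 Q V := (contDiff_fst.comp S.symm.contDiff).contDiffOn
    exact (h.contDiffOn.comp h1 hQB).sub (contDiff_snd.comp S.symm.contDiff).contDiffOn
  have hmemΩ : ∀ z ∈ V, z ∈ Ω ↔ 0 < d z := by
    rintro _ ⟨⟨k, t⟩, ⟨hk, ht⟩, rfl⟩
    simpa [d, Q] using h.mem_iff k hk t ht
  set nu : Space N l → Space N l := fun z => S (-gradient g (Q z), 1) with hnu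
  have hnuV : ContinuousOn nu V :=
    S.continuous.comp_continuousOn
      ((hgradB.comp hQc.continuousOn hQB).neg.prodMk continuousOn_const)
  have hdgrad : ∀ z ∈ V, HasGradientAt d (-nu z) z := fun z hz => by
    have := (h.hasGradientAt_height (hQB z hz)).hasFDerivAt.neg
    rw [hasGradientAt_iff_hasFDerivAt, map_neg]
    refine this.congr_of_eventuallyEq (Eventually.of_forall fun w => ?_)
    simp [d, Q]
  -- the flux density, extended by zero
  set ψ : Space N l → ℝ := fun z => η z * ⟪β z, nu z⟫_ℝ with hψ
  have hψs : tsupport ψ ⊆ tsupport η := tsupport_mul_subset_left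
  have hψ0 : ∀ z ∉ V, ψ z = 0 := fun z hz => by
    have : η z = 0 := image_eq_zero_of_notMem_tsupport fun hz' => hz (hs hz')
    simp [ψ, this]
  have hψc : Continuous ψ := continuous_of_tsupport fun z hz =>
    hη.continuous.continuousAt.mul
      (hβ.continuousAt.inner (hnuV.continuousAt (hVo.mem_nhds (hs (hψs hz)))))
  have hψcs : HasCompactSupport ψ := hc.mono' ((subset_tsupport ψ).trans hψs)
  set C : Set (EuclideanSpace ℝ (Fin m)) := Q '' tsupport η with hC
  have hCc : IsCompact C := IsCompact.image hc hQc
  have hCB : C ⊆ B := by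
    rintro _ ⟨z, hz, rfl⟩; exact hQB z (hs hz)
  have hψC : ∀ k ∉ C, ∀ t, ψ (S (k, t)) = 0 := fun k hk t => by
    refine image_eq_zero_of_notMem_tsupport fun hz => hk ⟨_, hψs hz, by simp [Q]⟩
  obtain ⟨M, hM⟩ : ∃ M, ∀ z, ‖ψ z‖ ≤ M := hψcs.exists_bound_of_continuous hψc
  have hM0 : 0 ≤ M := (norm_nonneg _).trans (hM 0)
  -- the surface integral
  have hΓB : ContinuousOn (fun k => S (k, g k)) B :=
    S.continuous.comp_continuousOn (continuousOn_id.prodMk h.contDiffOn.continuousOn)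
  have hψΓint : IntegrableOn (fun k => ψ (S (k, g k))) B := by
    have h1 : IntegrableOn (fun k => ψ (S (k, g k))) C :=
      ((hψc.comp_continuousOn hΓB).mono hCB).integrableOn_compact hCc
    exact h1.of_forall_sdiff_eq_zero h.isOpen.measurableSet fun k hk => hψC k hk.2 _
  -- The area density of the graph cancels the normalisation of the normal vector, which leaves an
  -- integrand free of square roots.
  have hfluxΓ : ∀ k ∈ B, graphDensity g k *
      (η (S (k, g k)) * ⟪β (S (k, g k)), outerNormal Ω (S (k, g k))⟫_ℝ) = ψ (S (k, g k)) := by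
    intro k hk
    have hJ := (graphDensity_pos g k).ne'
    rw [h.outerNormal_eq hk, inner_smul_right]
    simp only [ψ, nu, Q, ContinuousLinearEquiv.symm_apply_apply]
    field_simp
  have hfr := h.integral_frontier hm hΩ
    (F := fun z => η z * ⟪β z, outerNormal Ω z⟫_ℝ) (by
      have h1 : ContinuousOn (fun z => η z * ⟪β z, (graphDensity g (Q z))⁻¹ • nu z⟫_ℝ)
          ((fun k => S (k, g k)) '' B) := by
        have hsub : (fun k => S (k, g k)) '' B ⊆ V := by
          rw [← h.frontier_inter_box hΩ]; exact inter_subset_right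
        refine hη.continuous.continuousOn.mul (hβ.continuousOn.inner (ContinuousOn.smul
          (ContinuousOn.inv₀ (((graphDensity_continuousOn h.isOpen h.contDiffOn).comp
          hQc.continuousOn hQB).mono hsub) fun z _ => (graphDensity_pos _ _).ne')
          (hnuV.mono hsub)))
      refine h1.congr ?_
      rintro _ ⟨k, hk, rfl⟩
      simp only
      rw [h.outerNormal_eq hk]
      simp [nu, Q])
    (fun z hz => by
      have : η z = 0 := image_eq_zero_of_notMem_tsupport fun hz' => hz (hs hz')
      simp [this])
    (hψΓint.congr_fun (fun k hk => (hfluxΓ k hk).symm) h.isOpen.measurableSet)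
  refine ⟨hfr.1, ?_⟩
  rw [hfr.2, setIntegral_congr_fun h.isOpen.measurableSet hfluxΓ,
    setIntegral_eq_integral_of_forall_compl_eq_zero fun k hk => hψC k (fun hkC => hk (hCB hkC)) _]
  -- the cutoffs
  set ε : ℕ → ℝ := fun n => 1 / ((n : ℝ) + 1) with hε
  have hεpos : ∀ n, 0 < ε n := fun n => by positivity
  have hεlim : Tendsto ε atTop (𝓝 0) := tendsto_one_div_add_atTop_nhds_zero_nat
  set χ : ℕ → Space N l → ℝ := fun n z => cutoffTransition (d z / ε n) with hχ
  have hηχs : ∀ n, tsupport (fun z => η z * χ n z) ⊆ tsupport η := fun n =>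
    tsupport_mul_subset_left
  have hχV : ∀ n, ContDiffOn ℝ 1 (χ n) V := fun n =>
    (contDiff_cutoffTransition.of_le (by simp)).comp_contDiffOn (hdV.div_const _)
  have hχ1 : ∀ z ∈ Ω, z ∈ tsupport η → ∀ᶠ n in atTop, χ n z = 1 := by
    intro z hz hzη
    have hdz := (hmemΩ z (hs hzη)).1 hz
    filter_upwards [hεlim.eventually_lt_const (half_pos hdz)] with n hn
    refine cutoffTransition_eq_one ?_
    rw [le_div_iff₀ (hεpos n)]
    linarith
  have hsm : ∀ n, ContDiff ℝ 1 fun z => η z * χ n z := fun n =>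
    contDiff_of_tsupport fun z hz => hη.contDiffAt.mul
      ((hχV n).contDiffAt (hVo.mem_nhds (hs (hηχs n hz))))
  -- Since the gradient of `d` is `-nu`, differentiating the cutoff produces a layer of width
  -- comparable to `ε n` weighted by the flux density `ψ`.
  have hgradχ : ∀ n z, ⟪β z, gradient (fun z => η z * χ n z) z⟫_ℝ
      = χ n z * ⟪β z, gradient η z⟫_ℝ - (ε n)⁻¹ * deriv cutoffTransition (d z / ε n) * ψ z := by
    intro n z
    by_cases hz : z ∈ tsupport η
    · have h1 : HasFDerivAt η (fderiv ℝ η z) z :=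
        (hη.differentiable one_ne_zero z).hasFDerivAt
      have h2 := (hdgrad z (hs hz)).hasFDerivAt
      have h3 : HasFDerivAt (χ n) _ z :=
        HasDerivAt.comp_hasFDerivAt z (h₂ := cutoffTransition) (f := fun z => d z / ε n)
          ((contDiff_cutoffTransition.differentiable (by simp)).differentiableAt.hasDerivAt)
          (by simpa only [div_eq_mul_inv] using h2.mul_const (ε n)⁻¹)
      have h4 := (h1.fun_mul h3).fderiv
      rw [real_inner_comm, inner_gradient_left, h4]
      rw [real_inner_comm (gradient η z), inner_gradient_left]
      simp only [ψ, add_apply, FunLike.coe_smul, Pi.smul_apply, smul_eq_mul,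
        InnerProductSpace.toDual_apply_apply, inner_neg_left]
      rw [real_inner_comm (β z) (nu z)]
      ring
    · have e1 : η z = 0 := image_eq_zero_of_notMem_tsupport hz
      have e2 : gradient η z = 0 := gradient_eq_zero_of_notMem_tsupport hz
      have e3 : gradient (fun z => η z * χ n z) z = 0 :=
        gradient_eq_zero_of_notMem_tsupport fun h => hz (hηχs n h)
      simp [ψ, e1, e2, e3]
  refine ⟨χ, fun n z => cutoffTransition_mem_Icc _, hχ1, hsm, fun n => ?_, ?_⟩
  -- A nonzero cutoff forces `d ≥ ε n`. This condition is closed on the support of `η`, so it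
  -- persists on the support of the product and keeps it inside `Ω`.
  · have hclosed : IsClosed (tsupport η ∩ d ⁻¹' Ici (ε n)) :=
      (hdV.continuousOn.mono hs).preimage_isClosed_of_isClosed (isClosed_tsupport η) isClosed_Ici
    have hsub : Function.support (fun z => η z * χ n z) ⊆ tsupport η ∩ d ⁻¹' Ici (ε n) := by
      intro z hz
      rw [Function.mem_support] at hz
      refine ⟨subset_tsupport _ (left_ne_zero_of_mul hz), ?_⟩
      by_contra hlt
      rw [mem_preimage, mem_Ici, not_le] at hlt
      exact right_ne_zero_of_mul hz (cutoffTransition_eq_zero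
        ((div_le_one (hεpos n)).2 hlt.le))
    refine (closure_minimal hsub hclosed).trans fun z hz => ?_
    exact (hmemΩ z (hs hz.1)).2 ((hεpos n).trans_le hz.2)
  -- the layer integrals
  have hdτ := continuous_deriv_cutoffTransition
  have hlayc : ∀ n, Continuous fun z => (ε n)⁻¹ * deriv cutoffTransition (d z / ε n) * ψ z := by
    intro n
    refine continuous_of_tsupport fun z hz => ?_
    have hzη : z ∈ tsupport η := hψs (tsupport_mul_subset_right hz)
    have hdz : ContinuousAt d z := hdV.continuousOn.continuousAt (hVo.mem_nhds (hs hzη))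
    exact (continuousAt_const.mul (hdτ.continuousAt.comp (hdz.div_const _))).mul hψc.continuousAt
  have hlaycs : ∀ n, HasCompactSupport
      fun z => (ε n)⁻¹ * deriv cutoffTransition (d z / ε n) * ψ z := fun n => hψcs.mul_left
  have hlayi : ∀ n, Integrable
      fun z => (ε n)⁻¹ * deriv cutoffTransition (d z / ε n) * ψ z := fun n =>
    (hlayc n).integrable_of_hasCompactSupport (hlaycs n)
  -- Fubini in the chart and the substitution `t = g k - ε n * s` straighten the layer. As the
  -- derivative of the profile has integral one, the limit is the integral of `ψ` over the graph.
  have hlay : ∀ n, ∫ z in Ω, (ε n)⁻¹ * deriv cutoffTransition (d z / ε n) * ψ z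
      = ∫ k, ∫ s, deriv cutoffTransition s * ψ (S (k, g k - ε n * s)) := by
    intro n
    rw [setIntegral_eq_integral_of_forall_compl_eq_zero, ← h.ortho.measurePreserving.integral_comp
      S.toHomeomorph.measurableEmbedding, Measure.volume_eq_prod, integral_prod]
    · congr 1
      ext k
      have hk : ∀ t, (ε n)⁻¹ * deriv cutoffTransition (d (S (k, t)) / ε n) * ψ (S (k, t))
          = (ε n)⁻¹ * (fun r => deriv cutoffTransition (r / ε n) * ψ (S (k, g k - r)))
            (g k - t) := by
        intro t
        simp only [d, Q, ContinuousLinearEquiv.symm_apply_apply, sub_sub_cancel]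
        ring
      simp_rw [hk]
      rw [integral_const_mul, integral_sub_left_eq_self
        (fun r => deriv cutoffTransition (r / ε n) * ψ (S (k, g k - r)))]
      have := Measure.integral_comp_mul_left
        (fun r => deriv cutoffTransition (r / ε n) * ψ (S (k, g k - r))) (ε n)
      rw [abs_of_pos (inv_pos.2 (hεpos n)), smul_eq_mul] at this
      rw [← this]
      simp_rw [mul_div_cancel_left₀ _ (hεpos n).ne']
    · have := (h.ortho.measurePreserving.integrable_comp_emb
        S.toHomeomorph.measurableEmbedding).2 (hlayi n)
      exact this
    · intro z hz
      by_cases hzV : z ∈ V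
      · have hdz : d z ≤ 0 := not_lt.1 fun hlt => hz ((hmemΩ z hzV).2 hlt)
        rw [deriv_cutoffTransition_eq_zero_of_le
          ((div_nonpos_of_nonpos_of_nonneg hdz (hεpos n).le).trans zero_le_one)]
        simp
      · simp [hψ0 z hzV]
  have hτi : Integrable (deriv cutoffTransition) :=
    hdτ.integrable_of_hasCompactSupport hasCompactSupport_deriv_cutoffTransition
  have hlaylim : Tendsto
      (fun n => ∫ z in Ω, (ε n)⁻¹ * deriv cutoffTransition (d z / ε n) * ψ z) atTop
      (𝓝 (∫ k, ψ (S (k, g k)))) := by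
    simp_rw [hlay]
    refine tendsto_integral_of_dominated_convergence
      (C.indicator fun _ => ∫ s, ‖deriv cutoffTransition s‖ * M) (fun n => ?_) ?_
      (fun n => Eventually.of_forall fun k => ?_) (Eventually.of_forall fun k => ?_)
    · have hmeas : AEStronglyMeasurable
          (fun q : EuclideanSpace ℝ (Fin m) × ℝ =>
            deriv cutoffTransition q.2 * ψ (S (q.1, g q.1 - ε n * q.2)))
          (volume.prod volume) := by
        have h1 : ContinuousOn (fun q : EuclideanSpace ℝ (Fin m) × ℝ =>
            deriv cutoffTransition q.2 * ψ (S (q.1, g q.1 - ε n * q.2))) (B ×ˢ univ) := by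
          have hg1 : ContinuousOn (fun q : EuclideanSpace ℝ (Fin m) × ℝ => g q.1) (B ×ˢ univ) :=
            h.contDiffOn.continuousOn.comp continuousOn_fst fun q hq => hq.1
          refine (hdτ.comp continuous_snd).continuousOn.mul ((hψc.comp S.continuous).comp_continuousOn
            (continuousOn_fst.prodMk (hg1.sub (continuousOn_const.mul continuousOn_snd))))
        have hBm : MeasurableSet (B ×ˢ (univ : Set ℝ)) :=
          h.isOpen.measurableSet.prod MeasurableSet.univ
        have h2 := (aestronglyMeasurable_indicator_iff (μ := volume.prod volume) hBm).2
          (h1.aestronglyMeasurable hBm)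
        refine h2.congr (Eventually.of_forall fun q => ?_)
        by_cases hq : q ∈ B ×ˢ (univ : Set ℝ)
        · rw [indicator_of_mem hq]
        · rw [indicator_of_notMem hq]
          simp only
          rw [hψC q.1 fun hqC => hq ⟨hCB hqC, mem_univ _⟩, mul_zero]
      exact hmeas.integral_prod_right'
    · exact (integrable_indicator_iff hCc.measurableSet).2
        (integrableOn_const hCc.measure_lt_top.ne)
    · by_cases hk : k ∈ C
      · rw [indicator_of_mem hk]
        refine norm_integral_le_of_norm_le (hτi.norm.mul_const M) (Eventually.of_forall fun s => ?_)
        rw [norm_mul]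
        exact mul_le_mul_of_nonneg_left (hM _) (norm_nonneg _)
      · rw [indicator_of_notMem hk]
        simp [hψC k hk]
    · have hlim : ∫ s, deriv cutoffTransition s * ψ (S (k, g k)) = ψ (S (k, g k)) := by
        rw [integral_mul_const, integral_deriv_cutoffTransition, one_mul]
      rw [← hlim]
      refine tendsto_integral_of_dominated_convergence (fun s => ‖deriv cutoffTransition s‖ * M)
        (fun n => ?_) (hτi.norm.mul_const M) (fun n => Eventually.of_forall fun s => ?_)
        (Eventually.of_forall fun s => ?_)
      · exact (hdτ.mul (hψc.comp (S.continuous.comp (by fun_prop)))).aestronglyMeasurable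
      · rw [norm_mul]
        exact mul_le_mul_of_nonneg_left (hM _) (norm_nonneg _)
      · have h1 : Tendsto (fun n => ψ (S (k, g k - ε n * s))) atTop (𝓝 (ψ (S (k, g k - 0 * s)))) :=
          (Continuous.tendsto (f := fun r => ψ (S (k, g k - r * s)))
            (hψc.comp (S.continuous.comp (by fun_prop))) 0).comp hεlim
        rw [zero_mul, sub_zero] at h1
        exact h1.const_mul _
  have hgi : Integrable fun z => ⟪β z, gradient η z⟫_ℝ := by
    refine (hβ.inner hη.continuous_gradient).integrable_of_hasCompactSupport
      (hc.mono' fun z hz => ?_)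
    by_contra hz'
    exact hz (by simp [gradient_eq_zero_of_notMem_tsupport hz'])
  have hχae : ∀ n, AEStronglyMeasurable (fun z => χ n z * ⟪β z, gradient η z⟫_ℝ)
      (volume.restrict Ω) := by
    intro n
    have hcont : Continuous fun z => χ n z * ⟪β z, gradient η z⟫_ℝ := by
      have e : (fun z => χ n z * ⟪β z, gradient η z⟫_ℝ)
          = fun z => ⟪β z, gradient (fun z => η z * χ n z) z⟫_ℝ
            + (ε n)⁻¹ * deriv cutoffTransition (d z / ε n) * ψ z := by
        ext z; rw [hgradχ]; ring
      rw [e]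
      exact (hβ.inner (hsm n).continuous_gradient).add (hlayc n)
    exact hcont.aestronglyMeasurable
  have hχb : ∀ n z, ‖χ n z * ⟪β z, gradient η z⟫_ℝ‖ ≤ ‖⟪β z, gradient η z⟫_ℝ‖ := fun n z => by
    rw [norm_mul]
    have h1 := cutoffTransition_mem_Icc (d z / ε n)
    have h2 : ‖χ n z‖ ≤ 1 := by
      rw [Real.norm_of_nonneg h1.1]; exact h1.2
    exact mul_le_of_le_one_left (norm_nonneg _) h2
  have hmain : Tendsto (fun n => ∫ z in Ω, χ n z * ⟪β z, gradient η z⟫_ℝ) atTop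
      (𝓝 (∫ z in Ω, ⟪β z, gradient η z⟫_ℝ)) := by
    refine tendsto_integral_of_dominated_convergence _ hχae hgi.integrableOn.norm
      (fun n => Eventually.of_forall (hχb n)) ?_
    filter_upwards [ae_restrict_mem hΩ.measurableSet] with z hz
    by_cases hzη : z ∈ tsupport η
    · refine tendsto_const_nhds.congr' ?_
      filter_upwards [hχ1 z hz hzη] with n hn
      rw [hn, one_mul]
    · simp [gradient_eq_zero_of_notMem_tsupport hzη]
  refine (hmain.sub hlaylim).congr fun n => ?_
  simp_rw [hgradχ n]
  rw [integral_sub]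
  · exact Integrable.mono hgi.integrableOn (hχae n) (Eventually.of_forall (hχb n))
  · exact (hlayi n).integrableOn

end IsChart

end Grushin

/-! ### Localisation of additive properties -/

section Splitting

variable {E : Type*} [NormedAddCommGroup E] [InnerProductSpace ℝ E] [FiniteDimensional ℝ E]

/-- A smooth function supported in `O₁` and equal to `1` near `C`. -/
theorem exists_contDiff_one_nhdsSet {C O : Set E} (hC : IsClosed C) (hO : IsOpen O) (hCO : C ⊆ O) :
    ∃ θ : E → ℝ, ContDiff ℝ ∞ θ ∧ tsupport θ ⊆ O ∧ (∀ᶠ x in 𝓝ˢ C, θ x = 1) ∧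
      ∀ x, θ x ∈ Icc (0 : ℝ) 1 := by
  obtain ⟨f, h0, h1, h01⟩ := exists_contMDiffMap_zero_one_nhds_of_isClosed (modelWithCornersSelf ℝ E)
    (n := (⊤ : ℕ∞)) hO.isClosed_compl hC (disjoint_compl_left_iff_subset.2 hCO)
  refine ⟨f, f.contMDiff.contDiff, fun x hx => ?_, h1, h01⟩
  by_contra hxO
  exact (notMem_tsupport_iff_eventuallyEq.2 (eventually_nhdsSet_iff_forall.1 h0 x hxO)) hx

/-- A property of compactly supported `C^1` functions that is additive and holds for small
supports holds in general. -/
theorem forall_of_locally {P : (E → ℝ) → Prop}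
    (hadd : ∀ η₁ η₂ : E → ℝ, ContDiff ℝ 1 η₁ → HasCompactSupport η₁ → ContDiff ℝ 1 η₂ →
      HasCompactSupport η₂ → P η₁ → P η₂ → P fun x => η₁ x + η₂ x)
    (hloc : ∀ x, ∃ O, IsOpen O ∧ x ∈ O ∧
      ∀ η : E → ℝ, ContDiff ℝ 1 η → HasCompactSupport η → tsupport η ⊆ O → P η)
    {η : E → ℝ} (hη : ContDiff ℝ 1 η) (hc : HasCompactSupport η) : P η := by
  have key : ∃ O, IsOpen O ∧ tsupport η ⊆ O ∧
      ∀ η : E → ℝ, ContDiff ℝ 1 η → HasCompactSupport η → tsupport η ⊆ O → P η := by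
    refine IsCompact.induction_on (p := fun s => ∃ O, IsOpen O ∧ s ⊆ O ∧
      ∀ η : E → ℝ, ContDiff ℝ 1 η → HasCompactSupport η → tsupport η ⊆ O → P η) hc ?_ ?_ ?_ ?_
    · obtain ⟨O, hO, -, hP⟩ := hloc 0
      exact ⟨O, hO, empty_subset _, hP⟩
    · rintro s t hst ⟨O, hO, htO, hP⟩
      exact ⟨O, hO, hst.trans htO, hP⟩
    · rintro s t ⟨O₁, hO₁, hs₁, hP₁⟩ ⟨O₂, hO₂, hs₂, hP₂⟩
      refine ⟨O₁ ∪ O₂, hO₁.union hO₂, union_subset_union hs₁ hs₂, fun η hη hc hs => ?_⟩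
      -- The function `θ` is supported in `O₁` and equals one near the part of the support of `η`
      -- outside `O₂`, so `θ η` lives in `O₁` and `(1 - θ) η` in `O₂`.
      obtain ⟨θ, hθ, hθs, hθ1, -⟩ := exists_contDiff_one_nhdsSet
        ((isClosed_tsupport η).inter hO₂.isClosed_compl) hO₁
        (fun x hx => (hs hx.1).resolve_right hx.2)
      have hθ' : ContDiff ℝ 1 θ := hθ.of_le (by simp)
      have h1 := hP₁ (fun x => θ x * η x) (hθ'.mul hη) hc.mul_left
        (tsupport_mul_subset_left.trans hθs)
      have h2 := hP₂ (fun x => (1 - θ x) * η x) ((contDiff_const.sub hθ').mul hη) hc.mul_left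
        (fun x hx => by
          by_contra hxO
          have hxη : x ∈ tsupport η := tsupport_mul_subset_right hx
          have := eventually_nhdsSet_iff_forall.1 hθ1 x ⟨hxη, hxO⟩
          refine (notMem_tsupport_iff_eventuallyEq.2 ?_) hx
          filter_upwards [this] with y hy
          simp [hy])
      have := hadd _ _ (hθ'.mul hη) hc.mul_left ((contDiff_const.sub hθ').mul hη) hc.mul_left h1 h2
      convert this using 2
      ring
    · intro x _
      obtain ⟨O, hO, hxO, hP⟩ := hloc x
      exact ⟨O, mem_nhdsWithin_of_mem_nhds (hO.mem_nhds hxO), O, hO, subset_rfl, hP⟩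
  obtain ⟨O, -, hsO, hP⟩ := key
  exact hP η hη hc hsO

end Splitting

/-! ### The divergence theorem up to the boundary -/

namespace Grushin

variable {N l : ℕ}

/-- The divergence theorem for the field `η b`, the divergence of `b` being `-α`. -/
def HasFlux (Ω : Set (Space N l)) (α : Space N l → ℝ) (b : Space N l → Space N l)
    (η : Space N l → ℝ) : Prop :=
  IntegrableOn (fun z => η z * ⟪b z, outerNormal Ω z⟫_ℝ) (frontier Ω) (surfaceMeasure N l) ∧
  ∫ z in Ω, (η z * α z + ⟪b z, gradient η z⟫_ℝ)
    = ∫ z in frontier Ω, η z * ⟪b z, outerNormal Ω z⟫_ℝ ∂surfaceMeasure N l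

variable {Ω : Set (Space N l)} {α : Space N l → ℝ}

theorem integrableOn_mul_of_hasCompactSupport {α : Space N l → ℝ} (hΩ : IsOpen Ω)
    (hα : ∀ K, IsCompact K → IntegrableOn α (Ω ∩ K)) {η : Space N l → ℝ} (hη : Continuous η)
    (hc : HasCompactSupport η) : IntegrableOn (fun z => η z * α z) Ω := by
  obtain ⟨M, hM⟩ := hc.exists_bound_of_continuous hη
  have h1 : IntegrableOn (fun z => η z * α z) (Ω ∩ tsupport η) :=
    (hα _ hc).bdd_mul hη.aestronglyMeasurable (Eventually.of_forall hM)
  refine h1.of_forall_sdiff_eq_zero hΩ.measurableSet fun z hz => ?_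
  rw [image_eq_zero_of_notMem_tsupport fun h => hz.2 ⟨hz.1, h⟩, zero_mul]

theorem integrable_inner_gradient {β : Space N l → Space N l} (hβ : Continuous β)
    {η : Space N l → ℝ} (hη : ContDiff ℝ 1 η) (hc : HasCompactSupport η) :
    Integrable fun z => ⟪β z, gradient η z⟫_ℝ := by
  refine (hβ.inner hη.continuous_gradient).integrable_of_hasCompactSupport (hc.mono' fun z hz => ?_)
  by_contra hz'
  exact hz (by simp [gradient_eq_zero_of_notMem_tsupport hz'])

theorem gradient_fun_add {f g : Space N l → ℝ} {x : Space N l} (hf : DifferentiableAt ℝ f x)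
    (hg : DifferentiableAt ℝ g x) :
    gradient (fun x => f x + g x) x = gradient f x + gradient g x := by
  rw [gradient, fderiv_fun_add hf hg, map_add]
  rfl

/-- The interior identity holds for `η χ_n`, whose support stays inside `Ω`. In the limit `n → ∞`
the boundary layers of the gradients leave the flux, and the terms with `α` converge by domination.
-/
theorem IsChart.hasFlux {m : ℕ} {S : (EuclideanSpace ℝ (Fin m) × ℝ) ≃L[ℝ] Space N l}
    {B : Set (EuclideanSpace ℝ (Fin m))} {g : EuclideanSpace ℝ (Fin m) → ℝ} {a b : ℝ}
    (h : IsChart Ω S B g a b) (hm : N + l = m + 1) (hΩ : IsOpen Ω)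
    (hα : ∀ K, IsCompact K → IntegrableOn α (Ω ∩ K)) {β : Space N l → Space N l}
    (hβ : Continuous β)
    (hid : ∀ η : Space N l → ℝ, ContDiff ℝ 1 η → HasCompactSupport η → tsupport η ⊆ Ω →
      ∫ z in Ω, (η z * α z + ⟪β z, gradient η z⟫_ℝ) = 0)
    {η : Space N l → ℝ} (hη : ContDiff ℝ 1 η) (hc : HasCompactSupport η)
    (hs : tsupport η ⊆ S '' (B ×ˢ Ioo a b)) : HasFlux Ω α β η := by
  obtain ⟨hi, χ, hχ01, hχ1, hχd, hχs, hlim⟩ := h.exists_tendsto_flux hm hΩ hβ hη hc hs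
  refine ⟨hi, ?_⟩
  have hηα := integrableOn_mul_of_hasCompactSupport hΩ hα hη.continuous hc
  have hχα : ∀ n, IntegrableOn (fun z => (η z * χ n z) * α z) Ω := fun n =>
    integrableOn_mul_of_hasCompactSupport hΩ hα (hχd n).continuous hc.mul_right
  have hz : ∀ n, (∫ z in Ω, (η z * χ n z) * α z)
      + ∫ z in Ω, ⟪β z, gradient (fun z => η z * χ n z) z⟫_ℝ = 0 := fun n => by
    rw [← integral_add (hχα n)
      (integrable_inner_gradient hβ (hχd n) hc.mul_right).integrableOn]
    exact hid _ (hχd n) hc.mul_right (hχs n)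
  have hlim2 : Tendsto (fun n => ∫ z in Ω, (η z * χ n z) * α z) atTop
      (𝓝 (∫ z in Ω, η z * α z)) := by
    refine tendsto_integral_of_dominated_convergence _ (fun n => (hχα n).aestronglyMeasurable)
      hηα.norm (fun n => Eventually.of_forall fun z => ?_) ?_
    · rw [mul_right_comm, norm_mul _ (χ n z)]
      refine mul_le_of_le_one_right (norm_nonneg _) ?_
      rw [Real.norm_of_nonneg (hχ01 n z).1]
      exact (hχ01 n z).2
    · filter_upwards [ae_restrict_mem hΩ.measurableSet] with z hz
      by_cases hzη : z ∈ tsupport η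
      · refine tendsto_const_nhds.congr' ?_
        filter_upwards [hχ1 z hz hzη] with n hn
        rw [hn, mul_one]
      · simp [image_eq_zero_of_notMem_tsupport hzη]
  have h0 := tendsto_nhds_unique ((hlim2.add hlim).congr hz) tendsto_const_nhds
  rw [integral_add hηα (integrable_inner_gradient hβ hη hc).integrableOn]
  linarith

/-- The flux identity is additive in `η`, so a neighbourhood of each point suffices: `Ω` itself for
an interior point, a chart box for a boundary point, the complement of the closure otherwise. In the
first and last case both sides vanish. -/
theorem HasC1Boundary.hasFlux_of_continuous (hC : HasC1Boundary Ω) (hN : 1 ≤ N) (hΩ : IsOpen Ω)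
    (hα : ∀ K, IsCompact K → IntegrableOn α (Ω ∩ K)) {β : Space N l → Space N l}
    (hβ : Continuous β)
    (hid : ∀ η : Space N l → ℝ, ContDiff ℝ 1 η → HasCompactSupport η → tsupport η ⊆ Ω →
      ∫ z in Ω, (η z * α z + ⟪β z, gradient η z⟫_ℝ) = 0)
    {η : Space N l → ℝ} (hη : ContDiff ℝ 1 η) (hc : HasCompactSupport η) : HasFlux Ω α β η := by
  refine forall_of_locally (P := HasFlux Ω α β) ?_ (fun x => ?_) hη hc
  · intro η₁ η₂ h1 hc1 h2 hc2 hf1 hf2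
    have e1 : ∀ z, (η₁ z + η₂ z) * ⟪β z, outerNormal Ω z⟫_ℝ = η₁ z * ⟪β z, outerNormal Ω z⟫_ℝ
        + η₂ z * ⟪β z, outerNormal Ω z⟫_ℝ := fun z => add_mul _ _ _
    have e2 : ∀ z, (η₁ z + η₂ z) * α z + ⟪β z, gradient (fun z => η₁ z + η₂ z) z⟫_ℝ
        = (η₁ z * α z + ⟪β z, gradient η₁ z⟫_ℝ) + (η₂ z * α z + ⟪β z, gradient η₂ z⟫_ℝ) :=
      fun z => by
        rw [gradient_fun_add (h1.differentiable one_ne_zero z) (h2.differentiable one_ne_zero z),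
          inner_add_right]
        ring
    refine ⟨?_, ?_⟩
    · simp_rw [e1]; exact hf1.1.add hf2.1
    · simp_rw [e1, e2]
      rw [integral_add hf1.1 hf2.1, integral_add, hf1.2, hf2.2]
      · exact (integrableOn_mul_of_hasCompactSupport hΩ hα h1.continuous hc1).add
          (integrable_inner_gradient hβ h1 hc1).integrableOn
      · exact (integrableOn_mul_of_hasCompactSupport hΩ hα h2.continuous hc2).add
          (integrable_inner_gradient hβ h2 hc2).integrableOn
  have hoff : ∀ η : Space N l → ℝ, (∀ z ∈ frontier Ω, η z = 0) →
      ∫ z in Ω, (η z * α z + ⟪β z, gradient η z⟫_ℝ) = 0 → HasFlux Ω α β η := by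
    intro η h0 hint
    have e : EqOn (fun z => η z * ⟪β z, outerNormal Ω z⟫_ℝ) 0 (frontier Ω) := fun z hz => by
      simp [h0 z hz]
    refine ⟨integrableOn_zero.congr_fun e.symm isClosed_frontier.measurableSet, ?_⟩
    rw [hint, setIntegral_congr_fun isClosed_frontier.measurableSet e]
    simp
  by_cases hx : x ∈ Ω
  · refine ⟨Ω, hΩ, hx, fun η hη hc hs => hoff η (fun z hz => ?_) (hid η hη hc hs)⟩
    refine image_eq_zero_of_notMem_tsupport fun hz' => ?_
    rw [hΩ.frontier_eq] at hz
    exact hz.2 (hs hz')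
  by_cases hxc : x ∈ closure Ω
  · obtain ⟨n, hn⟩ := hC x (by rw [hΩ.frontier_eq]; exact ⟨hxc, hx⟩)
    obtain ⟨m, hm⟩ : ∃ m, N + l = m + 1 := ⟨N + l - 1, by omega⟩
    obtain ⟨S, B, g, a, b, hch, -, hxB, hxg⟩ := hn.exists_isChart hm
    refine ⟨S '' (B ×ˢ Ioo a b), hch.isOpen_box, ?_, fun η hη hc hs =>
      hch.hasFlux hm hΩ hα hβ hid hη hc hs⟩
    exact ⟨S.symm x, ⟨hxB, hxg ▸ hch.mem_Ioo _ hxB⟩, by simp⟩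
  · refine ⟨(closure Ω)ᶜ, isClosed_closure.isOpen_compl, hxc, fun η hη hc hs =>
      hoff η (fun z hz => ?_) ?_⟩
    · exact image_eq_zero_of_notMem_tsupport fun hz' => hs hz' (frontier_subset_closure hz)
    · refine setIntegral_eq_zero_of_forall_eq_zero fun z hz => ?_
      have hz' : z ∉ tsupport η := fun h => hs h (subset_closure hz)
      simp [image_eq_zero_of_notMem_tsupport hz', gradient_eq_zero_of_notMem_tsupport hz']

/-- If `div b = -α` weakly in `Ω` and `b` is continuous up to the `C^1` boundary of `Ω`, then the
divergence theorem holds with test functions that need not vanish on the boundary. -/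
theorem HasC1Boundary.hasFlux (hC : HasC1Boundary Ω) (hN : 1 ≤ N) (hΩ : IsOpen Ω)
    (hα : ∀ K, IsCompact K → IntegrableOn α (Ω ∩ K)) {b : Space N l → Space N l}
    (hb : ContinuousOn b (closure Ω))
    (hid : ∀ η : Space N l → ℝ, ContDiff ℝ 1 η → HasCompactSupport η → tsupport η ⊆ Ω →
      ∫ z in Ω, (η z * α z + ⟪b z, gradient η z⟫_ℝ) = 0)
    {η : Space N l → ℝ} (hη : ContDiff ℝ 1 η) (hc : HasCompactSupport η) : HasFlux Ω α b η := by
  -- Tietze extension. Only the values on the closure of `Ω` enter the identity, so the choice of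
  -- extension is immaterial.
  obtain ⟨β, hβ⟩ := ContinuousMap.exists_restrict_eq (isClosed_closure (s := Ω))
    ⟨_, continuousOn_iff_continuous_domRestrict.1 hb⟩
  have hβb : ∀ z ∈ closure Ω, β z = b z := fun z hz => DFunLike.congr_fun hβ ⟨z, hz⟩
  have e1 : ∀ η : Space N l → ℝ, ∫ z in Ω, (η z * α z + ⟪β z, gradient η z⟫_ℝ)
      = ∫ z in Ω, (η z * α z + ⟪b z, gradient η z⟫_ℝ) := fun η =>
    setIntegral_congr_fun hΩ.measurableSet fun z hz => by rw [hβb z (subset_closure hz)]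
  have e2 : EqOn (fun z => η z * ⟪β z, outerNormal Ω z⟫_ℝ)
      (fun z => η z * ⟪b z, outerNormal Ω z⟫_ℝ) (frontier Ω) := fun z hz => by
    simp only; rw [hβb z (frontier_subset_closure hz)]
  obtain ⟨h1, h2⟩ := hC.hasFlux_of_continuous hN hΩ hα β.continuous
    (fun η hη hc hs => by rw [e1]; exact hid η hη hc hs) hη hc
  refine ⟨h1.congr_fun e2 isClosed_frontier.measurableSet, ?_⟩
  rw [← e1, h2, setIntegral_congr_fun isClosed_frontier.measurableSet e2]

end Grushin

/-! ### Algebra of the Grushin weight -/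

namespace Grushin

variable {N l : ℕ}

section Weight

/-- The linear map `(a, b) ↦ (a, c b)`. -/
noncomputable def stretch (c : ℝ) (v : Space N l) : Space N l :=
  WithLp.toLp 2 (Sum.elim (fun i => v (Sum.inl i)) fun j => c * v (Sum.inr j))

theorem weight_eq_stretch (γ : ℝ) (z v : Space N l) : weight γ z v = stretch (‖xPart z‖ ^ γ) v := rfl

@[simp] theorem stretch_inl (c : ℝ) (v : Space N l) (i : Fin N) :
    stretch c v (Sum.inl i) = v (Sum.inl i) := rfl

@[simp] theorem stretch_inr (c : ℝ) (v : Space N l) (j : Fin l) :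
    stretch c v (Sum.inr j) = c * v (Sum.inr j) := rfl

@[simp] theorem xPart_apply (z : Space N l) (i : Fin N) : xPart z i = z (Sum.inl i) := rfl

@[simp] theorem yPart_apply (z : Space N l) (j : Fin l) : yPart z j = z (Sum.inr j) := rfl

theorem ext_inl_inr {v w : Space N l} (h1 : ∀ i, v (Sum.inl i) = w (Sum.inl i))
    (h2 : ∀ j, v (Sum.inr j) = w (Sum.inr j)) : v = w := by
  ext i
  rcases i with i | j
  · exact h1 i
  · exact h2 j

theorem stretch_add (c : ℝ) (v w : Space N l) : stretch c (v + w) = stretch c v + stretch c w :=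
  ext_inl_inr (fun i => by simp) (fun j => by simp [mul_add])

theorem stretch_smul (c t : ℝ) (v : Space N l) : stretch c (t • v) = t • stretch c v :=
  ext_inl_inr (fun i => by simp) (fun j => by simp [mul_left_comm])

theorem stretch_zero (c : ℝ) : stretch c (0 : Space N l) = 0 :=
  ext_inl_inr (fun i => by simp) (fun j => by simp)

theorem inner_stretch_left (c : ℝ) (v w : Space N l) : ⟪stretch c v, w⟫_ℝ = ⟪v, stretch c w⟫_ℝ := by
  simp [PiLp.inner_apply, Fintype.sum_sum_type, mul_assoc, mul_left_comm]

theorem contDiff_stretch {n : WithTop ℕ∞} :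
    ContDiff ℝ n fun q : ℝ × Space N l => stretch q.1 q.2 := by
  rw [contDiff_euclidean]
  rintro (i | j)
  · simp only [stretch_inl]
    exact (EuclideanSpace.proj (𝕜 := ℝ) (Sum.inl i : Fin N ⊕ Fin l)).contDiff.comp contDiff_snd
  · simp only [stretch_inr]
    exact contDiff_fst.mul
      ((EuclideanSpace.proj (𝕜 := ℝ) (Sum.inr j : Fin N ⊕ Fin l)).contDiff.comp contDiff_snd)

theorem continuous_xPart : Continuous (xPart : Space N l → _) :=
  (PiLp.continuous_toLp 2 _).comp (by fun_prop)

theorem continuous_yPart : Continuous (yPart : Space N l → _) :=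
  (PiLp.continuous_toLp 2 _).comp (by fun_prop)

theorem norm_sq_eq (z : Space N l) : ‖z‖ ^ 2 = ‖xPart z‖ ^ 2 + ‖yPart z‖ ^ 2 := by
  simp [EuclideanSpace.norm_sq_eq, Fintype.sum_sum_type]

theorem inner_eq (z w : Space N l) :
    ⟪z, w⟫_ℝ = ⟪xPart z, xPart w⟫_ℝ + ⟪yPart z, yPart w⟫_ℝ := by
  simp [PiLp.inner_apply, Fintype.sum_sum_type]

theorem norm_xPart_le (z : Space N l) : ‖xPart z‖ ≤ ‖z‖ :=
  le_of_sq_le_sq (by rw [norm_sq_eq z]; linarith [sq_nonneg ‖yPart z‖]) (norm_nonneg _)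

theorem norm_yPart_le (z : Space N l) : ‖yPart z‖ ≤ ‖z‖ :=
  le_of_sq_le_sq (by rw [norm_sq_eq z]; linarith [sq_nonneg ‖xPart z‖]) (norm_nonneg _)

theorem xPart_stretch (c : ℝ) (v : Space N l) : xPart (stretch c v) = xPart v := by
  ext i; simp

theorem yPart_stretch (c : ℝ) (v : Space N l) : yPart (stretch c v) = c • yPart v := by
  ext i; simp

theorem continuous_norm_xPart_rpow {γ : ℝ} (hγ : 0 ≤ γ) :
    Continuous fun z : Space N l => ‖xPart z‖ ^ γ :=
  continuous_xPart.norm.rpow_const fun _ => Or.inr hγ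

theorem continuous_weight {γ : ℝ} (hγ : 0 ≤ γ) :
    Continuous fun q : Space N l × Space N l => weight γ q.1 q.2 :=
  (contDiff_stretch (n := 0)).continuous.comp
    (((continuous_norm_xPart_rpow hγ).comp continuous_fst).prodMk continuous_snd)

theorem norm_stretch_le {c : ℝ} (hc : 0 ≤ c) (v : Space N l) : ‖stretch c v‖ ≤ (1 + c) * ‖v‖ := by
  refine le_of_sq_le_sq ?_ (by positivity)
  rw [norm_sq_eq, xPart_stretch, yPart_stretch, norm_smul, mul_pow, Real.norm_of_nonneg hc, mul_pow,
    norm_sq_eq v]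
  nlinarith [sq_nonneg ‖xPart v‖, sq_nonneg ‖yPart v‖, mul_nonneg hc (sq_nonneg ‖xPart v‖),
    mul_nonneg hc (sq_nonneg ‖yPart v‖), mul_nonneg (sq_nonneg c) (sq_nonneg ‖xPart v‖)]

/-- The coefficients of the diagonal map `weight γ z`. -/
noncomputable def weightCoef (γ : ℝ) (z : Space N l) : Fin N ⊕ Fin l → ℝ :=
  Sum.elim (fun _ => 1) fun _ => ‖xPart z‖ ^ γ

theorem weight_apply (γ : ℝ) (z v : Space N l) (i : Fin N ⊕ Fin l) :
    weight γ z v i = weightCoef γ z i * v i := by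
  rcases i with i | j
  · simp [weight, weightCoef]
  · simp [weight, weightCoef]

theorem continuous_weightCoef {γ : ℝ} (hγ : 0 ≤ γ) (i : Fin N ⊕ Fin l) :
    Continuous fun z => weightCoef γ z i := by
  rcases i with i | j
  · exact continuous_const
  · exact continuous_norm_xPart_rpow hγ

/-- The coefficient of the `i`-th component does not vary in the `i`-th direction. This makes the
weighted derivatives skew-adjoint although `|x|^γ` need not be differentiable. -/
theorem weightCoef_add_smul_single (γ : ℝ) (z : Space N l) (i : Fin N ⊕ Fin l) (t : ℝ) :
    weightCoef γ (z + t • EuclideanSpace.single i 1) i = weightCoef γ z i := by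
  rcases i with i | j
  · rfl
  · have : xPart (z + t • EuclideanSpace.single (Sum.inr j) (1 : ℝ)) = xPart z := by
      ext i; simp
    simp [weightCoef, this]

theorem gradient_apply (f : Space N l → ℝ) (z : Space N l) (i : Fin N ⊕ Fin l) :
    gradient f z i = fderiv ℝ f z (EuclideanSpace.single i 1) := by
  rw [← inner_gradient_left, EuclideanSpace.inner_single_right]
  simp

theorem grushinGrad_apply (γ : ℝ) (f : Space N l → ℝ) (z : Space N l) (i : Fin N ⊕ Fin l) :
    grushinGrad γ f z i = weightCoef γ z i * fderiv ℝ f z (EuclideanSpace.single i 1) := by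
  rw [grushinGrad, weight_apply, gradient_apply]

theorem continuousOn_grushinGrad {γ : ℝ} (hγ : 0 ≤ γ) {Ω : Set (Space N l)} (hΩ : IsOpen Ω)
    {f : Space N l → ℝ} (hf : ContDiffOn ℝ 1 f Ω) : ContinuousOn (grushinGrad γ f) Ω :=
  (continuous_weight hγ).comp_continuousOn (continuousOn_id.prodMk (gradient_continuousOn hΩ hf))

theorem continuous_grushinGrad {γ : ℝ} (hγ : 0 ≤ γ)
    {f : Space N l → ℝ} (hf : ContDiff ℝ 1 f) : Continuous (grushinGrad γ f) :=
  (continuous_weight hγ).comp (continuous_id.prodMk hf.continuous_gradient)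

theorem grushinGrad_eq_zero_of_notMem_tsupport {γ : ℝ} {f : Space N l → ℝ} {z : Space N l}
    (hz : z ∉ tsupport f) : grushinGrad γ f z = 0 := by
  rw [grushinGrad, gradient_eq_zero_of_notMem_tsupport hz, weight_eq_stretch, stretch_zero]

theorem hasCompactSupport_grushinGrad (γ : ℝ) {f : Space N l → ℝ} (hf : HasCompactSupport f) :
    HasCompactSupport (grushinGrad γ f) := hf.mono' fun z hz => by
  by_contra hz'
  exact hz (grushinGrad_eq_zero_of_notMem_tsupport hz')

end Weight

/-! ### Integration by parts for the Grushin gradient -/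

section IntegrationByParts

variable {γ : ℝ} {Ω : Set (Space N l)} {f g : Space N l → ℝ}

/-- The weight is constant along the `i`-th direction, so it can be absorbed into `f` and the
product still has a line derivative there. Only points of the support of `g` matter, so regularity
of `f` inside `Ω` is enough. -/
theorem integral_mul_weightCoef_fderiv (hγ : 0 ≤ γ) (hΩ : IsOpen Ω) (hf : ContDiffOn ℝ 1 f Ω)
    (hg : ContDiff ℝ 1 g) (hc : HasCompactSupport g) (hs : tsupport g ⊆ Ω)
    (i : Fin N ⊕ Fin l) :
    ∫ z, f z * grushinGrad γ g z i = -∫ z, g z * grushinGrad γ f z i := by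
  set e : Space N l := EuclideanSpace.single i 1
  have hcc := continuous_weightCoef (N := N) (l := l) hγ i
  have hgd : Continuous fun z => fderiv ℝ g z e :=
    (hg.continuous_fderiv one_ne_zero).clm_apply continuous_const
  have hfd : ContinuousOn (fun z => fderiv ℝ f z e) Ω :=
    (hf.continuousOn_fderiv_of_isOpen hΩ le_rfl).clm_apply continuousOn_const
  have hgs : tsupport (fun z => fderiv ℝ g z e) ⊆ tsupport g :=
    closure_minimal (fun z hz => by
      by_contra h
      exact hz (by simp [image_eq_zero_of_notMem_tsupport fun h2 => h (tsupport_fderiv_subset ℝ h2)]))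
      (isClosed_tsupport g)
  have hint : ∀ {a b : Space N l → ℝ}, ContinuousOn a Ω → Continuous b → tsupport b ⊆ tsupport g →
      Integrable fun z => a z * b z := fun {a b} ha hb hab => by
    have hsub : tsupport (fun z => a z * b z) ⊆ tsupport g :=
      tsupport_mul_subset_right.trans hab
    refine Continuous.integrable_of_hasCompactSupport (continuous_of_tsupport fun z hz =>
      (ha.continuousAt (hΩ.mem_nhds (hs (hsub hz)))).mul hb.continuousAt)
      (hc.mono' ((subset_tsupport _).trans hsub))
  have key := integral_bilinear_hasLineDerivAt_right_eq_neg_left_of_integrable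
    (μ := (volume : Measure (Space N l))) (B := ContinuousLinearMap.mul ℝ ℝ) (v := e)
    (f := fun z => weightCoef γ z i * f z) (f' := fun z => weightCoef γ z i * fderiv ℝ f z e)
    (g := g) (g' := fun z => fderiv ℝ g z e)
    (hint (hcc.continuousOn.mul hfd) hg.continuous subset_rfl)
    (hint (hcc.continuousOn.mul hf.continuousOn) hgd hgs)
    (hint (hcc.continuousOn.mul hf.continuousOn) hg.continuous subset_rfl)
    (fun z hz => by
      have h1 : HasDerivAt (fun t : ℝ => f (z + t • e)) (fderiv ℝ f z e) 0 :=
        ((hf.contDiffAt (hΩ.mem_nhds (hs hz))).differentiableAt one_ne_zero).hasFDerivAt.hasLineDerivAt e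
      have h2 := h1.const_mul (weightCoef γ z i)
      refine h2.congr_of_eventuallyEq (Eventually.of_forall fun t => ?_)
      simp only [e, weightCoef_add_smul_single])
    (fun z _ => (hg.differentiable one_ne_zero z).hasFDerivAt.hasLineDerivAt e)
  simp only [ContinuousLinearMap.mul_apply'] at key
  simp only [grushinGrad_apply]
  convert key using 1
  · congr 1; ext z; ring
  · congr 2; ext z; ring

/-- Integration by parts for the Grushin gradient. -/
theorem setIntegral_smul_grushinGrad (hγ : 0 ≤ γ) (hΩ : IsOpen Ω) (hf : ContDiffOn ℝ 1 f Ω)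
    (hg : ContDiff ℝ 1 g) (hc : HasCompactSupport g) (hs : tsupport g ⊆ Ω) :
    ∫ z in Ω, f z • grushinGrad γ g z = -∫ z in Ω, g z • grushinGrad γ f z := by
  have hG1 : Continuous fun z => f z • grushinGrad γ g z := continuous_of_tsupport fun z hz => by
    have hz' : z ∈ tsupport g := by
      by_contra h
      have h' : z ∉ tsupport (grushinGrad γ g) := fun h2 => h (closure_minimal (fun w hw => by
        by_contra h3; exact hw (grushinGrad_eq_zero_of_notMem_tsupport h3)) (isClosed_tsupport g) h2)
      exact h' (tsupport_smul_subset_right f (grushinGrad γ g) hz)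
    exact (hf.continuousOn.continuousAt (hΩ.mem_nhds (hs hz'))).smul
      (continuous_grushinGrad hγ hg).continuousAt
  have hG2 : Continuous fun z => g z • grushinGrad γ f z := continuous_of_tsupport fun z hz => by
    have hz' : z ∈ tsupport g := tsupport_smul_subset_left g (grushinGrad γ f) hz
    exact hg.continuous.continuousAt.smul
      ((continuousOn_grushinGrad hγ hΩ hf).continuousAt (hΩ.mem_nhds (hs hz')))
  have hI1 : Integrable fun z => f z • grushinGrad γ g z :=
    hG1.integrable_of_hasCompactSupport 
      (hc.mono' fun z hz => by
        by_contra h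
        exact hz (by simp [grushinGrad_eq_zero_of_notMem_tsupport h]))
  have hI2 : Integrable fun z => g z • grushinGrad γ f z :=
    hG2.integrable_of_hasCompactSupport hc.smul_right
  rw [setIntegral_eq_integral_of_forall_compl_eq_zero fun z hz => by
      rw [grushinGrad_eq_zero_of_notMem_tsupport fun h => hz (hs h), smul_zero],
    setIntegral_eq_integral_of_forall_compl_eq_zero fun z hz => by
      rw [image_eq_zero_of_notMem_tsupport fun h => hz (hs h), zero_smul]]
  ext i
  have e1 : ∫ z, f z * grushinGrad γ g z i = (∫ z, f z • grushinGrad γ g z) i :=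
    (EuclideanSpace.proj (𝕜 := ℝ) i).integral_comp_comm hI1
  have e2 : ∫ z, g z * grushinGrad γ f z i = (∫ z, g z • grushinGrad γ f z) i :=
    (EuclideanSpace.proj (𝕜 := ℝ) i).integral_comp_comm hI2
  rw [PiLp.neg_apply, ← e1, ← e2]
  exact integral_mul_weightCoef_fderiv hγ hΩ hf hg hc hs i

end IntegrationByParts

/-! ### The spaces `W^{1,p}_λ` and `W^{1,p}_{λ,0}` -/

section Sobolev

variable {p γ : ℝ} {Ω : Set (Space N l)}

theorem tendsto_eLpNorm_zero_of_norm_le {F : Type*} [NormedAddCommGroup F] {q : ℝ≥0∞}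
    {μ : Measure (Space N l)} [IsFiniteMeasureOnCompacts μ]
    {K : Set (Space N l)} (hK : IsCompact K) {f : ℕ → Space N l → F} {ε : ℕ → ℝ}
    (hε : Tendsto ε atTop (𝓝 0)) (hf : ∀ n z, ‖f n z‖ ≤ ε n) (hf0 : ∀ n, ∀ z ∉ K, f n z = 0) :
    Tendsto (fun n => eLpNorm (f n) q μ) atTop (𝓝 0) := by
  have h1 : ∀ n, eLpNorm (f n) q μ ≤ μ K ^ q.toReal⁻¹ * ENNReal.ofReal (ε n) := fun n => by
    have hi : K.indicator (f n) = f n := indicator_eq_self.2 fun z hz => by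
      by_contra h; exact hz (hf0 n z h)
    rw [← hi, eLpNorm_indicator_eq_eLpNorm_restrict hK.measurableSet]
    simpa using eLpNorm_le_of_ae_bound (μ := μ.restrict K) (p := q)
      (Eventually.of_forall (hf n))
  refine tendsto_of_tendsto_of_tendsto_of_le_of_le tendsto_const_nhds ?_ (fun n => zero_le) h1
  have h2 := ENNReal.Tendsto.const_mul (a := μ K ^ q.toReal⁻¹) (ENNReal.tendsto_ofReal hε)
    (Or.inr (ENNReal.rpow_ne_top_of_nonneg (by positivity) hK.measure_lt_top.ne))
  simpa using h2

/-- Compactly supported `C^1` functions belong to `W^{1,p}_{λ,0}`. -/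
theorem memWZero_of_contDiff (hγ : 0 ≤ γ) (hΩ : IsOpen Ω) {φ : Space N l → ℝ}
    (hφ : ContDiff ℝ 1 φ) (hc : HasCompactSupport φ) (hs : tsupport φ ⊆ Ω) :
    MemWZero p γ Ω φ (grushinGrad γ φ) where
  memLp := (hφ.continuous.memLp_of_hasCompactSupport hc).restrict Ω
  memLp_grad := ((continuous_grushinGrad hγ hφ).memLp_of_hasCompactSupport
    (hasCompactSupport_grushinGrad γ hc)).restrict Ω
  weak_grad ψ hψ := setIntegral_smul_grushinGrad hγ hΩ hφ.contDiffOn (hψ.smooth.of_le (by simp))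
    hψ.compact hψ.subset
  approx := by
    obtain ⟨K, hK, hKΩ, hap⟩ := exists_contDiff_approx hΩ hφ hc hs
    have hε : ∀ n : ℕ, (0 : ℝ) < 1 / ((n : ℝ) + 1) := fun n => by positivity
    choose ψ hψ1 hψ2 hψ3 using fun n : ℕ => hap _ (hε n)
    have hεl : Tendsto (fun n : ℕ => 1 / ((n : ℝ) + 1)) atTop (𝓝 0) :=
      tendsto_one_div_add_atTop_nhds_zero_nat
    obtain ⟨M, hM⟩ := (hK.union hc).exists_bound_of_continuousOn
      (continuous_norm_xPart_rpow (N := N) (l := l) hγ).continuousOn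
    have hM0 : 0 ≤ max M 0 := le_max_right _ _
    refine ⟨ψ, fun n => ⟨hψ1 n, hK.of_isClosed_subset (isClosed_tsupport _) (hψ2 n),
      (hψ2 n).trans hKΩ⟩, ?_, ?_⟩
    · refine tendsto_eLpNorm_zero_of_norm_le (hK.union hc) hεl (fun n z => (hψ3 n z).1) ?_
      intro n z hz
      rw [image_eq_zero_of_notMem_tsupport fun h => hz (Or.inl (hψ2 n h)),
        image_eq_zero_of_notMem_tsupport fun h => hz (Or.inr h), sub_zero]
    · have h0 : ∀ n, ∀ z ∉ K ∪ tsupport φ, grushinGrad γ (ψ n) z - grushinGrad γ φ z = 0 := by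
        intro n z hz
        rw [grushinGrad_eq_zero_of_notMem_tsupport fun h => hz (Or.inl (hψ2 n h)),
          grushinGrad_eq_zero_of_notMem_tsupport fun h => hz (Or.inr h), sub_zero]
      refine tendsto_eLpNorm_zero_of_norm_le (hK.union hc)
        (ε := fun n => (1 + max M 0) * (1 / ((n : ℝ) + 1))) (by simpa using hεl.const_mul _) ?_ h0
      intro n z
      by_cases hz : z ∈ K ∪ tsupport φ
      · have e : grushinGrad γ (ψ n) z - grushinGrad γ φ z
            = stretch (‖xPart z‖ ^ γ) (gradient (ψ n) z - gradient φ z) := by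
          rw [sub_eq_add_neg (gradient _ _), ← neg_one_smul ℝ (gradient φ z), stretch_add,
            stretch_smul, neg_one_smul, ← sub_eq_add_neg]
          rfl
        rw [e]
        have h1 : ‖xPart z‖ ^ γ ≤ max M 0 :=
          ((le_abs_self _).trans (hM z hz)).trans (le_max_left _ _)
        have h2 : ‖gradient (ψ n) z - gradient φ z‖ ≤ 1 / ((n : ℝ) + 1) := by
          rw [gradient, gradient, ← map_sub, LinearIsometryEquiv.norm_map]
          exact (hψ3 n z).2
        calc _ ≤ (1 + ‖xPart z‖ ^ γ) * ‖gradient (ψ n) z - gradient φ z‖ :=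
              norm_stretch_le (by positivity) _
          _ ≤ _ := by gcongr
      · rw [h0 n z hz, norm_zero]
        positivity

/-- Functions of `W^{1,p}_{λ,0}` can be integrated by parts against test functions that do not
vanish on the boundary. -/
theorem MemWZero.setIntegral_smul (hp : 1 < p) (hγ : 0 ≤ γ) (hΩ : IsOpen Ω) {u : Space N l → ℝ}
    {G : Space N l → Space N l} (hu : MemWZero p γ Ω u G) {η : Space N l → ℝ}
    (hη : ContDiff ℝ 1 η) (hc : HasCompactSupport η) :
    ∫ z in Ω, η z • G z = -∫ z in Ω, u z • grushinGrad γ η z := by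
  obtain ⟨φ, hφ, hφ1, hφ2⟩ := hu.approx
  have hpq := Real.HolderConjugate.conjExponent hp
  have hpq1 : ENNReal.HolderTriple (ENNReal.ofReal p) (ENNReal.ofReal p.conjExponent) 1 :=
    hpq.ennrealOfReal
  have hpq2 : ENNReal.HolderTriple (ENNReal.ofReal p.conjExponent) (ENNReal.ofReal p) 1 :=
    hpq.symm.ennrealOfReal
  have hφd : ∀ n, ContDiff ℝ 1 (φ n) := fun n => (hφ n).smooth.of_le (by simp)
  have hηG := continuous_grushinGrad hγ hη
  have hηL : MemLp η (ENNReal.ofReal p.conjExponent) (volume.restrict Ω) :=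
    (hη.continuous.memLp_of_hasCompactSupport hc).restrict Ω
  have hηGL : MemLp (grushinGrad γ η) (ENNReal.ofReal p.conjExponent) (volume.restrict Ω) :=
    (hηG.memLp_of_hasCompactSupport (hasCompactSupport_grushinGrad γ hc)).restrict Ω
  -- Here the compact support inside `Ω` is that of `φ n`, which is why `η` may reach the boundary.
  -- Both sides then pass to the limit by Hölder's inequality.
  have heq : ∀ n, ∫ z in Ω, η z • grushinGrad γ (φ n) z
      = -∫ z in Ω, φ n z • grushinGrad γ η z := fun n =>
    setIntegral_smul_grushinGrad hγ hΩ hη.contDiffOn (hφd n) (hφ n).compact (hφ n).subset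
  have hlim1 : Tendsto (fun n => ∫ z in Ω, φ n z • grushinGrad γ η z) atTop
      (𝓝 (∫ z in Ω, u z • grushinGrad γ η z)) := by
    refine tendsto_integral_of_L1' _
      (hu.memLp.aestronglyMeasurable.smul hηGL.aestronglyMeasurable)
      (Eventually.of_forall fun n => ?_) ?_
    · exact (((hφd n).continuous.smul hηG).integrable_of_hasCompactSupport
        (hφ n).compact.smul_right).integrableOn
    · have hb : ∀ n, eLpNorm ((fun z => φ n z • grushinGrad γ η z) - fun z => u z • grushinGrad γ η z)
          1 (volume.restrict Ω) ≤ eLpNorm (fun z => φ n z - u z) (ENNReal.ofReal p)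
            (volume.restrict Ω) * eLpNorm (grushinGrad γ η) (ENNReal.ofReal p.conjExponent)
            (volume.restrict Ω) := fun n => by
        have := eLpNorm_smul_le_mul_eLpNorm (r := 1) (p := ENNReal.ofReal p)
          (q := ENNReal.ofReal p.conjExponent) hηGL.aestronglyMeasurable
          (((hφd n).continuous.aestronglyMeasurable (μ := volume.restrict Ω)).sub
            hu.memLp.aestronglyMeasurable)
        convert this using 2
        · ext1 z
          simp [sub_smul]
        · rfl
      have h2 := ENNReal.Tendsto.mul_const hφ1 (Or.inr hηGL.eLpNorm_ne_top)
      rw [zero_mul] at h2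
      exact tendsto_of_tendsto_of_tendsto_of_le_of_le tendsto_const_nhds h2 (fun n => zero_le) hb
  have hlim2 : Tendsto (fun n => ∫ z in Ω, η z • grushinGrad γ (φ n) z) atTop
      (𝓝 (∫ z in Ω, η z • G z)) := by
    refine tendsto_integral_of_L1' _
      (hηL.aestronglyMeasurable.smul hu.memLp_grad.aestronglyMeasurable)
      (Eventually.of_forall fun n => ?_) ?_
    · exact ((hη.continuous.smul (continuous_grushinGrad hγ (hφd n))).integrable_of_hasCompactSupport
        hc.smul_right).integrableOn
    · have hb : ∀ n, eLpNorm ((fun z => η z • grushinGrad γ (φ n) z) - fun z => η z • G z)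
          1 (volume.restrict Ω) ≤ eLpNorm η (ENNReal.ofReal p.conjExponent)
            (volume.restrict Ω) * eLpNorm (fun z => grushinGrad γ (φ n) z - G z)
              (ENNReal.ofReal p) (volume.restrict Ω) := fun n => by
        have := eLpNorm_smul_le_mul_eLpNorm (r := 1) (q := ENNReal.ofReal p)
          (p := ENNReal.ofReal p.conjExponent)
          (((continuous_grushinGrad hγ (hφd n)).aestronglyMeasurable (μ := volume.restrict Ω)).sub
            hu.memLp_grad.aestronglyMeasurable) hηL.aestronglyMeasurable
        convert this using 2
        · ext1 z
          simp [smul_sub]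
        · rfl
      have h2 := ENNReal.Tendsto.const_mul hφ2 (Or.inr hηL.eLpNorm_ne_top)
      rw [mul_zero] at h2
      exact tendsto_of_tendsto_of_tendsto_of_le_of_le tendsto_const_nhds h2 (fun n => zero_le) hb
  exact tendsto_nhds_unique hlim2 ((hlim1.neg).congr fun n => (heq n).symm)

/-- The weak Grushin gradient of a `C^1` function is the classical one. -/
theorem MemWZero.ae_eq_grushinGrad (hp : 1 < p) (hγ : 0 ≤ γ) (hΩ : IsOpen Ω) {u : Space N l → ℝ}
    {G : Space N l → Space N l} (hu : MemWZero p γ Ω u G) (hud : ContDiffOn ℝ 1 u Ω) :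
    G =ᵐ[volume.restrict Ω] grushinGrad γ u := by
  have hcont := continuousOn_grushinGrad hγ hΩ hud
  have hloc : LocallyIntegrableOn (fun z => G z - grushinGrad γ u z) Ω := by
    refine LocallyIntegrableOn.sub ?_ (hcont.locallyIntegrableOn hΩ.measurableSet)
    have h1 : LocallyIntegrable G (volume.restrict Ω) := hu.memLp_grad.locallyIntegrable
      (by rw [← ENNReal.ofReal_one]; exact ENNReal.ofReal_le_ofReal hp.le)
    exact locallyIntegrableOn_of_locallyIntegrable_restrict h1
  have h := hΩ.ae_eq_zero_of_integral_contDiff_smul_eq_zero hloc fun η hη hc hs => by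
    have hη1 : ContDiff ℝ 1 η := hη.of_le (by simp)
    have e1 := hu.setIntegral_smul hp hγ hΩ hη1 hc
    have e2 := setIntegral_smul_grushinGrad hγ hΩ hud hη1 hc hs
    have hi1 : IntegrableOn (fun z => η z • G z) Ω := by
      have h2 : LocallyIntegrable G (volume.restrict Ω) := hu.memLp_grad.locallyIntegrable
        (by rw [← ENNReal.ofReal_one]; exact ENNReal.ofReal_le_ofReal hp.le)
      exact h2.integrable_smul_left_of_hasCompactSupport hη1.continuous hc
    have hi2 : IntegrableOn (fun z => η z • grushinGrad γ u z) Ω := by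
      refine Integrable.integrableOn (Continuous.integrable_of_hasCompactSupport
        (continuous_of_tsupport fun z hz => ?_) hc.smul_right)
      exact hη1.continuous.continuousAt.smul (hcont.continuousAt
        (hΩ.mem_nhds (hs (tsupport_smul_subset_left η (grushinGrad γ u) hz))))
    rw [← setIntegral_eq_integral_of_forall_compl_eq_zero (s := Ω) fun z hz => by
      rw [image_eq_zero_of_notMem_tsupport fun h => hz (hs h), zero_smul]]
    simp_rw [smul_sub]
    rw [integral_sub hi1 hi2, e1, e2]
    simp
  rw [Filter.EventuallyEq, ae_restrict_iff' hΩ.measurableSet]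
  filter_upwards [h] with z hz hzΩ
  exact sub_eq_zero.1 (hz hzΩ)

end Sobolev

end Grushin

/-! ### The local dilations `z ↦ (1 + t η(z)) z` -/

section Dilation

set_option linter.unusedSectionVars false

/-- Solving `z + t g(z) = y` is a fixed point problem for the contraction `z ↦ y - t g(z)`. -/
theorem bijective_add_smul_of_lipschitzWith {E : Type*} [NormedAddCommGroup E] [NormedSpace ℝ E]
    [CompleteSpace E] {g : E → E} {M : NNReal} (hg : LipschitzWith M g) {t : ℝ}
    (ht : |t| * M < 1) : Function.Bijective fun z => z + t • g z := by
  have hc : ∀ y, ContractingWith (‖t‖₊ * M) fun z => y - t • g z := fun y => by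
    refine ⟨by exact_mod_cast ht, ?_⟩
    refine LipschitzWith.of_dist_le_mul fun a b => ?_
    rw [dist_eq_norm, sub_sub_sub_cancel_left, ← smul_sub, norm_smul, ← dist_eq_norm, dist_comm]
    push_cast
    rw [mul_assoc]
    exact mul_le_mul_of_nonneg_left (hg.dist_le_mul _ _) (norm_nonneg _)
  have hfix : ∀ y z, Function.IsFixedPt (fun z => y - t • g z) z ↔ z + t • g z = y := fun y z => by
    rw [Function.IsFixedPt, sub_eq_iff_eq_add, eq_comm]
  refine ⟨fun a b hab => ?_, fun y => ?_⟩
  · exact (hc (b + t • g b)).fixedPoint_unique' ((hfix _ _).2 hab) ((hfix _ _).2 rfl)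
  · exact ⟨_, (hfix y _).1 (hc y).fixedPoint_isFixedPt⟩

theorem image_eq_self_of_bijective {α : Type*} {f : α → α} (hf : Function.Bijective f) {K : Set α}
    (hK : ∀ z ∉ K, f z = z) : f '' K = K := by
  have h : f '' Kᶜ = Kᶜ := (image_congr (g := id) fun z hz => hK z hz).trans (image_id _)
  rw [image_compl_eq hf] at h
  exact compl_injective h

variable {E : Type*} [NormedAddCommGroup E] [InnerProductSpace ℝ E] [FiniteDimensional ℝ E]

/-- The map is `c` times a transvection, whose determinant is one plus a scalar. -/
theorem det_smul_id_add_smulRight {c : ℝ} (hc : c ≠ 0) (hn : 0 < Module.finrank ℝ E)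
    (ℓ : E →L[ℝ] ℝ) (v : E) :
    (c • ContinuousLinearMap.id ℝ E + ℓ.smulRight v).det
      = c ^ Module.finrank ℝ E + c ^ (Module.finrank ℝ E - 1) * ℓ v := by
  have h : ((c • ContinuousLinearMap.id ℝ E + ℓ.smulRight v : E →L[ℝ] E) : E →ₗ[ℝ] E)
      = c • LinearMap.transvection (c⁻¹ • (ℓ : E →ₗ[ℝ] ℝ)) v := by
    ext w
    simp [LinearMap.transvection, smul_smul, hc]
  rw [ContinuousLinearMap.det, h, LinearMap.det_smul, LinearMap.transvection.det]
  obtain ⟨n, hn⟩ := Nat.exists_eq_succ_of_ne_zero hn.ne'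
  simp only [hn, Nat.succ_eq_add_one, Nat.add_sub_cancel, LinearMap.smul_apply, smul_eq_mul,
    ContinuousLinearMap.coe_coe, pow_succ]
  field_simp

/-- The map `z ↦ (1 + t η(z)) z`. -/
noncomputable def dilation (η : E → ℝ) (t : ℝ) (z : E) : E := (1 + t * η z) • z

variable {η : E → ℝ}

theorem dilation_eq (η : E → ℝ) (t : ℝ) (z : E) : dilation η t z = z + t • (η z • z) := by
  rw [dilation, add_smul, one_smul, mul_smul]

theorem dilation_of_notMem {z : E} (hz : z ∉ tsupport η) (t : ℝ) : dilation η t z = z := by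
  simp [dilation, image_eq_zero_of_notMem_tsupport hz]

theorem contDiff_dilation (hη : ContDiff ℝ 1 η) (t : ℝ) : ContDiff ℝ 1 (dilation η t) :=
  (contDiff_const.add (contDiff_const.mul hη)).smul contDiff_id

theorem hasFDerivAt_dilation (hη : ContDiff ℝ 1 η) (t : ℝ) (z : E) :
    HasFDerivAt (dilation η t)
      ((1 + t * η z) • ContinuousLinearMap.id ℝ E + (t • fderiv ℝ η z).smulRight z) z :=
  (((hη.differentiable one_ne_zero z).hasFDerivAt.const_mul t).const_add 1).smul (hasFDerivAt_id z)

theorem hasGradientAt_comp_dilation (hη : ContDiff ℝ 1 η) {u : E → ℝ} (hu : ContDiff ℝ 1 u)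
    (t : ℝ) (z : E) :
    HasGradientAt (fun z => u (dilation η t z)) ((1 + t * η z) • gradient u (dilation η t z)
      + (t * ⟪z, gradient u (dilation η t z)⟫_ℝ) • gradient η z) z := by
  rw [hasGradientAt_iff_hasFDerivAt]
  refine ((hu.differentiable one_ne_zero _).hasFDerivAt.comp z
    (hasFDerivAt_dilation hη t z)).congr_fderiv ?_
  ext v
  simp [inner_gradient_left, real_inner_comm _ z]
  ring

variable [MeasurableSpace E] [BorelSpace E]

/-- The dilation is a bijection fixing the complement of the support, so it maps the support onto
itself. The Jacobian factors as `(1 + t η)^(n-1) (1 + t η + t ⟨∇η, z⟩)`; the two positivity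
assumptions remove its absolute value. -/
theorem setIntegral_dilation (hn : 0 < Module.finrank ℝ E) (hη : ContDiff ℝ 1 η) {t : ℝ}
    (hb : Function.Bijective (dilation η t)) (h1 : ∀ z, 0 < 1 + t * η z)
    (h2 : ∀ z, 0 < 1 + t * η z + t * ⟪gradient η z, z⟫_ℝ) (h : E → ℝ) :
    ∫ z in tsupport η, h z = ∫ z in tsupport η, ((1 + t * η z) ^ Module.finrank ℝ E
      + (1 + t * η z) ^ (Module.finrank ℝ E - 1) * (t * ⟪gradient η z, z⟫_ℝ))
        * h (dilation η t z) := by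
  have key := integral_image_eq_integral_abs_det_fderiv_smul volume
    (isClosed_tsupport η).measurableSet
    (fun z _ => (hasFDerivAt_dilation hη t z).hasFDerivWithinAt) hb.injective.injOn h
  rw [image_eq_self_of_bijective hb fun z hz => dilation_of_notMem hz t] at key
  rw [key]
  congr 1 with z
  rw [det_smul_id_add_smulRight (h1 z).ne' hn, smul_eq_mul, inner_gradient_left,
    smul_apply, smul_eq_mul, abs_of_pos]
  obtain ⟨n, hn⟩ := Nat.exists_eq_succ_of_ne_zero hn.ne'
  have h3 := h2 z
  rw [inner_gradient_left] at h3
  rw [hn, Nat.succ_eq_add_one, Nat.add_sub_cancel, pow_succ, ← mul_add]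
  exact mul_pos (pow_pos (h1 z) _) h3

theorem abs_sub_dilation_le {u : E → ℝ} {C : NNReal} (hu : LipschitzWith C u) (t : ℝ) (z : E) :
    |u (dilation η t z) - u z| ≤ C * (|t| * ‖η z • z‖) := by
  have := hu.dist_le_mul (dilation η t z) z
  rwa [Real.dist_eq, dist_eq_norm, dilation_eq, add_sub_cancel_left, norm_smul, Real.norm_eq_abs,
    ← dilation_eq] at this

theorem exists_dilation_bound (hη : ContDiff ℝ 1 η) (hc : HasCompactSupport η) :
    ∃ M : NNReal, 0 < M ∧ (∀ z, |η z| ≤ M) ∧ (∀ z, |⟪gradient η z, z⟫_ℝ| ≤ M) ∧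
      LipschitzWith M fun z => η z • z := by
  obtain ⟨A, hA⟩ := hη.continuous.bounded_above_of_compact_support hc
  have hc2 : HasCompactSupport fun z => ⟪gradient η z, z⟫_ℝ := hc.mono' fun z hz => by
    by_contra h
    exact hz (by simp [gradient_eq_zero_of_notMem_tsupport h])
  obtain ⟨B, hB⟩ := (hη.continuous_gradient.inner continuous_id).bounded_above_of_compact_support hc2
  obtain ⟨C, hC⟩ := ContDiff.lipschitzWith_of_hasCompactSupport (𝕂 := ℝ)
    (hc.smul_right (f' := fun z : E => z)) (hη.smul contDiff_id) one_ne_zero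
  refine ⟨A.toNNReal + B.toNNReal + C + 1, by positivity, fun z => ?_, fun z => ?_,
    hC.weaken ?_⟩
  · push_cast
    have := (hA z).trans (Real.le_coe_toNNReal A)
    rw [Real.norm_eq_abs] at this
    linarith [B.toNNReal.coe_nonneg, C.coe_nonneg]
  · push_cast
    have := (hB z).trans (Real.le_coe_toNNReal B)
    rw [Real.norm_eq_abs] at this
    linarith [A.toNNReal.coe_nonneg, C.coe_nonneg]
  · rw [add_assoc, add_comm]
    exact (le_self_add).trans le_self_add

end Dilation

/-! ### Inner variations of the `p`-energy -/

namespace Grushin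

variable {N l : ℕ} {p γ : ℝ} {η u : Space N l → ℝ}

section VariationDensity

theorem stretch_mul_sub_stretch (a c : ℝ) (v : Space N l) :
    stretch (a * c) v - stretch a v = (c - 1) • (stretch a v - stretch 0 v) :=
  ext_inl_inr (fun i => by simp) (fun j => by simp; ring)

theorem grushinGrad_comp_dilation (hη : ContDiff ℝ 1 η) (hu : ContDiff ℝ 1 u) (t : ℝ)
    (z : Space N l) :
    grushinGrad γ (fun z => u (dilation η t z)) z = stretch (‖xPart z‖ ^ γ)
      ((1 + t * η z) • gradient u (dilation η t z)
        + (t * ⟪z, gradient u (dilation η t z)⟫_ℝ) • gradient η z) := by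
  rw [grushinGrad, (hasGradientAt_comp_dilation hη hu t z).gradient, weight_eq_stretch]

theorem xPart_smul (c : ℝ) (z : Space N l) : xPart (c • z) = c • xPart z := by
  ext i; simp

/-- The weight is positively homogeneous of degree `γ` in `x`. The factor `(1 + t η)^γ` is the
origin of the degenerate term in the identity. -/
theorem grushinGrad_dilation {t : ℝ} {z : Space N l} (h : 0 ≤ 1 + t * η z) :
    grushinGrad γ u (dilation η t z)
      = stretch (‖xPart z‖ ^ γ * (1 + t * η z) ^ γ) (gradient u (dilation η t z)) := by
  rw [grushinGrad, weight_eq_stretch]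
  congr 1
  rw [dilation, xPart_smul, norm_smul, Real.norm_of_nonneg h, Real.mul_rpow h (norm_nonneg _),
    mul_comm]

/-- The derivative in `t` of the `p`-energy density of `z ↦ u ((1 + t η(z)) z)`, up to the change
of variables `z ↦ (1 + t η(z)) z`, in the form of a difference quotient that makes sense at
`t = 0`. -/
noncomputable def variationDensity (p γ : ℝ) (η u : Space N l → ℝ) (t : ℝ) (z : Space N l) : ℝ :=
  ⟪‖grushinGrad γ (fun z => u (dilation η t z)) z‖ ^ (p - 2) •
      grushinGrad γ (fun z => u (dilation η t z)) z,
    η z • stretch (‖xPart z‖ ^ γ) (gradient u (dilation η t z))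
      + ⟪z, gradient u (dilation η t z)⟫_ℝ • stretch (‖xPart z‖ ^ γ) (gradient η z)
      - (η z * dslope (fun s : ℝ => (1 + s) ^ γ) 0 (t * η z)) •
        (stretch (‖xPart z‖ ^ γ) (gradient u (dilation η t z))
          - stretch 0 (gradient u (dilation η t z)))⟫_ℝ
  - ‖grushinGrad γ u (dilation η t z)‖ ^ p / p *
    (η z * dslope (fun s : ℝ => (1 + s) ^ (N + l)) 0 (t * η z)
      + (1 + t * η z) ^ (N + l - 1) * ⟪gradient η z, z⟫_ℝ)

/-- An exact first-order expansion whose coefficient is continuous at `s = 0`, so that dividing by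
`t` leaves no singular expression. -/
theorem dslope_one_add_rpow (s : ℝ) :
    (1 + s) ^ γ = 1 + s * dslope (fun s : ℝ => (1 + s) ^ γ) 0 s := by
  have := sub_smul_dslope (fun s : ℝ => (1 + s) ^ γ) 0 s
  simp at this
  rw [this]; ring

theorem dslope_one_add_pow (n : ℕ) (s : ℝ) :
    (1 + s) ^ n = 1 + s * dslope (fun s : ℝ => (1 + s) ^ n) 0 s := by
  have := sub_smul_dslope (fun s : ℝ => (1 + s) ^ n) 0 s
  simp at this
  rw [this]; ring

theorem hasDerivAt_one_add_rpow (γ : ℝ) : HasDerivAt (fun s : ℝ => (1 + s) ^ γ) γ 0 := by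
  have := ((hasDerivAt_id (0 : ℝ)).const_add 1).rpow_const (p := γ) (Or.inl (by simp))
  simpa using this

theorem hasDerivAt_one_add_pow (n : ℕ) : HasDerivAt (fun s : ℝ => (1 + s) ^ n) n 0 := by
  have := ((hasDerivAt_id' (0 : ℝ)).const_add 1).fun_pow n
  simpa using this

/-- Convexity at `ξ = ∇_γ(u ∘ Φ_t)` bounds `L(ξ) - L(ζ)` by the pairing of `|ξ|^(p-2) ξ` with `ξ -
ζ`, where `ζ = (∇_γ u) ∘ Φ_t`. Both `ξ - ζ` and the Jacobian minus one are exactly `t` times an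
explicit expression. Differentiability of the gradient of `u` is never used. -/
theorem energy_sub_le_variationDensity (hp : 1 < p) (hη : ContDiff ℝ 1 η) (hu : ContDiff ℝ 1 u)
    {t : ℝ} {z : Space N l} (h : 0 ≤ 1 + t * η z) :
    ‖grushinGrad γ (fun z => u (dilation η t z)) z‖ ^ p / p
      - ((1 + t * η z) ^ (N + l) + (1 + t * η z) ^ (N + l - 1) * (t * ⟪gradient η z, z⟫_ℝ))
        * (‖grushinGrad γ u (dilation η t z)‖ ^ p / p)
      ≤ t * variationDensity p γ η u t z := by
  have hd : grushinGrad γ (fun z => u (dilation η t z)) z - grushinGrad γ u (dilation η t z)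
      = t • (η z • stretch (‖xPart z‖ ^ γ) (gradient u (dilation η t z))
      + ⟪z, gradient u (dilation η t z)⟫_ℝ • stretch (‖xPart z‖ ^ γ) (gradient η z)
      - (η z * dslope (fun s : ℝ => (1 + s) ^ γ) 0 (t * η z)) •
        (stretch (‖xPart z‖ ^ γ) (gradient u (dilation η t z))
          - stretch 0 (gradient u (dilation η t z)))) := by
    rw [grushinGrad_comp_dilation hη hu, grushinGrad_dilation h, ← sub_sub_sub_cancel_right _ _
      (stretch (‖xPart z‖ ^ γ) (gradient u (dilation η t z))), stretch_mul_sub_stretch,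
      dslope_one_add_rpow, stretch_add, stretch_smul, stretch_smul]
    module
  have hconv := norm_rpow_sub_two_mul_inner_sub_le hp
    (grushinGrad γ (fun z => u (dilation η t z)) z) (grushinGrad γ u (dilation η t z))
  rw [← neg_sub (grushinGrad γ _ z), inner_neg_right, hd, inner_smul_right] at hconv
  rw [variationDensity, real_inner_smul_left, dslope_one_add_pow]
  rw [sub_div] at hconv
  linarith

/-- Joint continuity, including `t = 0`, lets the integral of the density pass to the limit. The
restriction on `(t, z)` keeps `1 + t η` away from the singularity of its real power. -/
theorem continuousOn_variationDensity (hp : 1 < p) (hγ : 0 ≤ γ) (hη : ContDiff ℝ 1 η)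
    (hu : ContDiff ℝ 1 u) : ContinuousOn (Function.uncurry (variationDensity p γ η u))
      {q : ℝ × Space N l | -1 < q.1 * η q.2} := by
  have hη' : Continuous fun q : ℝ × Space N l => η q.2 := hη.continuous.comp continuous_snd
  have hc : Continuous fun q : ℝ × Space N l => q.1 * η q.2 := continuous_fst.mul hη'
  have hdil : Continuous fun q : ℝ × Space N l => dilation η q.1 q.2 :=
    (continuous_const.add hc).smul continuous_snd
  have hζ : Continuous fun q : ℝ × Space N l => gradient η q.2 :=
    hη.continuous_gradient.comp continuous_snd
  have hq : Continuous fun q : ℝ × Space N l => gradient u (dilation η q.1 q.2) :=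
    hu.continuous_gradient.comp hdil
  have ha : Continuous fun q : ℝ × Space N l => ‖xPart q.2‖ ^ γ :=
    (continuous_norm_xPart_rpow hγ).comp continuous_snd
  have hst : Continuous fun q : ℝ × Space N l => stretch q.1 q.2 :=
    (contDiff_stretch (n := 0)).continuous
  have hzq : Continuous fun q : ℝ × Space N l => ⟪q.2, gradient u (dilation η q.1 q.2)⟫_ℝ :=
    continuous_snd.inner hq
  have h1 : Continuous fun q : ℝ × Space N l =>
      grushinGrad γ (fun z => u (dilation η q.1 z)) q.2 := by
    simp_rw [grushinGrad_comp_dilation hη hu]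
    exact hst.comp (ha.prodMk (((continuous_const.add hc).smul hq).add
      ((continuous_fst.mul hzq).smul hζ)))
  have hds : ContinuousOn (fun q : ℝ × Space N l =>
      dslope (fun s : ℝ => (1 + s) ^ γ) 0 (q.1 * η q.2)) {q | -1 < q.1 * η q.2} := by
    have : ContinuousOn (dslope (fun s : ℝ => (1 + s) ^ γ) 0) (Ioi (-1)) :=
      (continuousOn_dslope (Ioi_mem_nhds (by norm_num))).2
        ⟨fun s hs => ((by fun_prop : ContinuousAt (fun s : ℝ => 1 + s) s).rpow_const
          (Or.inl (by linarith [mem_Ioi.1 hs]))).continuousWithinAt,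
          (hasDerivAt_one_add_rpow γ).differentiableAt⟩
    exact this.comp hc.continuousOn fun q hq => hq
  have hdn : Continuous fun q : ℝ × Space N l =>
      dslope (fun s : ℝ => (1 + s) ^ (N + l)) 0 (q.1 * η q.2) := by
    have : Continuous (dslope (fun s : ℝ => (1 + s) ^ (N + l)) 0) := by
      rw [← continuousOn_univ, continuousOn_dslope univ_mem]
      exact ⟨by fun_prop, (hasDerivAt_one_add_pow _).differentiableAt⟩
    exact this.comp hc
  refine ContinuousOn.sub (ContinuousOn.inner ?_ (ContinuousOn.sub ?_ ?_))
    (Continuous.continuousOn ?_)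
  · exact ((continuous_norm_rpow_sub_two_smul hp).comp h1).continuousOn
  · exact ((hη'.smul (hst.comp (ha.prodMk hq))).add
      (hzq.smul (hst.comp (ha.prodMk hζ)))).continuousOn
  · exact (hη'.continuousOn.mul hds).smul
      ((hst.comp (ha.prodMk hq)).sub (hst.comp (continuous_const.prodMk hq))).continuousOn
  · refine Continuous.mul ?_ ((hη'.mul hdn).add (((continuous_const.add hc).pow _).mul
      (hζ.inner continuous_snd)))
    exact (((continuous_grushinGrad hγ hu).comp hdil).norm.rpow_const
      fun _ => Or.inr (by linarith)).div_const p

theorem continuous_variationDensity (hp : 1 < p) (hγ : 0 ≤ γ) (hη : ContDiff ℝ 1 η)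
    (hu : ContDiff ℝ 1 u) {t : ℝ} (h1 : ∀ z, -1 < t * η z) :
    Continuous fun z => variationDensity p γ η u t z := by
  rw [← continuousOn_univ]
  have hm : MapsTo (fun z : Space N l => (t, z)) univ {q : ℝ × Space N l | -1 < q.1 * η q.2} :=
    fun z _ => by
      show -1 < t * η z
      exact h1 z
  have hi : ContinuousOn (fun z : Space N l => (t, z)) univ := by fun_prop
  have hcomp := (continuousOn_variationDensity hp hγ hη hu).comp hi hm
  simpa only [Function.comp_def, Function.uncurry_apply_pair] using hcomp

theorem variationDensity_of_notMem {z : Space N l} (hz : z ∉ tsupport η) (t : ℝ) :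
    variationDensity p γ η u t z = 0 := by
  simp [variationDensity, image_eq_zero_of_notMem_tsupport hz,
    gradient_eq_zero_of_notMem_tsupport hz, stretch_zero]

end VariationDensity

section InnerVariation

theorem grushinGrad_fun_sub {f g : Space N l → ℝ} {z : Space N l} (hf : DifferentiableAt ℝ f z)
    (hg : DifferentiableAt ℝ g z) :
    grushinGrad γ (fun z => f z - g z) z = grushinGrad γ f z - grushinGrad γ g z := by
  ext i
  rw [PiLp.sub_apply, grushinGrad_apply, grushinGrad_apply, grushinGrad_apply,
    fderiv_fun_sub hf hg]
  simp [mul_sub]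

/-- Convexity is used twice. At `∇_γ u` it bounds the weak equation tested with `u ∘ Φ_t - u` by a
difference of energies; after the change of variables in the energy of `u`, it is used at `∇_γ(u ∘
Φ_t)`. -/
theorem integral_mul_sub_le_variationDensity (hp : 1 < p) (hγ : 0 ≤ γ) (hn : 0 < N + l)
    (hη : ContDiff ℝ 1 η) (hc : HasCompactSupport η) (hu : ContDiff ℝ 1 u) {R : Space N l → ℝ}
    (hR : ∀ φ : Space N l → ℝ, ContDiff ℝ 1 φ → tsupport φ ⊆ tsupport η →
      ∫ z, ‖grushinGrad γ u z‖ ^ (p - 2) * ⟪grushinGrad γ u z, grushinGrad γ φ z⟫_ℝ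
        = ∫ z, R z * φ z) {t : ℝ} (hb : Function.Bijective (dilation η t))
    (h1 : ∀ z, 0 < 1 + t * η z) (h2 : ∀ z, 0 < 1 + t * η z + t * ⟪gradient η z, z⟫_ℝ) :
    ∫ z, R z * (u (dilation η t z) - u z) ≤ t * ∫ z, variationDensity p γ η u t z := by
  have hut : ContDiff ℝ 1 fun z => u (dilation η t z) := hu.comp (contDiff_dilation hη t)
  have hs : tsupport (fun z => u (dilation η t z) - u z) ⊆ tsupport η :=
    closure_minimal (fun z hz => by
      by_contra h
      exact hz (by simp [dilation_of_notMem h])) (isClosed_tsupport η)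
  have hL : ∀ {v : Space N l → ℝ}, ContDiff ℝ 1 v →
      Continuous fun z => ‖grushinGrad γ v z‖ ^ p / p := fun hv =>
    ((continuous_grushinGrad hγ hv).norm.rpow_const fun _ => Or.inr (by linarith)).div_const p
  have hJ : Continuous fun z => (1 + t * η z) ^ (N + l)
      + (1 + t * η z) ^ (N + l - 1) * (t * ⟪gradient η z, z⟫_ℝ) := by
    have h3 : Continuous fun z => 1 + t * η z :=
      continuous_const.add (continuous_const.mul hη.continuous)
    have h4 : Continuous fun z => ⟪gradient η z, z⟫_ℝ :=
      hη.continuous_gradient.inner continuous_id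
    exact (h3.pow (N + l)).add ((h3.pow (N + l - 1)).mul (continuous_const.mul h4))
  have hV : Continuous fun z => variationDensity p γ η u t z :=
    continuous_variationDensity hp hγ hη hu fun z => by linarith [h1 z]
  have hi : ∀ {v : Space N l → ℝ}, Continuous v → IntegrableOn v (tsupport η) := fun hv =>
    hv.continuousOn.integrableOn_compact hc
  have hA : Continuous fun z => ‖grushinGrad γ u z‖ ^ (p - 2) * ⟪grushinGrad γ u z,
      grushinGrad γ (fun z => u (dilation η t z)) z - grushinGrad γ u z⟫_ℝ := by
    have := Continuous.inner (𝕜 := ℝ)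
      ((continuous_norm_rpow_sub_two_smul hp).comp (continuous_grushinGrad hγ hu))
      ((continuous_grushinGrad hγ hut).sub (continuous_grushinGrad hγ hu))
    simpa only [Function.comp_def, real_inner_smul_left, Pi.sub_apply] using this
  have hJL : Continuous fun z => ((1 + t * η z) ^ (N + l)
      + (1 + t * η z) ^ (N + l - 1) * (t * ⟪gradient η z, z⟫_ℝ))
        * (‖grushinGrad γ u (dilation η t z)‖ ^ p / p) := hJ.mul ((hL hu).comp (contDiff_dilation hη t).continuous)
  have hfin : Module.finrank ℝ (Space N l) = N + l := by simp
  calc ∫ z, R z * (u (dilation η t z) - u z)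
      = ∫ z, ‖grushinGrad γ u z‖ ^ (p - 2) * ⟪grushinGrad γ u z,
          grushinGrad γ (fun z => u (dilation η t z) - u z) z⟫_ℝ := (hR _ (hut.sub hu) hs).symm
    _ = ∫ z in tsupport η, ‖grushinGrad γ u z‖ ^ (p - 2) * ⟪grushinGrad γ u z,
          grushinGrad γ (fun z => u (dilation η t z) - u z) z⟫_ℝ :=
        (setIntegral_eq_integral_of_forall_compl_eq_zero fun z hz => by
          rw [grushinGrad_eq_zero_of_notMem_tsupport fun h => hz (hs h), inner_zero_right,
            mul_zero]).symm
    _ = ∫ z in tsupport η, ‖grushinGrad γ u z‖ ^ (p - 2) * ⟪grushinGrad γ u z,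
          grushinGrad γ (fun z => u (dilation η t z)) z - grushinGrad γ u z⟫_ℝ := by
        congr 1 with z
        rw [grushinGrad_fun_sub (hut.differentiable one_ne_zero z) (hu.differentiable one_ne_zero z)]
    _ ≤ ∫ z in tsupport η, (‖grushinGrad γ (fun z => u (dilation η t z)) z‖ ^ p / p
          - ‖grushinGrad γ u z‖ ^ p / p) := by
        refine setIntegral_mono (hi hA) (hi ((hL hut).sub (hL hu))) fun z => ?_
        have := norm_rpow_sub_two_mul_inner_sub_le hp (grushinGrad γ u z)
          (grushinGrad γ (fun z => u (dilation η t z)) z)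
        rwa [sub_div] at this
    _ = ∫ z in tsupport η, (‖grushinGrad γ (fun z => u (dilation η t z)) z‖ ^ p / p
          - ((1 + t * η z) ^ (N + l) + (1 + t * η z) ^ (N + l - 1) * (t * ⟪gradient η z, z⟫_ℝ))
            * (‖grushinGrad γ u (dilation η t z)‖ ^ p / p)) := by
        have hcv := setIntegral_dilation (by rw [hfin]; exact hn) hη hb h1 h2
          fun z => ‖grushinGrad γ u z‖ ^ p / p
        rw [hfin] at hcv
        rw [integral_sub (hi (hL hut)) (hi (hL hu)), integral_sub (hi (hL hut)) (hi hJL), hcv]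
    _ ≤ ∫ z in tsupport η, t * variationDensity p γ η u t z :=
        setIntegral_mono (hi ((hL hut).sub hJL)) (hi (continuous_const.mul hV)) fun z =>
          energy_sub_le_variationDensity hp hη hu (h1 z).le
    _ = t * ∫ z, variationDensity p γ η u t z := by
        rw [integral_const_mul, setIntegral_eq_integral_of_forall_compl_eq_zero fun z hz =>
          variationDensity_of_notMem hz t]

/-- The inequality for `u ∘ Φ_t - u` is divided by `t > 0`. The difference quotients of `u` are
dominated by its Lipschitz constant, and the density is continuous in `t`. -/
theorem integral_mul_inner_le_variationDensity (hp : 1 < p) (hγ : 0 ≤ γ) (hn : 0 < N + l)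
    (hη : ContDiff ℝ 1 η) (hc : HasCompactSupport η) (hu : ContDiff ℝ 1 u)
    (huc : HasCompactSupport u) {R : Space N l → ℝ} (hRc : Continuous R)
    (hR : ∀ φ : Space N l → ℝ, ContDiff ℝ 1 φ → tsupport φ ⊆ tsupport η →
      ∫ z, ‖grushinGrad γ u z‖ ^ (p - 2) * ⟪grushinGrad γ u z, grushinGrad γ φ z⟫_ℝ
        = ∫ z, R z * φ z) :
    ∫ z, R z * (η z * ⟪gradient u z, z⟫_ℝ) ≤ ∫ z, variationDensity p γ η u 0 z := by
  obtain ⟨M, hM0, hM1, hM2, hM3⟩ := exists_dilation_bound hη hc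
  obtain ⟨C, hC⟩ := ContDiff.lipschitzWith_of_hasCompactSupport (𝕂 := ℝ) huc hu one_ne_zero
  have hMr : (0 : ℝ) < M := hM0
  -- For `|t| < δ` each of `t η` and `t ⟨∇η, z⟩` is below `1/2` in absolute value, so the Jacobian
  -- is positive, and the perturbation of the identity is a contraction.
  set δ : ℝ := (2 * M)⁻¹ with hδ
  have hδ0 : 0 < δ := by positivity
  have hb1 : ∀ t ∈ Ioo (-δ) δ, |t| * M < 1 / 2 := fun t ht => by
    have h1 : |t| < δ := abs_lt.2 ht
    calc |t| * M < δ * M := mul_lt_mul_of_pos_right h1 hMr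
      _ = 1 / 2 := by rw [hδ]; field_simp
  have hb2 : ∀ t ∈ Ioo (-δ) δ, ∀ x : ℝ, |x| ≤ M → |t * x| < 1 / 2 := fun t ht x hx => by
    rw [abs_mul]
    exact (mul_le_mul_of_nonneg_left hx (abs_nonneg t)).trans_lt (hb1 t ht)
  have hlim1 : Tendsto (fun t => ∫ z, variationDensity p γ η u t z) (𝓝[>] 0)
      (𝓝 (∫ z, variationDensity p γ η u 0 z)) := by
    have h1 := continuousOn_integral_of_compact_support (μ := (volume : Measure (Space N l)))
      (f := variationDensity p γ η u) (s := Ioo (-δ) δ) hc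
      ((continuousOn_variationDensity hp hγ hη hu).mono fun q hq => by
        have := (abs_lt.1 (hb2 q.1 hq.1 _ (hM1 q.2))).1
        rw [mem_ofPred_eq]
        linarith) fun t z _ hz => variationDensity_of_notMem hz t
    exact (h1.continuousAt (Ioo_mem_nhds (by linarith) hδ0)).tendsto.mono_left nhdsWithin_le_nhds
  have hlim2 : Tendsto (fun t : ℝ => ∫ z, R z * (t⁻¹ * (u (dilation η t z) - u z))) (𝓝[>] 0)
      (𝓝 (∫ z, R z * (η z * ⟪gradient u z, z⟫_ℝ))) := by
    refine tendsto_integral_filter_of_dominated_convergence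
      (fun z => ‖R z‖ * (C * ‖η z • z‖)) ?_ ?_ ?_ ?_
    · exact Eventually.of_forall fun t => (hRc.mul (continuous_const.mul
        ((hu.continuous.comp (contDiff_dilation hη t).continuous).sub
          hu.continuous))).aestronglyMeasurable
    · filter_upwards [self_mem_nhdsWithin] with t ht
      refine Eventually.of_forall fun z => ?_
      rw [norm_mul, norm_mul, norm_inv, Real.norm_of_nonneg (le_of_lt ht)]
      refine mul_le_mul_of_nonneg_left ?_ (norm_nonneg _)
      rw [inv_mul_le_iff₀ ht]
      have := abs_sub_dilation_le (η := η) hC t z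
      rw [abs_of_pos (mem_Ioi.1 ht)] at this
      rw [Real.norm_eq_abs]
      linarith
    · refine Continuous.integrable_of_hasCompactSupport (hRc.norm.mul (continuous_const.mul
        (hη.continuous.smul continuous_id).norm)) (hc.mono fun z hz => fun h => hz ?_)
      simp [h]
    · refine Eventually.of_forall fun z => Tendsto.const_mul _ ?_
      have h1 : HasDerivAt (fun t : ℝ => dilation η t z) (η z • z) 0 := by
        have := ((((hasDerivAt_id' (0 : ℝ)).mul_const (η z)).const_add 1)).smul_const z
        simpa [dilation] using this
      have h2 := ((hu.differentiable one_ne_zero (dilation η 0 z)).hasFDerivAt.comp_hasDerivAt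
        (0 : ℝ) h1)
      have h3 := h2.tendsto_slope_zero_right
      simp only [Function.comp_def, zero_add, smul_eq_mul] at h3
      have h4 : dilation η 0 z = z := by simp [dilation]
      rw [h4, map_smul, smul_eq_mul, ← inner_gradient_left] at h3
      exact h3
  refine le_of_tendsto_of_tendsto hlim2 hlim1 ?_
  filter_upwards [Ioo_mem_nhdsGT hδ0] with t ht
  have ht' : t ∈ Ioo (-δ) δ := ⟨by linarith [ht.1], ht.2⟩
  have key := integral_mul_sub_le_variationDensity hp hγ hn hη hc hu hR (t := t) ?_ ?_ ?_
  · have : ∫ z, R z * (t⁻¹ * (u (dilation η t z) - u z))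
        = t⁻¹ * ∫ z, R z * (u (dilation η t z) - u z) := by
      rw [← integral_const_mul]
      congr 1 with z
      ring
    rw [this, inv_mul_le_iff₀ ht.1]
    exact key
  · have := bijective_add_smul_of_lipschitzWith hM3 (t := t) (by linarith [hb1 t ht'])
    simpa only [← dilation_eq] using this
  · intro z
    linarith [(abs_lt.1 (hb2 t ht' _ (hM1 z))).1]
  · intro z
    linarith [(abs_lt.1 (hb2 t ht' _ (hM1 z))).1, (abs_lt.1 (hb2 t ht' _ (hM2 z))).1]

theorem inner_stretch_sub_stretch_zero (a : ℝ) (v : Space N l) :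
    ⟪stretch a v, stretch a v - stretch 0 v⟫_ℝ = a ^ 2 * ‖yPart v‖ ^ 2 := by
  rw [EuclideanSpace.norm_sq_eq]
  simp [PiLp.inner_apply, Fintype.sum_sum_type, Finset.mul_sum]
  exact Finset.sum_congr rfl fun j _ => by ring

/-- At `t = 0` the density is linear in `η` and its gradient. The coefficient of `η` feeds the
source and that of `∇η` is the part of the Pohozaev field without `F`. -/
theorem variationDensity_zero (p γ : ℝ) (η u : Space N l → ℝ) (z : Space N l) :
    variationDensity p γ η u 0 z = η z * (‖grushinGrad γ u z‖ ^ (p - 2) * ‖grushinGrad γ u z‖ ^ 2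
        - (N + l) * (‖grushinGrad γ u z‖ ^ p / p) - degenerateTerm p γ u z)
      + ⟪⟪gradient u z, z⟫_ℝ • weight γ z (‖grushinGrad γ u z‖ ^ (p - 2) • grushinGrad γ u z)
        - (‖grushinGrad γ u z‖ ^ p / p) • z, gradient η z⟫_ℝ := by
  have hd : ∀ z : Space N l, dilation η 0 z = z := fun z => by simp [dilation]
  have hx : ‖xPart z‖ ^ (2 * γ) = (‖xPart z‖ ^ γ) ^ 2 := by
    rw [mul_comm, Real.rpow_mul (norm_nonneg _), Real.rpow_two]
  have h1 := inner_stretch_sub_stretch_zero (‖xPart z‖ ^ γ) (gradient u z)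
  simp only [variationDensity, hd, zero_mul, dslope_same, (hasDerivAt_one_add_rpow γ).deriv,
    (hasDerivAt_one_add_pow (N + l)).deriv, add_zero, one_pow, one_mul, degenerateTerm, hx]
  rw [← weight_eq_stretch, ← weight_eq_stretch] at *
  have h2 : ⟪weight γ z (‖grushinGrad γ u z‖ ^ (p - 2) • grushinGrad γ u z), gradient η z⟫_ℝ
      = ‖grushinGrad γ u z‖ ^ (p - 2) * ⟪grushinGrad γ u z, weight γ z (gradient η z)⟫_ℝ := by
    rw [weight_eq_stretch, weight_eq_stretch, inner_stretch_left, real_inner_smul_left]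
  rw [← grushinGrad] at *
  eta_reduce
  rw [← grushinGrad]
  rw [inner_sub_left, real_inner_smul_left (weight _ _ _), h2, real_inner_smul_left,
    real_inner_smul_left, inner_sub_right, inner_add_right, inner_smul_right, inner_smul_right,
    inner_smul_right, h1, real_inner_self_eq_norm_sq, real_inner_comm (gradient u z) z,
    real_inner_comm (gradient η z) z]
  push_cast
  ring

/-- The identity obtained from the variations `z ↦ u ((1 + t η(z)) z)` of a weak solution. -/
theorem integral_variationDensity_zero (hp : 1 < p) (hγ : 0 ≤ γ) (hn : 0 < N + l)
    (hη : ContDiff ℝ 1 η) (hc : HasCompactSupport η) (hu : ContDiff ℝ 1 u)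
    (huc : HasCompactSupport u) {R : Space N l → ℝ} (hRc : Continuous R)
    (hR : ∀ φ : Space N l → ℝ, ContDiff ℝ 1 φ → tsupport φ ⊆ tsupport η →
      ∫ z, ‖grushinGrad γ u z‖ ^ (p - 2) * ⟪grushinGrad γ u z, grushinGrad γ φ z⟫_ℝ
        = ∫ z, R z * φ z) :
    ∫ z, variationDensity p γ η u 0 z = ∫ z, R z * (η z * ⟪gradient u z, z⟫_ℝ) := by
  refine le_antisymm ?_ (integral_mul_inner_le_variationDensity hp hγ hn hη hc hu huc hRc hR)
  have hs : tsupport (fun z => -η z) = tsupport η := by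
    rw [tsupport, tsupport]
    congr 1
    ext z
    simp
  have hg : ∀ z, gradient (fun z => -η z) z = -gradient η z := fun z => by
    rw [gradient, gradient, fderiv_fun_neg, map_neg]
  -- At `t = 0` both sides are odd in `η`, so the one-sided estimate for `-η` is the reverse
  -- inequality.
  have h := integral_mul_inner_le_variationDensity (η := fun z => -η z) hp hγ hn hη.neg hc.neg hu
    huc hRc (by rwa [hs])
  have e1 : ∀ z, variationDensity p γ (fun z => -η z) u 0 z = -variationDensity p γ η u 0 z :=
    fun z => by
      rw [variationDensity_zero, variationDensity_zero, hg, inner_neg_right]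
      ring
  simp only [e1, neg_mul, mul_neg, integral_neg] at h
  linarith

end InnerVariation

end Grushin

/-! ### The primitive `F` and the identity in the interior -/

namespace Grushin

variable {N l : ℕ} {p γ : ℝ} {f : Space N l → ℝ → ℝ} {Ω : Set (Space N l)} {u η : Space N l → ℝ}

section Primitive

theorem continuous_primitive (hf : Continuous (Function.uncurry f)) :
    Continuous (Function.uncurry (primitive f)) :=
  intervalIntegral.continuous_parametric_intervalIntegral_of_continuous
    (f := fun (q : Space N l × ℝ) t => f q.1 t)
    (hf.comp ((continuous_fst.comp continuous_fst).prodMk continuous_snd)) continuous_snd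

theorem primitive_zero (f : Space N l → ℝ → ℝ) (z : Space N l) : primitive f z 0 = 0 :=
  intervalIntegral.integral_same

/-- `F` is differentiable in its first variable only at the frozen value `u z`. The remainder `F(w,
u(w)) - F(w, u(z))` is an integral of `f(w, ·)` between nearby values, and joint continuity of `f`
makes it `f(z, u(z)) (u(w) - u(z))` up to a small error. -/
theorem hasGradientAt_primitive_comp (hf : Continuous (Function.uncurry f)) {z : Space N l}
    (hu : DifferentiableAt ℝ u z)
    (hF : DifferentiableAt ℝ (fun w => primitive f w (u z)) z) :
    HasGradientAt (fun w => primitive f w (u w))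
      (gradPrimitive f z (u z) + f z (u z) • gradient u z) z := by
  have hfi : ∀ w a b, IntervalIntegrable (f w) volume a b := fun w a b =>
    (hf.comp (Continuous.prodMk_right w)).intervalIntegrable a b
  have hr : HasFDerivAt (fun w => ∫ t in u z..u w, (f w t - f z (u z))) (0 : Space N l →L[ℝ] ℝ)
      z := by
    rw [hasFDerivAt_iff_isLittleO]
    simp only [intervalIntegral.integral_same, sub_zero, zero_apply]
    refine Asymptotics.IsLittleO.trans_isBigO (g := fun w => u w - u z) ?_ hu.isBigO_sub
    rw [Asymptotics.isLittleO_iff]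
    intro ε hε
    have hfc : ContinuousAt (Function.uncurry f) (z, u z) := hf.continuousAt
    obtain ⟨δ, hδ, hfδ⟩ := Metric.continuousAt_iff.1 hfc ε hε
    filter_upwards [Metric.ball_mem_nhds z hδ, hu.continuousAt (Metric.ball_mem_nhds _ hδ)]
      with w hw huw
    refine intervalIntegral.norm_integral_le_of_norm_le_const fun t ht => ?_
    have htd : dist t (u z) < δ := by
      have h1 : |t - u z| ≤ |u w - u z| :=
        abs_sub_left_of_mem_uIcc (uIoc_subset_uIcc ht)
      exact h1.trans_lt huw
    have := hfδ (x := (w, t)) (max_lt hw htd)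
    exact this.le
  have h2 := (hasGradientAt_iff_hasFDerivAt.1 hF.hasGradientAt).add
    (hr.add ((hu.hasFDerivAt.sub_const (u z)).const_mul (f z (u z))))
  rw [hasGradientAt_iff_hasFDerivAt]
  refine (h2.congr_fderiv ?_).congr_of_eventuallyEq (Eventually.of_forall fun w => ?_)
  · ext v
    simp [gradPrimitive]
  · have e1 : ∫ t in u z..u w, (f w t - f z (u z))
        = (∫ t in u z..u w, f w t) - f z (u z) * (u w - u z) := by
      rw [intervalIntegral.integral_sub (hfi _ _ _) intervalIntegrable_const]
      simp [mul_comm]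
    have e2 : primitive f w (u w) = primitive f w (u z) + ∫ t in u z..u w, f w t :=
      (intervalIntegral.integral_add_adjacent_intervals (hfi _ _ _) (hfi _ _ _)).symm
    simp only [Pi.add_apply, e1, e2]
    ring

end Primitive

section Interior

/-- The function `α` for which `div b = -α` holds for the Pohozaev vector field `b`. -/
noncomputable def pohozaevSource (p γ : ℝ) (f : Space N l → ℝ → ℝ) (u : Space N l → ℝ)
    (z : Space N l) : ℝ :=
  (1 - (N + l) / p) * ‖grushinGrad γ u z‖ ^ p - degenerateTerm p γ u z
    + (N + l) * primitive f z (u z) + ⟪gradPrimitive f z (u z), z⟫_ℝ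

/-- The Pohozaev vector field, `V` being the gradient of `u`. -/
noncomputable def pohozaevField (p γ : ℝ) (f : Space N l → ℝ → ℝ) (u : Space N l → ℝ)
    (V : Space N l → Space N l) (z : Space N l) : Space N l :=
  ⟪V z, z⟫_ℝ • weight γ z (‖weight γ z (V z)‖ ^ (p - 2) • weight γ z (V z))
    + (primitive f z (u z) - ‖weight γ z (V z)‖ ^ p / p) • z

theorem IsWeakSolution.integral_grushinGrad (hp : 1 < p) (hγ : 0 ≤ γ) (hΩ : IsOpen Ω)
    (hu : ContDiffOn ℝ 1 u Ω) (hsol : IsWeakSolution p γ f Ω u) {φ : Space N l → ℝ}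
    (hφ : ContDiff ℝ 1 φ) (hc : HasCompactSupport φ) (hs : tsupport φ ⊆ Ω) :
    ∫ z in Ω, ‖grushinGrad γ u z‖ ^ (p - 2) * ⟪grushinGrad γ u z, grushinGrad γ φ z⟫_ℝ
      = ∫ z in Ω, f z (u z) * φ z := by
  obtain ⟨G, hG, h⟩ := hsol
  rw [← (h φ _ (memWZero_of_contDiff hγ hΩ hφ hc hs)).2]
  refine integral_congr_ae ?_
  filter_upwards [hG.ae_eq_grushinGrad hp hγ hΩ hu] with z hz
  rw [hz]

/-- The Pohozaev identity tested with functions supported inside `Ω`. -/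
theorem IsWeakSolution.integral_pohozaev (hp : 1 < p) (hγ : 0 ≤ γ) (hn : 0 < N + l)
    (hf : Continuous (Function.uncurry f)) (hΩ : IsOpen Ω)
    (hu : ContDiffOn ℝ 1 u Ω) (hsol : IsWeakSolution p γ f Ω u)
    (hFdiff : ∀ z ∈ Ω, DifferentiableAt ℝ (fun w => primitive f w (u z)) z)
    (hFz : IntegrableOn (fun z => ⟪gradPrimitive f z (u z), z⟫_ℝ) Ω)
    (hη : ContDiff ℝ 1 η) (hc : HasCompactSupport η) (hs : tsupport η ⊆ Ω) :
    ∫ z in Ω, (η z * pohozaevSource p γ f u z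
      + ⟪pohozaevField p γ f u (gradient u) z, gradient η z⟫_ℝ) = 0 := by
  obtain ⟨r, hr⟩ := hc.isBounded.subset_ball 0
  obtain ⟨θ, hθ, hθs, hθ1, -⟩ := exists_contDiff_one_nhdsSet (isClosed_tsupport η)
    (hΩ.inter Metric.isOpen_ball) (subset_inter hs hr)
  have hθc : HasCompactSupport θ := (isCompact_closedBall (0 : Space N l) r).of_isClosed_subset
    (isClosed_tsupport θ) (hθs.trans (inter_subset_right.trans Metric.ball_subset_closedBall))
  -- The variations require a function that is `C^1` on the whole space. `v` is one, and it
  -- coincides with `u` near the support of `η`.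
  set v : Space N l → ℝ := fun z => θ z * u z with hv
  have hvd : ContDiff ℝ 1 v := contDiff_of_tsupport fun z hz =>
    ((hθ.of_le (by simp)).contDiffAt).mul
      (hu.contDiffAt (hΩ.mem_nhds (hθs (tsupport_mul_subset_left hz)).1))
  have hvc : HasCompactSupport v := hθc.mul_right
  have hvu : ∀ z ∈ tsupport η, v =ᶠ[𝓝 z] u := fun z hz => by
    filter_upwards [eventually_nhdsSet_iff_forall.1 hθ1 z hz] with w hw
    simp [hv, hw]
  have hgr : ∀ z ∈ tsupport η, gradient v z = gradient u z := fun z hz => (hvu z hz).gradient_eq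
  have hgg : ∀ z ∈ tsupport η, grushinGrad γ v z = grushinGrad γ u z := fun z hz => by
    rw [grushinGrad, hgr z hz, grushinGrad]
  have hRc : Continuous fun z => f z (v z) := hf.comp (continuous_id.prodMk hvd.continuous)
  have hWc : Continuous fun z => primitive f z (v z) :=
    (continuous_primitive hf).comp (continuous_id.prodMk hvd.continuous)
  -- Only test functions supported in `tsupport η` occur, and there `u` and `v` have the same values
  -- and gradients, so `v` satisfies the equation against them.
  have key := integral_variationDensity_zero hp hγ hn hη hc hvd hvc hRc fun φ hφ hφs => by
    have h1 := hsol.integral_grushinGrad hp hγ hΩ hu hφ (hc.of_isClosed_subset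
      (isClosed_tsupport φ) hφs) (hφs.trans hs)
    rw [setIntegral_eq_integral_of_forall_compl_eq_zero,
      setIntegral_eq_integral_of_forall_compl_eq_zero] at h1
    · calc _ = _ := ?_
        _ = _ := h1
        _ = _ := ?_
      · congr 1 with z
        by_cases hz : z ∈ tsupport η
        · rw [hgg z hz]
        · simp [grushinGrad_eq_zero_of_notMem_tsupport fun h => hz (hφs h)]
      · congr 1 with z
        by_cases hz : z ∈ tsupport η
        · rw [(hvu z hz).self_of_nhds]
        · simp [image_eq_zero_of_notMem_tsupport fun h => hz (hφs h)]
    · intro z hz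
      simp [image_eq_zero_of_notMem_tsupport fun h => hz (hs (hφs h))]
    · intro z hz
      simp [grushinGrad_eq_zero_of_notMem_tsupport fun h => hz (hs (hφs h))]
  set g : Space N l → ℝ := fun z => η z * primitive f z (v z) with hg
  have hud : ∀ z ∈ tsupport η, DifferentiableAt ℝ u z := fun z hz =>
    (hu.contDiffAt (hΩ.mem_nhds (hs hz))).differentiableAt one_ne_zero
  have hW : ∀ z ∈ tsupport η, HasGradientAt (fun w => primitive f w (v w))
      (gradPrimitive f z (u z) + f z (u z) • gradient u z) z := fun z hz => by
    have := hasGradientAt_primitive_comp hf (hud z hz) (hFdiff z (hs hz))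
    rw [hasGradientAt_iff_hasFDerivAt] at this ⊢
    refine this.congr_of_eventuallyEq ?_
    filter_upwards [hvu z hz] with w hw
    rw [hw]
  have hgs : tsupport g ⊆ tsupport η := tsupport_mul_subset_left
  -- Differentiability is all that is available, as `∇_z F` need not be continuous. Integrability of
  -- the radial derivative of `g` comes from that of `⟨∇_z F, z⟩`.
  have hgd : ∀ z, HasFDerivAt g (η z • fderiv ℝ (fun w => primitive f w (v w)) z
      + primitive f z (v z) • fderiv ℝ η z) z := fun z => by
    by_cases hz : z ∈ tsupport η
    · exact (hη.differentiable one_ne_zero z).hasFDerivAt.mul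
        (hasGradientAt_iff_hasFDerivAt.1 (hW z hz)).differentiableAt.hasFDerivAt
    · have h0 : g =ᶠ[𝓝 z] fun _ => 0 := by
        filter_upwards [notMem_tsupport_iff_eventuallyEq.1 hz] with w hw
        simp [hg, hw]
      rw [image_eq_zero_of_notMem_tsupport hz,
        image_eq_zero_of_notMem_tsupport fun h => hz (tsupport_fderiv_subset ℝ h)]
      simpa using (hasFDerivAt_const (0 : ℝ) z).congr_of_eventuallyEq h0
  have hgz : ∀ z, fderiv ℝ g z z = η z * ⟪gradPrimitive f z (u z), z⟫_ℝ
      + (f z (v z) * (η z * ⟪gradient v z, z⟫_ℝ) + primitive f z (v z) * ⟪gradient η z, z⟫_ℝ) :=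
    fun z => by
    rw [(hgd z).fderiv]
    by_cases hz : z ∈ tsupport η
    · have h1 : fderiv ℝ (fun w => primitive f w (v w)) z z
          = ⟪gradPrimitive f z (u z) + f z (u z) • gradient u z, z⟫_ℝ := by
        rw [← (hW z hz).gradient, inner_gradient_left]
      rw [add_apply, smul_apply, smul_apply, h1, inner_add_left, real_inner_smul_left, hgr z hz,
        (hvu z hz).self_of_nhds, inner_gradient_left (f := η), smul_eq_mul, smul_eq_mul]
      ring
    · simp [image_eq_zero_of_notMem_tsupport hz, gradient_eq_zero_of_notMem_tsupport hz,
        image_eq_zero_of_notMem_tsupport fun h => hz (tsupport_fderiv_subset ℝ h)]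
  have hcs : ∀ a : Space N l → ℝ, Continuous a → (∀ z ∉ tsupport η, a z = 0) → Integrable a :=
    fun a ha h0 => ha.integrable_of_hasCompactSupport (hc.mono' fun z hz => by
      by_contra h; exact hz (h0 z h))
  have hi1 : Integrable fun z => variationDensity p γ η v 0 z :=
    hcs _ (continuous_variationDensity hp hγ hη hvd (by simp))
      fun z hz => variationDensity_of_notMem hz 0
  have hi2 : Integrable fun z => f z (v z) * (η z * ⟪gradient v z, z⟫_ℝ) :=
    hcs _ (hRc.mul (hη.continuous.mul (hvd.continuous_gradient.inner continuous_id)))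
      fun z hz => by simp [image_eq_zero_of_notMem_tsupport hz]
  have hi3 : Integrable g := hcs _ (hη.continuous.mul hWc)
    fun z hz => by simp [hg, image_eq_zero_of_notMem_tsupport hz]
  have hi4 : Integrable fun z => fderiv ℝ g z z := by
    simp only [hgz]
    refine Integrable.add ?_ (hi2.add (hcs _ (hWc.mul (hη.continuous_gradient.inner continuous_id))
      fun z hz => by simp [gradient_eq_zero_of_notMem_tsupport hz]))
    rw [← integrableOn_iff_integrable_of_support_subset (s := Ω)]
    · exact integrableOn_mul_of_hasCompactSupport hΩ (fun K _ => hFz.mono_set inter_subset_left)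
        hη.continuous hc
    · intro z hz
      by_contra h
      exact hz (by simp [image_eq_zero_of_notMem_tsupport fun h' => h (hs h')])
  have hE := integral_fderiv_apply_self_eq volume (fun z => (hgd z).differentiableAt)
    (hc.of_isClosed_subset (isClosed_tsupport g) hgs) (by simpa using hn) hi4
  -- Each of the two brackets integrates to zero: the first by the inner variation, the second by
  -- the dilation identity for `g`.
  have hpt : ∀ z, η z * pohozaevSource p γ f u z
      + ⟪pohozaevField p γ f u (gradient u) z, gradient η z⟫_ℝ
      = (variationDensity p γ η v 0 z - f z (v z) * (η z * ⟪gradient v z, z⟫_ℝ))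
        + ((N + l) * g z + fderiv ℝ g z z) := fun z => by
    by_cases hz : z ∈ tsupport η
    · rw [hgz, variationDensity_zero, pohozaevSource, pohozaevField, hg]
      simp only
      rw [hgg z hz, hgr z hz,
        (hvu z hz).self_of_nhds, degenerateTerm, degenerateTerm, hgg z hz, hgr z hz,
        norm_rpow_sub_two_mul_sq (by linarith), ← grushinGrad, inner_add_left, inner_sub_left,
        real_inner_smul_left z, real_inner_smul_left z, real_inner_comm (gradient η z) z]
      ring
    · rw [hgz]
      simp [variationDensity_of_notMem hz, hg, image_eq_zero_of_notMem_tsupport hz,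
        gradient_eq_zero_of_notMem_tsupport hz]
  rw [setIntegral_eq_integral_of_forall_compl_eq_zero fun z hz => by
    simp [image_eq_zero_of_notMem_tsupport fun h => hz (hs h),
      gradient_eq_zero_of_notMem_tsupport fun h => hz (hs h)]]
  simp_rw [hpt]
  have hi5 : Integrable fun z => ((N : ℝ) + l) * g z := hi3.const_mul _
  have hi6 : Integrable fun z =>
      variationDensity p γ η v 0 z - f z (v z) * (η z * ⟪gradient v z, z⟫_ℝ) := hi1.sub hi2
  have hi7 : Integrable fun z => ((N : ℝ) + l) * g z + fderiv ℝ g z z := hi5.add hi4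
  rw [integral_add hi6 hi7, integral_sub hi1 hi2, integral_add hi5 hi4, integral_const_mul, hE, key]
  simp
  ring

end Interior

end Grushin

/-! ### Boundary values and normal gradients in a chart -/

namespace Grushin

variable {N l : ℕ} {p γ : ℝ} {Ω : Set (Space N l)} {u : Space N l → ℝ}

namespace IsChart

variable {m : ℕ} {S : (EuclideanSpace ℝ (Fin m) × ℝ) ≃L[ℝ] Space N l}
  {B : Set (EuclideanSpace ℝ (Fin m))} {g : EuclideanSpace ℝ (Fin m) → ℝ} {a b : ℝ}

theorem mem_frontier (h : IsChart Ω S B g a b) (hΩ : IsOpen Ω) {k : EuclideanSpace ℝ (Fin m)}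
    (hk : k ∈ B) : S (k, g k) ∈ frontier Ω := by
  have : S (k, g k) ∈ (fun k => S (k, g k)) '' B := ⟨k, hk, rfl⟩
  rw [← h.frontier_inter_box hΩ] at this
  exact this.1

theorem continuousOn_graph (h : IsChart Ω S B g a b) : ContinuousOn (fun k => S (k, g k)) B :=
  S.continuous.comp_continuousOn (continuousOn_id.prodMk h.contDiffOn.continuousOn)

theorem continuousOn_outerNormal (h : IsChart Ω S B g a b) :
    ContinuousOn (fun k => outerNormal Ω (S (k, g k))) B := by
  have h1 : ContinuousOn (fun k => (graphDensity g k)⁻¹ • S (-gradient g k, 1)) B :=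
    ((graphDensity_continuousOn h.isOpen h.contDiffOn).inv₀
      fun k _ => (graphDensity_pos g k).ne').smul (S.continuous.comp_continuousOn
        ((gradient_continuousOn h.isOpen h.contDiffOn).neg.prodMk continuousOn_const))
  exact h1.congr fun k hk => h.outerNormal_eq hk

/-- If `H` were positive at a boundary point, a bump supported over the part of the graph where `H >
0` would have a positive integral against it. -/
theorem nonpos_of_integral_mul_eq_zero (h : IsChart Ω S B g a b) (hm : N + l = m + 1)
    (hΩ : IsOpen Ω) {H : Space N l → ℝ} (hH : ContinuousOn (fun k => H (S (k, g k))) B)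
    (hint : ∀ η : Space N l → ℝ, ContDiff ℝ 1 η → HasCompactSupport η →
      ∫ z in frontier Ω, η z * H z ∂surfaceMeasure N l = 0)
    {k₀ : EuclideanSpace ℝ (Fin m)} (hk₀ : k₀ ∈ B) : H (S (k₀, g k₀)) ≤ 0 := by
  by_contra! hpos
  set Q : Space N l → EuclideanSpace ℝ (Fin m) := fun z => (S.symm z).1 with hQ
  have hQc : Continuous Q := continuous_fst.comp S.symm.continuous
  have hQS : ∀ k t, Q (S (k, t)) = k := fun k t => by simp [Q]
  set B' : Set (EuclideanSpace ℝ (Fin m)) := B ∩ {k | 0 < H (S (k, g k))} with hB'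
  have hB'o : IsOpen B' := hH.isOpen_inter_preimage h.isOpen isOpen_Ioi
  have hO : IsOpen (S '' (B' ×ˢ Ioo a b)) :=
    S.toHomeomorph.isOpenMap _ (hB'o.prod isOpen_Ioo)
  have hz₀ : S (k₀, g k₀) ∈ S '' (B' ×ˢ Ioo a b) :=
    mem_image_of_mem _ ⟨⟨hk₀, hpos⟩, h.mem_Ioo k₀ hk₀⟩
  obtain ⟨η, hηs, hηc, hη, hη01, hη1⟩ :=
    exists_contDiff_tsupport_subset (n := 1) (hO.mem_nhds hz₀)
  have hη' : ContDiff ℝ 1 η := hη.of_le (by simp)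
  have hη0 : ∀ z, 0 ≤ η z := fun z => (hη01 (mem_range_self z)).1
  set G : EuclideanSpace ℝ (Fin m) → ℝ :=
    fun k => graphDensity g k * (η (S (k, g k)) * H (S (k, g k))) with hG
  have hGc : ContinuousOn G B := (graphDensity_continuousOn h.isOpen h.contDiffOn).mul
    ((hη'.continuous.comp_continuousOn h.continuousOn_graph).mul hH)
  have hKB : Q '' tsupport η ⊆ B := by
    rintro _ ⟨z, hz, rfl⟩
    obtain ⟨v, hv, rfl⟩ := hηs hz
    simpa [Q] using hv.1.1
  have hK : IsCompact (Q '' tsupport η) := hηc.image hQc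
  have hGi : IntegrableOn G B := by
    refine ((hGc.mono hKB).integrableOn_compact hK).of_forall_sdiff_eq_zero h.isOpen.measurableSet
      fun k hk => ?_
    have : S (k, g k) ∉ tsupport η := fun hz => hk.2 ⟨_, hz, hQS _ _⟩
    simp [hG, image_eq_zero_of_notMem_tsupport this]
  have hF : ContinuousOn (fun z => η z * H z) ((fun k => S (k, g k)) '' B) := by
    refine hη'.continuous.continuousOn.mul ?_
    refine (hH.comp hQc.continuousOn ?_).congr ?_
    · rintro _ ⟨k, hk, rfl⟩
      simpa [hQS] using hk
    · rintro _ ⟨k, hk, rfl⟩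
      simp [hQS]
  have h0 := (h.integral_frontier hm hΩ hF (fun z hz => by
    rw [image_eq_zero_of_notMem_tsupport fun h' => hz (image_mono (prod_mono inter_subset_left
      subset_rfl) (hηs h')), zero_mul]) hGi).2
  rw [hint η hη' hηc] at h0
  have hGnn : ∀ k ∈ B, 0 ≤ G k := fun k hk => by
    by_cases hz : S (k, g k) ∈ tsupport η
    · have := hηs hz
      rw [S.injective.mem_set_image] at this
      exact mul_nonneg (graphDensity_pos g k).le (mul_nonneg (hη0 _) this.1.2.le)
    · simp [hG, image_eq_zero_of_notMem_tsupport hz]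
  refine h0.not_lt ((setIntegral_pos_iff_support_of_nonneg_ae ?_ hGi).2 ?_)
  · exact (ae_restrict_iff' h.isOpen.measurableSet).2 (Eventually.of_forall hGnn)
  · have hop : IsOpen (B ∩ G ⁻¹' Ioi 0) := hGc.isOpen_inter_preimage h.isOpen isOpen_Ioi
    refine (hop.measure_pos volume ⟨k₀, hk₀, ?_⟩).trans_le
      (measure_mono fun k hk => ⟨(mem_preimage.1 hk.2).ne', hk.1⟩)
    exact mul_pos (graphDensity_pos g k₀) (mul_pos (by rw [hη1]; exact one_pos) hpos)

/-- The fundamental lemma of the calculus of variations on the boundary. -/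
theorem eq_zero_of_integral_mul_eq_zero (h : IsChart Ω S B g a b) (hm : N + l = m + 1)
    (hΩ : IsOpen Ω) {H : Space N l → ℝ} (hH : ContinuousOn (fun k => H (S (k, g k))) B)
    (hint : ∀ η : Space N l → ℝ, ContDiff ℝ 1 η → HasCompactSupport η →
      ∫ z in frontier Ω, η z * H z ∂surfaceMeasure N l = 0)
    {k : EuclideanSpace ℝ (Fin m)} (hk : k ∈ B) : H (S (k, g k)) = 0 := by
  refine le_antisymm (h.nonpos_of_integral_mul_eq_zero hm hΩ hH hint hk) ?_
  have := h.nonpos_of_integral_mul_eq_zero hm hΩ (H := fun z => -H z) hH.neg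
    (fun η hη hc => by simp [integral_neg, hint η hη hc]) hk
  linarith

/-- The tangential derivatives of a function that vanishes on the boundary are zero. -/
theorem inner_tangent_nonpos (h : IsChart Ω S B g a b) (hΩ : IsOpen Ω) (hu : ContDiffOn ℝ 1 u Ω)
    (huc : ContinuousOn u (closure Ω)) {V : Space N l → Space N l}
    (hV : ContinuousOn V (closure Ω)) (hVu : ∀ z ∈ Ω, V z = gradient u z)
    (hu0 : ∀ z ∈ frontier Ω, u z = 0) {k : EuclideanSpace ℝ (Fin m)} (hk : k ∈ B)
    (d : EuclideanSpace ℝ (Fin m)) : ⟪V (S (k, g k)), S (d, fderiv ℝ g k d)⟫_ℝ ≤ 0 := by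
  by_contra! hpos
  have hgc := h.contDiffOn.continuousOn
  have hdg : ContinuousOn (fderiv ℝ g) B := h.contDiffOn.continuousOn_fderiv_of_isOpen h.isOpen le_rfl
  -- Pairs of a base point and a depth below the graph. Depth zero is the boundary; positive depth
  -- is inside `Ω`, where `u` is differentiable.
  set D : Set (EuclideanSpace ℝ (Fin m) × ℝ) := {q | q.1 ∈ B ∧ 0 ≤ q.2 ∧ a < g q.1 - q.2} with hD
  have hDΩ : ∀ q ∈ D, 0 < q.2 → S (q.1, g q.1 - q.2) ∈ Ω := fun q hq h0 =>
    (h.mem_iff q.1 hq.1 _ ⟨hq.2.2, by linarith [(h.mem_Ioo q.1 hq.1).2]⟩).2 (by linarith)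
  have hDc : ∀ q ∈ D, S (q.1, g q.1 - q.2) ∈ closure Ω := fun q hq => by
    rcases hq.2.1.eq_or_lt with h0 | h0
    · rw [← h0, sub_zero]
      exact frontier_subset_closure (h.mem_frontier hΩ hq.1)
    · exact subset_closure (hDΩ q hq h0)
  have hSc : ContinuousOn (fun q : EuclideanSpace ℝ (Fin m) × ℝ => S (q.1, g q.1 - q.2)) D :=
    S.continuous.comp_continuousOn (continuousOn_fst.prodMk
      ((hgc.comp continuousOn_fst fun q hq => hq.1).sub continuousOn_snd))
  have hΨ : ContinuousOn (fun q : EuclideanSpace ℝ (Fin m) × ℝ =>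
      ⟪V (S (q.1, g q.1 - q.2)), S (d, fderiv ℝ g q.1 d)⟫_ℝ) D :=
    (hV.comp hSc hDc).inner (S.continuous.comp_continuousOn (continuousOn_const.prodMk
      ((hdg.comp continuousOn_fst fun q hq => hq.1).clm_apply continuousOn_const)))
  have hk0 : (k, (0 : ℝ)) ∈ D := ⟨hk, le_rfl, by simpa using (h.mem_Ioo k hk).1⟩
  set c := ⟪V (S (k, g k)), S (d, fderiv ℝ g k d)⟫_ℝ / 2 with hc
  have hc0 : 0 < c := by positivity
  have hev1 : ∀ᶠ q in 𝓝[D] (k, (0 : ℝ)),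
      c < ⟪V (S (q.1, g q.1 - q.2)), S (d, fderiv ℝ g q.1 d)⟫_ℝ := by
    refine (hΨ _ hk0).eventually_const_lt ?_
    simp only [sub_zero]
    linarith
  have hev2 : ∀ᶠ q : EuclideanSpace ℝ (Fin m) × ℝ in 𝓝 (k, (0 : ℝ)),
      q.1 ∈ B ∧ a < g q.1 - q.2 := by
    have e1 : ContinuousAt (fun v : EuclideanSpace ℝ (Fin m) × ℝ => g v.1 - v.2) (k, 0) :=
      (ContinuousAt.comp (f := Prod.fst) (hgc.continuousAt (h.isOpen.mem_nhds hk))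
        continuousAt_fst).sub continuousAt_snd
    exact (continuousAt_fst.eventually (h.isOpen.mem_nhds hk)).and
      (e1.eventually_const_lt (by simpa using (h.mem_Ioo k hk).1))
  rw [eventually_nhdsWithin_iff] at hev1
  have hev3 : ∀ᶠ q : EuclideanSpace ℝ (Fin m) × ℝ in 𝓝 k ×ˢ 𝓝 (0 : ℝ), 0 ≤ q.2 → q ∈ D ∧
      c < ⟪V (S (q.1, g q.1 - q.2)), S (d, fderiv ℝ g q.1 d)⟫_ℝ := by
    rw [← nhds_prod_eq]
    filter_upwards [hev1, hev2] with q h1 h2 h3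
    have hqD : q ∈ D := ⟨h2.1, h3, h2.2⟩
    exact ⟨hqD, h1 hqD⟩
  obtain ⟨P1, hP1, P2, hP2, hP⟩ := eventually_prod_iff.1 hev3
  have hline : Tendsto (fun σ : ℝ => k + σ • d) (𝓝 0) (𝓝 k) := by
    have : ContinuousAt (fun σ : ℝ => k + σ • d) 0 := by fun_prop
    simpa [ContinuousAt] using this
  obtain ⟨δ, hδ, hδP⟩ := Metric.eventually_nhds_iff.1 (hline.eventually hP1)
  set τ := δ / 2 with hτ
  have hτ0 : 0 < τ := by positivity
  have hseg : ∀ σ ∈ Icc 0 τ, P1 (k + σ • d) := fun σ hσ => hδP (by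
    rw [Real.dist_eq, sub_zero, abs_of_nonneg hσ.1]; linarith [hσ.2])
  -- On the copy of the boundary curve lowered by `s`, the derivative of `u` exceeds `c`, so `u`
  -- grows by at least `c τ`. As `s → 0` both end values tend to zero, a contradiction.
  have hincr : ∀ s, 0 < s → P2 s → c * τ ≤ u (S (k + τ • d, g (k + τ • d) - s))
      - u (S (k, g k - s)) := fun s hs hPs => by
    have hder : ∀ σ ∈ Icc 0 τ, HasDerivAt (fun σ : ℝ => u (S (k + σ • d, g (k + σ • d) - s)))
        ⟪V (S (k + σ • d, g (k + σ • d) - s)), S (d, fderiv ℝ g (k + σ • d) d)⟫_ℝ σ :=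
      fun σ hσ => by
      have hq := (hP (hseg σ hσ) hPs hs.le).1
      have hm := hDΩ _ hq hs
      have h1 : HasDerivAt (fun σ : ℝ => k + σ • d) d σ := by
        simpa using ((hasDerivAt_id' σ).smul_const d).const_add k
      have h2 : HasDerivAt (fun σ : ℝ => g (k + σ • d)) (fderiv ℝ g (k + σ • d) d) σ :=
        ((h.contDiffOn.contDiffAt (h.isOpen.mem_nhds hq.1)).differentiableAt
          one_ne_zero).hasFDerivAt.comp_hasDerivAt σ h1
      have h3 := (S : (EuclideanSpace ℝ (Fin m) × ℝ) →L[ℝ] Space N l).hasFDerivAt.comp_hasDerivAt σ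
        (h1.prodMk (h2.sub_const s))
      have h4 := ((hu.contDiffAt (hΩ.mem_nhds hm)).differentiableAt
        one_ne_zero).hasFDerivAt.comp_hasDerivAt σ h3
      rw [hVu _ hm, inner_gradient_left]
      exact h4
    have := (convex_Icc (0 : ℝ) τ).mul_sub_le_image_sub_of_le_deriv (C := c)
      (fun σ hσ => (hder σ hσ).continuousAt.continuousWithinAt)
      (fun σ hσ => (hder σ (interior_subset hσ)).differentiableAt.differentiableWithinAt)
      (fun σ hσ => by
        rw [(hder σ (interior_subset hσ)).deriv]
        exact (hP (hseg σ (interior_subset hσ)) hPs hs.le).2.le)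
      0 (left_mem_Icc.2 hτ0.le) τ (right_mem_Icc.2 hτ0.le) hτ0.le
    simpa using this
  have hlim : ∀ k' ∈ B, Tendsto (fun s : ℝ => u (S (k', g k' - s))) (𝓝[>] 0) (𝓝 0) :=
    fun k' hk' => by
    have hfr := h.mem_frontier hΩ hk'
    have h1 := (huc _ (frontier_subset_closure hfr)).tendsto
    rw [hu0 _ hfr] at h1
    refine h1.comp (tendsto_nhdsWithin_iff.2 ⟨?_, ?_⟩)
    · have : ContinuousAt (fun s : ℝ => S (k', g k' - s)) 0 :=
        S.continuous.continuousAt.comp (by fun_prop)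
      simpa [ContinuousAt] using this.tendsto.mono_left nhdsWithin_le_nhds
    · filter_upwards [self_mem_nhdsWithin, Ioo_mem_nhdsGT (sub_pos.2 (h.mem_Ioo k' hk').1)]
        with s h1 h2
      exact hDc (k', s) ⟨hk', le_of_lt h1, by simp only; linarith [h2.2]⟩
  have hkτ : k + τ • d ∈ B := (hP (hseg τ (right_mem_Icc.2 hτ0.le)) hP2.self_of_nhds le_rfl).1.1
  have hfin := (hlim _ hkτ).sub (hlim k hk)
  rw [sub_zero] at hfin
  have : c * τ ≤ 0 := ge_of_tendsto hfin (by
    filter_upwards [self_mem_nhdsWithin, hP2.filter_mono nhdsWithin_le_nhds] with s h1 h2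
    exact hincr s h1 h2)
  linarith [mul_pos hc0 hτ0]

/-- The gradient of a function that vanishes on the boundary is normal to the boundary. -/
theorem exists_eq_smul_outerNormal (h : IsChart Ω S B g a b) (hΩ : IsOpen Ω)
    (hu : ContDiffOn ℝ 1 u Ω)
    (huc : ContinuousOn u (closure Ω)) {V : Space N l → Space N l}
    (hV : ContinuousOn V (closure Ω)) (hVu : ∀ z ∈ Ω, V z = gradient u z)
    (hu0 : ∀ z ∈ frontier Ω, u z = 0) {k : EuclideanSpace ℝ (Fin m)} (hk : k ∈ B) :
    ∃ c : ℝ, V (S (k, g k)) = c • outerNormal Ω (S (k, g k)) := by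
  set v := S.symm (V (S (k, g k))) with hv
  have hVv : V (S (k, g k)) = S v := by simp [hv]
  have h0 : ∀ d, ⟪v.1 + v.2 • gradient g k, d⟫_ℝ = 0 := fun d => by
    have h1 := h.inner_tangent_nonpos hΩ hu huc hV hVu hu0 hk d
    have h2 := h.inner_tangent_nonpos hΩ hu huc hV hVu hu0 hk (-d)
    rw [hVv, h.ortho] at h1 h2
    simp only [map_neg, inner_neg_right] at h2
    rw [inner_add_left, real_inner_smul_left, inner_gradient_left]
    linarith
  have h1 : v.1 = v.2 • -gradient g k := by
    rw [smul_neg, eq_neg_iff_add_eq_zero]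
    exact inner_self_eq_zero.1 (h0 _)
  refine ⟨v.2 * graphDensity g k, ?_⟩
  rw [h.outerNormal_eq hk, smul_smul, mul_inv_cancel_right₀ (graphDensity_pos g k).ne', ← map_smul,
    hVv]
  congr 1
  exact Prod.ext h1 (by simp)

end IsChart

end Grushin

/-! ### Vanishing on the boundary and the normal component of the field -/

namespace Grushin

variable {N l : ℕ} {p γ : ℝ} {Ω : Set (Space N l)} {u : Space N l → ℝ}

theorem inner_weight_left (γ : ℝ) (z v w : Space N l) :
    ⟪weight γ z v, w⟫_ℝ = ⟪v, weight γ z w⟫_ℝ := inner_stretch_left _ v w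

theorem weight_smul (γ : ℝ) (z : Space N l) (c : ℝ) (v : Space N l) :
    weight γ z (c • v) = c • weight γ z v := stretch_smul _ c v

theorem eq_zero_of_weight_eq_zero {z v : Space N l} (hz : xPart z ≠ 0) (h : weight γ z v = 0) :
    v = 0 := by
  refine ext_inl_inr (fun i => ?_) fun j => ?_
  · simpa [weight_eq_stretch] using congrArg (fun w : Space N l => w (Sum.inl i)) h
  · have h1 := congrArg (fun w : Space N l => w (Sum.inr j)) h
    simp only [weight_eq_stretch, stretch_inr, PiLp.zero_apply] at h1
    exact (mul_eq_zero.1 h1).resolve_left (Real.rpow_pos_of_pos (norm_pos_iff.2 hz) γ).ne'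

theorem xPart_eq_zero_of_weight_eq_zero {z v : Space N l} (h : weight γ z v = 0) :
    xPart v = 0 := by
  rw [weight_eq_stretch] at h
  rw [← xPart_stretch (‖xPart z‖ ^ γ), h]
  ext i; simp

theorem MemWZero.integrableOn_grushinGrad (hp : 1 < p) (hγ : 0 ≤ γ) (hΩ : IsOpen Ω)
    {G : Space N l → Space N l} (hG : MemWZero p γ Ω u G) (hu : ContDiffOn ℝ 1 u Ω)
    {K : Set (Space N l)} (hK : IsCompact K) : IntegrableOn (grushinGrad γ u) (Ω ∩ K) := by
  have h1 : MemLp (grushinGrad γ u) (ENNReal.ofReal p) (volume.restrict (Ω ∩ K)) :=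
    ((memLp_congr_ae (hG.ae_eq_grushinGrad hp hγ hΩ hu)).1 hG.memLp_grad).mono_measure
      (Measure.restrict_mono inter_subset_left le_rfl)
  have : IsFiniteMeasure (volume.restrict (Ω ∩ K)) :=
    ⟨by rw [Measure.restrict_apply_univ]
        exact (measure_mono inter_subset_right).trans_lt hK.measure_lt_top⟩
  exact h1.integrable (by rw [← ENNReal.ofReal_one]; exact ENNReal.ofReal_le_ofReal hp.le)

/-- For `u` in the closure of the test functions, the volume integral of `η ∇_γ u + u ∇_γ η`
vanishes even when `η` does not vanish on the boundary. By the divergence theorem its component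
along `e` is the flux of `u` times the weighted `e`, so that flux is zero. -/
theorem MemWZero.integral_frontier (hp : 1 < p) (hγ : 0 ≤ γ) (hN : 1 ≤ N) (hΩ : IsOpen Ω)
    (hC : HasC1Boundary Ω) {G : Space N l → Space N l} (hG : MemWZero p γ Ω u G)
    (hu : ContDiffOn ℝ 1 u Ω) (huc : ContinuousOn u (closure Ω)) (e : Space N l)
    {η : Space N l → ℝ} (hη : ContDiff ℝ 1 η) (hc : HasCompactSupport η) :
    ∫ z in frontier Ω, η z * ⟪u z • weight γ z e, outerNormal Ω z⟫_ℝ ∂surfaceMeasure N l = 0 := by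
  have hα : ∀ K, IsCompact K → IntegrableOn (fun z => ⟪grushinGrad γ u z, e⟫_ℝ) (Ω ∩ K) :=
    fun K hK => (hG.integrableOn_grushinGrad hp hγ hΩ hu hK).inner_const e
  have hb : ContinuousOn (fun z => u z • weight γ z e) (closure Ω) :=
    huc.smul ((continuous_weight hγ).comp
      (continuous_id.prodMk continuous_const)).continuousOn
  have hid : ∀ η : Space N l → ℝ, ContDiff ℝ 1 η → HasCompactSupport η →
      ∫ z in Ω, (η z * ⟪grushinGrad γ u z, e⟫_ℝ + ⟪u z • weight γ z e, gradient η z⟫_ℝ) = 0 :=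
    fun η hη hc => by
    have h1 := hG.setIntegral_smul hp hγ hΩ hη hc
    have hae := hG.ae_eq_grushinGrad hp hγ hΩ hu
    have h2 : ∫ z in Ω, η z • G z = ∫ z in Ω, η z • grushinGrad γ u z := by
      refine integral_congr_ae ?_
      filter_upwards [hae] with z hz
      rw [hz]
    have hL : LocallyIntegrable u (volume.restrict Ω) := hG.memLp.locallyIntegrable
      (by rw [← ENNReal.ofReal_one]; exact ENNReal.ofReal_le_ofReal hp.le)
    have hLG : LocallyIntegrable G (volume.restrict Ω) := hG.memLp_grad.locallyIntegrable
      (by rw [← ENNReal.ofReal_one]; exact ENNReal.ofReal_le_ofReal hp.le)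
    have hi1 : IntegrableOn (fun z => η z • grushinGrad γ u z) Ω := by
      refine (hLG.integrable_smul_left_of_hasCompactSupport hη.continuous hc).congr ?_
      filter_upwards [hae] with z hz
      rw [hz]
    have hi2 : IntegrableOn (fun z => u z • grushinGrad γ η z) Ω :=
      hL.integrable_smul_right_of_hasCompactSupport (continuous_grushinGrad hγ hη)
        (hasCompactSupport_grushinGrad γ hc)
    have h3 : ∀ z, η z * ⟪grushinGrad γ u z, e⟫_ℝ + ⟪u z • weight γ z e, gradient η z⟫_ℝ
        = ⟪e, η z • grushinGrad γ u z + u z • grushinGrad γ η z⟫_ℝ := fun z => by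
      rw [inner_add_right, real_inner_smul_right, real_inner_smul_right, real_inner_smul_left,
        inner_weight_left, real_inner_comm e]
      rfl
    simp_rw [h3]
    have hi3 : IntegrableOn (fun z => η z • grushinGrad γ u z + u z • grushinGrad γ η z) Ω :=
      hi1.add hi2
    rw [integral_inner hi3, integral_add hi1 hi2, ← h2, h1, neg_add_cancel,
      inner_zero_right]
  have h := hC.hasFlux hN hΩ hα hb (fun η hη hc _ => hid η hη hc) hη hc
  rw [← h.2]
  exact hid η hη hc

/-- A function of `W^{1,p}_{λ,0}(Ω)` that is continuous up to the boundary vanishes there. -/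
theorem MemWZero.eq_zero_of_mem_frontier (hp : 1 < p) (hγ : 0 ≤ γ) (hN : 1 ≤ N) (hΩ : IsOpen Ω)
    (hC : HasC1Boundary Ω) {G : Space N l → Space N l} (hG : MemWZero p γ Ω u G)
    (hu : ContDiffOn ℝ 1 u Ω) (huc : ContinuousOn u (closure Ω)) {z : Space N l}
    (hz : z ∈ frontier Ω) : u z = 0 := by
  obtain ⟨m, hm⟩ : ∃ m, N + l = m + 1 := ⟨N + l - 1, by omega⟩
  obtain ⟨n, hn⟩ := hC z hz
  obtain ⟨S, B, g, a, b, h, hSn, hzB, hzg⟩ := hn.exists_isChart hm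
  set k := (S.symm z).1 with hk
  have hzk : S (k, g k) = z := by
    rw [← hzg]; simp [hk]
  -- Taking for `e` the weighted normal at the point in question turns the vanishing integrand into
  -- `u` times the squared norm of `e`.
  have key : ∀ k' ∈ B, u (S (k', g k')) = 0 ∨
      weight γ (S (k', g k')) (outerNormal Ω (S (k', g k'))) = 0 := fun k' hk' => by
    set e := weight γ (S (k', g k')) (outerNormal Ω (S (k', g k'))) with he
    have hcont : ContinuousOn (fun k => ⟪u (S (k, g k)) • weight γ (S (k, g k)) e,
        outerNormal Ω (S (k, g k))⟫_ℝ) B := by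
      refine ContinuousOn.inner (𝕜 := ℝ) (ContinuousOn.fun_smul ?_ ?_) h.continuousOn_outerNormal
      · exact huc.comp h.continuousOn_graph
          fun k hk => frontier_subset_closure (h.mem_frontier hΩ hk)
      · exact (continuous_weight hγ).comp_continuousOn
          (h.continuousOn_graph.prodMk continuousOn_const)
    have h0 := h.eq_zero_of_integral_mul_eq_zero hm hΩ
      (H := fun z => ⟪u z • weight γ z e, outerNormal Ω z⟫_ℝ) hcont
      (fun η hη hc => hG.integral_frontier hp hγ hN hΩ hC hu huc e hη hc) hk'
    simp only [real_inner_smul_left, inner_weight_left, ← he] at h0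
    exact (mul_eq_zero.1 h0).imp_right inner_self_eq_zero.1
  rcases key k hzB with h0 | h0
  · rwa [hzk] at h0
  rw [hzk, hn.outerNormal_eq] at h0
  have hxn := xPart_eq_zero_of_weight_eq_zero h0
  have hn0 : n ≠ 0 := norm_ne_zero_iff.1 (by rw [hn.norm_eq]; exact one_ne_zero)
  -- The remaining case is a characteristic point: there `x = 0` and the normal has no
  -- `x`-component. An `x`-direction `e` is then tangent. Moving along the boundary over this
  -- tangent direction makes `x` nonzero, so nearby points are not characteristic; `u` vanishes at
  -- them and hence, by continuity, at `z`.
  have hxz : xPart z = 0 := by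
    by_contra hx
    exact hn0 (eq_zero_of_weight_eq_zero hx h0)
  set e : Space N l := EuclideanSpace.single (Sum.inl ⟨0, hN⟩) 1 with he
  have hne : ⟪n, e⟫_ℝ = 0 := by
    have := congrArg (fun v : EuclideanSpace ℝ (Fin N) => v ⟨0, hN⟩) hxn
    rw [he, EuclideanSpace.inner_single_right]
    simpa using this
  set w := S.symm e with hw
  have hSw : S w = e := by simp [hw]
  have hw2 : w.2 = 0 := by
    have := h.ortho (0, 1) w
    rw [hSn, hSw, hne] at this
    simpa using this.symm
  have hSt : ∀ k' t, S (k', t) = S (k', 0) + t • n := fun k' t => by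
    rw [← hSn, ← map_smul, ← map_add]
    simp
  have hxadd : ∀ v v' : Space N l, xPart (v + v') = xPart v + xPart v' := fun v v' => by
    ext i; simp
  have hxS : ∀ t : ℝ, xPart (S (k + t • w.1, g (k + t • w.1))) = t • xPart e := fun t => by
    have h1 : S (k + t • w.1, 0) = S (k, 0) + t • e := by
      rw [← hSw, ← map_smul, ← map_add]
      congr 1
      exact Prod.ext rfl (by simp [hw2])
    have h2 : xPart (S (k, 0)) = 0 := by
      rw [← hzk, hSt, hxadd, xPart_smul, hxn, smul_zero, add_zero] at hxz
      exact hxz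
    rw [hSt, h1, hxadd, hxadd, xPart_smul, xPart_smul, hxn, h2]
    simp
  have hxe : xPart e ≠ 0 := fun h => by
    have := congrArg (fun v : EuclideanSpace ℝ (Fin N) => v ⟨0, hN⟩) h
    simp [he] at this
  have hline : Tendsto (fun t : ℝ => k + t • w.1) (𝓝[≠] 0) (𝓝 k) := by
    have : ContinuousAt (fun t : ℝ => k + t • w.1) 0 := by fun_prop
    simpa [ContinuousAt] using this.tendsto.mono_left nhdsWithin_le_nhds
  have hlim : Tendsto (fun t : ℝ => u (S (k + t • w.1, g (k + t • w.1)))) (𝓝[≠] 0)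
      (𝓝 (u z)) := by
    have h1 : ContinuousAt (fun k => u (S (k, g k))) k :=
      (huc.comp h.continuousOn_graph
        fun k hk => frontier_subset_closure (h.mem_frontier hΩ hk)).continuousAt
          (h.isOpen.mem_nhds hzB)
    rw [ContinuousAt, hzk] at h1
    exact h1.comp hline
  refine tendsto_nhds_unique hlim (tendsto_const_nhds.congr' ?_)
  filter_upwards [hline.eventually (h.isOpen.mem_nhds hzB), self_mem_nhdsWithin] with t htB ht
  refine ((key _ htB).resolve_right fun h1 => ?_).symm
  have h2 := eq_zero_of_weight_eq_zero (by rw [hxS]; exact smul_ne_zero ht hxe) h1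
  have h3 := (h.isOuterUnitNormal htB).norm_eq
  rw [← h.outerNormal_eq htB, h2, norm_zero] at h3
  exact zero_ne_one h3

/-- On the boundary `u = 0`, so `F` drops out, and `∇u` is a multiple of `ν`. This allows `ν` and
`∇u` to be exchanged in `⟨∇u, z⟩ ⟨∇_γ u, ν_γ⟩ = ⟨z, ν⟩ |∇_γ u|^2`, where `ν_γ` is the weighted
normal. The first part of the field contributes the coefficient `1`, the second `-1/p`. -/
theorem inner_pohozaevField_outerNormal (hp : 1 < p) (hγ : 0 ≤ γ) (hN : 1 ≤ N)
    (f : Space N l → ℝ → ℝ) (hΩ : IsOpen Ω)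
    (hC : HasC1Boundary Ω) {G : Space N l → Space N l} (hG : MemWZero p γ Ω u G)
    (hu : ContDiffOn ℝ 1 u Ω) (huc : ContinuousOn u (closure Ω)) {V : Space N l → Space N l}
    (hV : ContinuousOn V (closure Ω)) (hVu : ∀ z ∈ Ω, V z = gradient u z) {z : Space N l}
    (hz : z ∈ frontier Ω) :
    ⟪pohozaevField p γ f u V z, outerNormal Ω z⟫_ℝ = (1 - 1 / p) * boundaryTerm p γ Ω u z := by
  have hu0 : ∀ z ∈ frontier Ω, u z = 0 := fun z hz =>
    hG.eq_zero_of_mem_frontier hp hγ hN hΩ hC hu huc hz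
  obtain ⟨c, hc⟩ : ∃ c : ℝ, V z = c • outerNormal Ω z := by
    obtain ⟨m, hm⟩ : ∃ m, N + l = m + 1 := ⟨N + l - 1, by omega⟩
    obtain ⟨n, hn⟩ := hC z hz
    obtain ⟨S, B, g, a, b, h, hSn, hzB, hzg⟩ := hn.exists_isChart hm
    have hzk : S ((S.symm z).1, g (S.symm z).1) = z := by
      rw [← hzg]; simp
    have := h.exists_eq_smul_outerNormal hΩ hu huc hV hVu hu0 hzB
    rwa [hzk] at this
  have hext : extendFrom Ω (gradient u) z = V z := by
    refine extendFrom_eq (frontier_subset_closure hz) ?_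
    have h1 : Tendsto V (𝓝[Ω] z) (𝓝 (V z)) :=
      (hV z (frontier_subset_closure hz)).mono subset_closure
    refine h1.congr' ?_
    filter_upwards [self_mem_nhdsWithin] with w hw using hVu w hw
  rw [pohozaevField, boundaryTerm, grushinGradClosure, hext, hu0 z hz, primitive_zero,
    inner_add_left, real_inner_smul_left, real_inner_smul_left, inner_weight_left,
    real_inner_smul_left]
  have h1 : ⟪V z, z⟫_ℝ * ⟪weight γ z (V z), weight γ z (outerNormal Ω z)⟫_ℝ
      = ⟪z, outerNormal Ω z⟫_ℝ * ‖weight γ z (V z)‖ ^ 2 := by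
    rw [← real_inner_self_eq_norm_sq]
    conv_lhs => rw [hc]
    conv_rhs => rw [hc]
    simp only [weight_smul, real_inner_smul_left, real_inner_smul_right, real_inner_comm z]
    ring
  have h2 := norm_rpow_sub_two_mul_sq (p := p) (by linarith) (weight γ z (V z))
  calc _ = ‖weight γ z (V z)‖ ^ (p - 2) *
        (⟪V z, z⟫_ℝ * ⟪weight γ z (V z), weight γ z (outerNormal Ω z)⟫_ℝ)
        - ‖weight γ z (V z)‖ ^ p / p * ⟪z, outerNormal Ω z⟫_ℝ := by ring
    _ = _ := by
      rw [h1, ← h2]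
      ring

end Grushin

/-! ### Anisotropic cutoffs -/

namespace Grushin

variable {N l : ℕ} {p γ : ℝ} {f : Space N l → ℝ → ℝ} {Ω : Set (Space N l)} {u : Space N l → ℝ}

section Cutoff

theorem hasFDerivAt_norm_sq_xPart (z : Space N l) : ∃ L : Space N l →L[ℝ] ℝ,
    (∀ v, L v = 2 * ⟪xPart z, xPart v⟫_ℝ) ∧ HasFDerivAt (fun z => ‖xPart z‖ ^ 2) L z := by
  set P : Space N l →L[ℝ] EuclideanSpace ℝ (Fin N) := LinearMap.toContinuousLinearMap
    { toFun := xPart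
      map_add' := fun v w => by ext i; simp
      map_smul' := fun c v => xPart_smul c v }
  exact ⟨_, fun v => by simp; rfl, (P.hasFDerivAt (x := z)).norm_sq⟩

theorem hasFDerivAt_norm_sq_yPart (z : Space N l) : ∃ L : Space N l →L[ℝ] ℝ,
    (∀ v, L v = 2 * ⟪yPart z, yPart v⟫_ℝ) ∧ HasFDerivAt (fun z => ‖yPart z‖ ^ 2) L z := by
  set P : Space N l →L[ℝ] EuclideanSpace ℝ (Fin l) := LinearMap.toContinuousLinearMap
    { toFun := yPart
      map_add' := fun v w => by ext i; simp
      map_smul' := fun c v => by ext i; simp }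
  exact ⟨_, fun v => by simp; rfl, (P.hasFDerivAt (x := z)).norm_sq⟩

theorem contDiff_norm_sq_xPart : ContDiff ℝ 1 fun z : Space N l => ‖xPart z‖ ^ 2 := by
  have h : ∀ z : Space N l, ‖xPart z‖ ^ 2 = ∑ i, z (Sum.inl i) ^ 2 := fun z => by
    simp [EuclideanSpace.norm_sq_eq]
  simp_rw [h]
  fun_prop

theorem contDiff_norm_sq_yPart : ContDiff ℝ 1 fun z : Space N l => ‖yPart z‖ ^ 2 := by
  have h : ∀ z : Space N l, ‖yPart z‖ ^ 2 = ∑ i, z (Sum.inr i) ^ 2 := fun z => by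
    simp [EuclideanSpace.norm_sq_eq]
  simp_rw [h]
  fun_prop

/-- A cutoff function adapted to the anisotropic dilations `(x, y) ↦ (R x, R^{1+γ} y)`. -/
noncomputable def cutoff (R T : ℝ) (z : Space N l) : ℝ :=
  (1 - cutoffTransition (‖xPart z‖ ^ 2 / R ^ 2)) * (1 - cutoffTransition (‖yPart z‖ ^ 2 / T ^ 2))

theorem contDiff_cutoff (R T : ℝ) : ContDiff ℝ 1 (cutoff R T : Space N l → ℝ) := by
  have h := contDiff_cutoffTransition.of_le (m := 1) (by simp)
  exact (contDiff_const.sub (h.comp (contDiff_norm_sq_xPart.div_const _))).mul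
    (contDiff_const.sub (h.comp (contDiff_norm_sq_yPart.div_const _)))

theorem cutoff_mem_Icc (R T : ℝ) (z : Space N l) : cutoff R T z ∈ Icc (0 : ℝ) 1 := by
  have h1 := cutoffTransition_mem_Icc (‖xPart z‖ ^ 2 / R ^ 2)
  have h2 := cutoffTransition_mem_Icc (‖yPart z‖ ^ 2 / T ^ 2)
  exact ⟨mul_nonneg (by linarith [h1.2]) (by linarith [h2.2]),
    mul_le_one₀ (by linarith [h1.1]) (by linarith [h2.2]) (by linarith [h2.1])⟩

variable {R T : ℝ}

theorem cutoffTransition_div_sq_eq_zero {a : ℝ} (hR : 0 < R) (h0 : 0 ≤ a) (h : a ≤ R) :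
    cutoffTransition (a ^ 2 / R ^ 2) = 0 :=
  cutoffTransition_eq_zero ((div_le_one (by positivity)).2 (by gcongr))

theorem lt_of_cutoffTransition_div_sq_ne_one {a : ℝ} (hR : 0 < R)
    (h : cutoffTransition (a ^ 2 / R ^ 2) ≠ 1) : a < 2 * R := by
  by_contra! h'
  refine h (cutoffTransition_eq_one ?_)
  rw [le_div_iff₀ (by positivity)]
  nlinarith

theorem cutoff_eq_one (hR : 0 < R) (hT : 0 < T) {z : Space N l} (h1 : ‖z‖ ≤ R) (h2 : ‖z‖ ≤ T) :
    cutoff R T z = 1 := by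
  rw [cutoff, cutoffTransition_div_sq_eq_zero hR (norm_nonneg _) ((norm_xPart_le z).trans h1),
    cutoffTransition_div_sq_eq_zero hT (norm_nonneg _) ((norm_yPart_le z).trans h2)]
  norm_num

theorem hasCompactSupport_cutoff (hR : 0 < R) (hT : 0 < T) :
    HasCompactSupport (cutoff R T : Space N l → ℝ) := by
  refine HasCompactSupport.intro (isCompact_closedBall 0 (2 * R + 2 * T)) fun z hz => ?_
  rw [mem_closedBall_zero_iff, not_le] at hz
  by_contra h
  have h1 := lt_of_cutoffTransition_div_sq_ne_one (a := ‖xPart z‖) hR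
    fun h' => h (by simp [cutoff, h'])
  have h2 := lt_of_cutoffTransition_div_sq_ne_one (a := ‖yPart z‖) hT
    fun h' => h (by simp [cutoff, h'])
  have h3 := norm_sq_eq z
  nlinarith [norm_nonneg (xPart z), norm_nonneg (yPart z), norm_nonneg z]

/-- The differential of the cutoff and the region where it is supported. -/
theorem fderiv_cutoff {M : ℝ} (hM : ∀ s, |deriv cutoffTransition s| ≤ M) (hR : 0 < R) (hT : 0 < T)
    (z : Space N l) : ∃ a c : ℝ,
      (∀ v, fderiv ℝ (cutoff R T) z v = a * ⟪xPart z, xPart v⟫_ℝ + c * ⟪yPart z, yPart v⟫_ℝ) ∧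
      |a| * ‖xPart z‖ ^ 2 ≤ 4 * M ∧ |c| * ‖yPart z‖ ^ 2 ≤ 4 * M ∧
      (a ≠ 0 → R ≤ ‖xPart z‖ ∧ ‖yPart z‖ ≤ 2 * T) ∧ (c ≠ 0 → ‖xPart z‖ ≤ 2 * R ∧ T ≤ ‖yPart z‖) := by
  -- The derivative of the profile is nonzero only for `1 < a^2 / Q^2 < 2`, which bounds the product
  -- by `2 * 2 * M`.
  have hderiv : ∀ {a Q : ℝ}, 0 < Q → 0 ≤ a → deriv cutoffTransition (a ^ 2 / Q ^ 2) ≠ 0 →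
      Q ≤ a ∧ |deriv cutoffTransition (a ^ 2 / Q ^ 2)| * (2 / Q ^ 2) * a ^ 2 ≤ 4 * M :=
    fun {a Q} hQ ha h => by
    have hQ2 : 0 < Q ^ 2 := by positivity
    have h1 : 1 < a ^ 2 / Q ^ 2 := by
      by_contra! h'; exact h (deriv_cutoffTransition_eq_zero_of_le h')
    have h2 : a ^ 2 / Q ^ 2 < 2 := by
      by_contra! h'; exact h (deriv_cutoffTransition_eq_zero_of_ge h')
    rw [lt_div_iff₀ hQ2, one_mul] at h1
    refine ⟨(pow_le_pow_iff_left₀ hQ.le ha two_ne_zero).1 h1.le, ?_⟩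
    calc _ = |deriv cutoffTransition (a ^ 2 / Q ^ 2)| * (2 * (a ^ 2 / Q ^ 2)) := by ring
      _ ≤ M * (2 * 2) := mul_le_mul (hM _) (by linarith) (by positivity)
          ((abs_nonneg _).trans (hM 0))
      _ = 4 * M := by ring
  obtain ⟨L1, hL1, hd1⟩ := hasFDerivAt_norm_sq_xPart z
  obtain ⟨L2, hL2, hd2⟩ := hasFDerivAt_norm_sq_yPart z
  have hTd : ∀ s, HasDerivAt cutoffTransition (deriv cutoffTransition s) s := fun s =>
    (contDiff_cutoffTransition.differentiable (by simp) s).hasDerivAt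
  have e1 := ((hTd (‖xPart z‖ ^ 2 / R ^ 2)).comp_hasFDerivAt z
    (hd1.mul_const (R ^ 2)⁻¹)).const_sub 1
  have e2 := ((hTd (‖yPart z‖ ^ 2 / T ^ 2)).comp_hasFDerivAt z
    (hd2.mul_const (T ^ 2)⁻¹)).const_sub 1
  have e3 := (e1.mul e2).fderiv
  set t1 := cutoffTransition (‖xPart z‖ ^ 2 / R ^ 2) with ht1
  set t2 := cutoffTransition (‖yPart z‖ ^ 2 / T ^ 2) with ht2
  set d1 := deriv cutoffTransition (‖xPart z‖ ^ 2 / R ^ 2) with hd1'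
  set d2 := deriv cutoffTransition (‖yPart z‖ ^ 2 / T ^ 2) with hd2'
  have ht1m := cutoffTransition_mem_Icc (‖xPart z‖ ^ 2 / R ^ 2)
  have ht2m := cutoffTransition_mem_Icc (‖yPart z‖ ^ 2 / T ^ 2)
  rw [← ht1] at ht1m
  rw [← ht2] at ht2m
  have hMp : 0 ≤ M := (abs_nonneg _).trans (hM 0)
  refine ⟨-(1 - t2) * (d1 * (2 / R ^ 2)), -(1 - t1) * (d2 * (2 / T ^ 2)), fun v => ?_, ?_, ?_, ?_,
    ?_⟩
  · have : fderiv ℝ (cutoff R T) z v = _ := congrArg (fun L : Space N l →L[ℝ] ℝ => L v) e3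
    rw [this]
    simp only [Function.comp_apply, add_apply, smul_apply, neg_apply, hL1, hL2, smul_eq_mul,
      ← div_eq_mul_inv, ← ht1, ← ht2]
    ring
  · by_cases h : d1 = 0
    · simp [h, hMp]
    · have := (hderiv hR (norm_nonneg _) h).2
      rw [abs_mul, abs_neg, abs_of_nonneg (by linarith [ht2m.2]), abs_mul,
        abs_of_nonneg (by positivity : 0 ≤ 2 / R ^ 2), mul_assoc]
      exact (mul_le_of_le_one_left (by positivity) (by linarith [ht2m.1])).trans this
  · by_cases h : d2 = 0
    · simp [h, hMp]
    · have := (hderiv hT (norm_nonneg _) h).2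
      rw [abs_mul, abs_neg, abs_of_nonneg (by linarith [ht1m.2]), abs_mul,
        abs_of_nonneg (by positivity : 0 ≤ 2 / T ^ 2), mul_assoc]
      exact (mul_le_of_le_one_left (by positivity) (by linarith [ht1m.1])).trans this
  · intro h
    refine ⟨(hderiv hR (norm_nonneg _) fun h' => h (by rw [hd1', h']; simp)).1,
      (lt_of_cutoffTransition_div_sq_ne_one hT fun h' => h (by rw [ht2, h']; simp)).le⟩
  · intro h
    refine ⟨(lt_of_cutoffTransition_div_sq_ne_one hR fun h' => h (by rw [ht1, h']; simp)).le,
      (hderiv hT (norm_nonneg _) fun h' => h (by rw [hd2', h']; simp)).1⟩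

/-- The factor `⟨q, z⟩` grows with `z`, and the scales are chosen to compensate for it. Where the
`x`-cutoff varies, `|y| ≤ 2 R^(1+γ) ≤ 2 |x|^(1+γ)`; where the `y`-cutoff varies, `|x|^(1+γ) ≤
(2R)^(1+γ) ≤ 2^(1+γ) |y|`. Either way the weight absorbs the growth, and the bound does not depend
on `R`. The two regions contribute `3` and `1 + 2^(1+γ)` to the constant. -/
theorem abs_fderiv_cutoff_le {M : ℝ} (hM : ∀ s, |deriv cutoffTransition s| ≤ M) (hγ : 0 ≤ γ)
    (hR : 0 < R) (z q v : Space N l) :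
    |fderiv ℝ (cutoff R (R ^ (1 + γ))) z (⟪q, z⟫_ℝ • weight γ z v)|
      ≤ 4 * M * (4 + 2 ^ (1 + γ)) * (‖weight γ z q‖ * ‖v‖) := by
  obtain ⟨a, c, h, ha, hc, ha0, hc0⟩ := fderiv_cutoff hM hR (Real.rpow_pos_of_pos hR (1 + γ)) z
  have hMp : 0 ≤ M := (abs_nonneg _).trans (hM 0)
  set X := ‖xPart z‖ with hX
  set Y := ‖yPart z‖ with hY
  set ξ := ‖weight γ z q‖ with hξ
  have hX0 : 0 ≤ X := norm_nonneg _
  have hY0 : 0 ≤ Y := norm_nonneg _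
  have hXγ : 0 ≤ X ^ γ := by positivity
  have hqx : ‖xPart q‖ ≤ ξ := by
    rw [← xPart_stretch (‖xPart z‖ ^ γ) q]
    exact norm_xPart_le _
  have hqy : X ^ γ * ‖yPart q‖ ≤ ξ := by
    have := norm_yPart_le (weight γ z q)
    rwa [weight_eq_stretch, yPart_stretch, norm_smul, Real.norm_of_nonneg hXγ] at this
  have hqz : |⟪q, z⟫_ℝ| ≤ ‖xPart q‖ * X + ‖yPart q‖ * Y := by
    rw [inner_eq]
    exact (abs_add_le _ _).trans (add_le_add (abs_real_inner_le_norm _ _)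
      (abs_real_inner_le_norm _ _))
  have hvx : |⟪xPart z, xPart v⟫_ℝ| ≤ X * ‖v‖ := (abs_real_inner_le_norm _ _).trans
    (mul_le_mul_of_nonneg_left (norm_xPart_le v) hX0)
  have hvy : |⟪yPart z, yPart v⟫_ℝ| ≤ Y * ‖v‖ := (abs_real_inner_le_norm _ _).trans
    (mul_le_mul_of_nonneg_left (norm_yPart_le v) hY0)
  have hRγ : R ^ (1 + γ) = R * R ^ γ := by rw [Real.rpow_add hR, Real.rpow_one]
  have hXγ1 : X ^ (1 + γ) = X * X ^ γ := by
    rw [Real.rpow_add_of_nonneg hX0 zero_le_one hγ, Real.rpow_one]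
  have hξ0 : 0 ≤ ξ := norm_nonneg _
  have t1 : |a| * X * |⟪q, z⟫_ℝ| ≤ 4 * M * 3 * ξ := by
    by_cases h0 : a = 0
    · simp only [h0, abs_zero, zero_mul]; positivity
    obtain ⟨h1, h2⟩ := ha0 h0
    have h3 : ‖yPart q‖ * Y ≤ 2 * ξ * X := calc
      _ ≤ ‖yPart q‖ * (2 * R ^ (1 + γ)) := by gcongr
      _ ≤ ‖yPart q‖ * (2 * (X * X ^ γ)) := by rw [hRγ]; gcongr
      _ = 2 * (X ^ γ * ‖yPart q‖) * X := by ring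
      _ ≤ _ := by gcongr
    calc |a| * X * |⟪q, z⟫_ℝ| ≤ |a| * X * (ξ * X + 2 * ξ * X) := by
          refine mul_le_mul_of_nonneg_left (hqz.trans (add_le_add ?_ h3)) (by positivity)
          gcongr
      _ = |a| * X ^ 2 * (3 * ξ) := by ring
      _ ≤ 4 * M * (3 * ξ) := by gcongr
      _ = _ := by ring
  have t2 : |c| * Y * (X ^ γ * |⟪q, z⟫_ℝ|) ≤ 4 * M * (1 + 2 ^ (1 + γ)) * ξ := by
    by_cases h0 : c = 0
    · simp only [h0, abs_zero, zero_mul]; positivity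
    obtain ⟨h1, h2⟩ := hc0 h0
    have h3 : X * X ^ γ ≤ 2 ^ (1 + γ) * Y := calc
      X * X ^ γ = X ^ (1 + γ) := hXγ1.symm
      _ ≤ (2 * R) ^ (1 + γ) := by gcongr
      _ = 2 ^ (1 + γ) * R ^ (1 + γ) := Real.mul_rpow (by norm_num) hR.le
      _ ≤ _ := by gcongr
    calc |c| * Y * (X ^ γ * |⟪q, z⟫_ℝ|)
        ≤ |c| * Y * (X ^ γ * (‖xPart q‖ * X + ‖yPart q‖ * Y)) := by gcongr
      _ = |c| * Y * ((X * X ^ γ) * ‖xPart q‖ + (X ^ γ * ‖yPart q‖) * Y) := by ring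
      _ ≤ |c| * Y * ((2 ^ (1 + γ) * Y) * ξ + ξ * Y) := by gcongr
      _ = |c| * Y ^ 2 * ((1 + 2 ^ (1 + γ)) * ξ) := by ring
      _ ≤ 4 * M * ((1 + 2 ^ (1 + γ)) * ξ) := by gcongr
      _ = _ := by ring
  rw [map_smul, smul_eq_mul, h, weight_eq_stretch, xPart_stretch, yPart_stretch,
    real_inner_smul_right, ← hX, abs_mul]
  calc |⟪q, z⟫_ℝ| * |a * ⟪xPart z, xPart v⟫_ℝ + c * (X ^ γ * ⟪yPart z, yPart v⟫_ℝ)|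
      ≤ |⟪q, z⟫_ℝ| * (|a| * (X * ‖v‖) + |c| * (X ^ γ * (Y * ‖v‖))) := by
        refine mul_le_mul_of_nonneg_left ((abs_add_le _ _).trans (add_le_add ?_ ?_)) (abs_nonneg _)
        · rw [abs_mul]; gcongr
        · rw [abs_mul, abs_mul, abs_of_nonneg hXγ]; gcongr
    _ = (|a| * X * |⟪q, z⟫_ℝ|) * ‖v‖ + (|c| * Y * (X ^ γ * |⟪q, z⟫_ℝ|)) * ‖v‖ := by ring
    _ ≤ (4 * M * 3 * ξ) * ‖v‖ + (4 * M * (1 + 2 ^ (1 + γ)) * ξ) * ‖v‖ := by gcongr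
    _ = _ := by ring

theorem abs_fderiv_cutoff_self_le {M : ℝ} (hM : ∀ s, |deriv cutoffTransition s| ≤ M)
    (hR : 0 < R) (hT : 0 < T) (z : Space N l) :
    |fderiv ℝ (cutoff R T) z z| ≤ 8 * M := by
  obtain ⟨a, c, h, ha, hc, -, -⟩ := fderiv_cutoff hM hR hT z
  rw [h, real_inner_self_eq_norm_sq, real_inner_self_eq_norm_sq]
  refine (abs_add_le _ _).trans ?_
  rw [abs_mul, abs_mul, abs_of_nonneg (sq_nonneg ‖xPart z‖), abs_of_nonneg (sq_nonneg ‖yPart z‖)]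
  linarith

/-- A majorant independent of `R`, which makes dominated convergence possible. The radial part of
the field adds `8 M`, hence the `6` in place of `4`. -/
theorem abs_inner_pohozaevField_cutoff_le {M : ℝ} (hM : ∀ s, |deriv cutoffTransition s| ≤ M)
    (hp : 1 < p) (hγ : 0 ≤ γ) (hR : 0 < R) (V : Space N l → Space N l) (z : Space N l) :
    |⟪pohozaevField p γ f u V z, gradient (cutoff R (R ^ (1 + γ))) z⟫_ℝ|
      ≤ 4 * M * (6 + 2 ^ (1 + γ)) * (‖weight γ z (V z)‖ ^ p + |primitive f z (u z)|) := by
  have hMp : 0 ≤ M := (abs_nonneg _).trans (hM 0)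
  have h1 := abs_fderiv_cutoff_le hM hγ hR z (V z)
    (‖weight γ z (V z)‖ ^ (p - 2) • weight γ z (V z))
  have h2 := abs_fderiv_cutoff_self_le hM hR (Real.rpow_pos_of_pos hR (1 + γ)) z
  have h3 : ‖weight γ z (V z)‖ * ‖‖weight γ z (V z)‖ ^ (p - 2) • weight γ z (V z)‖
      = ‖weight γ z (V z)‖ ^ p := by
    rw [norm_smul, Real.norm_of_nonneg (by positivity), norm_rpow_sub_two_mul_norm hp, mul_comm,
      norm_rpow_sub_one_mul_norm hp]
  rw [h3] at h1
  set ξ := ‖weight γ z (V z)‖ ^ p with hξ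
  have hξ0 : 0 ≤ ξ := by positivity
  have h4 : |primitive f z (u z) - ξ / p| ≤ |primitive f z (u z)| + ξ := by
    refine (abs_sub _ _).trans (add_le_add_right ?_ _)
    rw [abs_of_nonneg (by positivity)]
    exact div_le_self hξ0 hp.le
  rw [real_inner_comm, inner_gradient_left, pohozaevField, map_add, map_smul _ (_ - _), smul_eq_mul]
  refine (abs_add_le _ _).trans ?_
  rw [abs_mul]
  have h5 : |primitive f z (u z) - ξ / p| * |fderiv ℝ (cutoff R (R ^ (1 + γ))) z z|
      ≤ (|primitive f z (u z)| + ξ) * (8 * M) := by gcongr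
  have h6 : (0 : ℝ) ≤ 2 ^ (1 + γ) := by positivity
  nlinarith [mul_nonneg (mul_nonneg hMp (abs_nonneg (primitive f z (u z)))) h6,
    mul_nonneg hMp (abs_nonneg (primitive f z (u z)))]

end Cutoff

end Grushin

/-! ### Integrability and the global identity -/

namespace Grushin

variable {N l : ℕ} {p γ : ℝ} {f : Space N l → ℝ → ℝ} {Ω : Set (Space N l)} {u : Space N l → ℝ}

section Integrability

theorem MemWZero.integrableOn_norm_grushinGrad_rpow (hp : 1 < p) (hγ : 0 ≤ γ) (hΩ : IsOpen Ω)
    {G : Space N l → Space N l} (hG : MemWZero p γ Ω u G) (hu : ContDiffOn ℝ 1 u Ω) :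
    IntegrableOn (fun z => ‖grushinGrad γ u z‖ ^ p) Ω := by
  have h := ((memLp_congr_ae (hG.ae_eq_grushinGrad hp hγ hΩ hu)).1 hG.memLp_grad).integrable_norm_rpow
    (by simpa using by linarith) ENNReal.ofReal_ne_top
  rw [ENNReal.toReal_ofReal (by linarith)] at h
  exact h

theorem abs_degenerateTerm_le (hp : 1 < p) (hγ : 0 ≤ γ) (z : Space N l) :
    |degenerateTerm p γ u z| ≤ γ * ‖grushinGrad γ u z‖ ^ p := by
  have hx : ‖xPart z‖ ^ (2 * γ) = (‖xPart z‖ ^ γ) ^ 2 := by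
    rw [mul_comm, Real.rpow_mul (norm_nonneg _), Real.rpow_two]
  have h1 : (‖xPart z‖ ^ γ) ^ 2 * ‖yPart (gradient u z)‖ ^ 2 ≤ ‖grushinGrad γ u z‖ ^ 2 := by
    rw [← mul_pow, norm_sq_eq (grushinGrad γ u z), grushinGrad, weight_eq_stretch, yPart_stretch,
      norm_smul, Real.norm_of_nonneg (by positivity)]
    linarith [sq_nonneg ‖xPart (stretch (‖xPart z‖ ^ γ) (gradient u z))‖]
  rw [degenerateTerm, hx, ← norm_rpow_sub_two_mul_sq (p := p) (by linarith),
    abs_of_nonneg (by positivity)]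
  calc _ = γ * (‖grushinGrad γ u z‖ ^ (p - 2) *
        ((‖xPart z‖ ^ γ) ^ 2 * ‖yPart (gradient u z)‖ ^ 2)) := by ring
    _ ≤ _ := by gcongr

theorem MemWZero.integrableOn_degenerateTerm (hp : 1 < p) (hγ : 0 ≤ γ) (hΩ : IsOpen Ω)
    {G : Space N l → Space N l} (hG : MemWZero p γ Ω u G) (hu : ContDiffOn ℝ 1 u Ω) :
    IntegrableOn (degenerateTerm p γ u) Ω := by
  refine ((hG.integrableOn_norm_grushinGrad_rpow hp hγ hΩ hu).const_mul γ).mono' ?_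
    (Eventually.of_forall fun z => abs_degenerateTerm_le hp hγ z)
  have h1 : AEMeasurable (fun z => ‖grushinGrad γ u z‖) (volume.restrict Ω) :=
    (continuousOn_grushinGrad hγ hΩ hu).norm.aemeasurable hΩ.measurableSet
  have h2 : AEMeasurable (fun z => ‖yPart (gradient u z)‖) (volume.restrict Ω) :=
    (continuous_yPart.comp_continuousOn (gradient_continuousOn hΩ hu)).norm.aemeasurable
      hΩ.measurableSet
  have h3 : Continuous fun z : Space N l => γ * ‖xPart z‖ ^ (2 * γ) :=
    continuous_const.mul (continuous_norm_xPart_rpow (by positivity))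
  exact ((h1.pow_const (p - 2)).mul (h3.aemeasurable.mul (h2.pow_const 2))).aestronglyMeasurable

theorem integrableOn_primitive (hf : Continuous (Function.uncurry f))
    (hb : Bornology.IsBounded Ω) (huc : ContinuousOn u (closure Ω)) :
    IntegrableOn (fun z => primitive f z (u z)) Ω :=
  (((continuous_primitive hf).comp_continuousOn
    (continuousOn_id.prodMk huc)).integrableOn_compact hb.isCompact_closure).mono_set
      subset_closure

theorem continuousOn_pohozaevField (hp : 1 < p) (hγ : 0 ≤ γ) (hf : Continuous (Function.uncurry f))
    {s : Set (Space N l)} (hu : ContinuousOn u s) {V : Space N l → Space N l}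
    (hV : ContinuousOn V s) : ContinuousOn (pohozaevField p γ f u V) s := by
  have hw : ContinuousOn (fun z => weight γ z (V z)) s :=
    (continuous_weight hγ).comp_continuousOn (continuousOn_id.prodMk hV)
  have hA := (continuous_norm_rpow_sub_two_smul hp).comp_continuousOn hw
  have h1 : ContinuousOn (fun z => ⟪V z, z⟫_ℝ) s := hV.inner continuousOn_id
  have h2 : ContinuousOn (fun z => ‖weight γ z (V z)‖ ^ p / p) s :=
    (hw.norm.rpow_const fun _ _ => Or.inr (by linarith)).div_const p
  have h3 : ContinuousOn (fun z => primitive f z (u z)) s :=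
    (continuous_primitive hf).comp_continuousOn (continuousOn_id.prodMk hu)
  exact (h1.smul ((continuous_weight hγ).comp_continuousOn (continuousOn_id.prodMk hA))).add
    ((h3.sub h2).smul continuousOn_id)

theorem exists_abs_deriv_cutoffTransition_le : ∃ M, ∀ s, |deriv cutoffTransition s| ≤ M :=
  continuous_deriv_cutoffTransition.bounded_above_of_compact_support
    hasCompactSupport_deriv_cutoffTransition

end Integrability

section Pohozaev

/-- The divergence theorem for the Pohozaev field on the whole domain. -/
theorem setIntegral_pohozaevSource (hp : 1 < p) (hγ : 0 ≤ γ) (hN : 1 ≤ N)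
    (hf : Continuous (Function.uncurry f)) (hΩ : IsOpen Ω) (hC : HasC1Boundary Ω)
    (hu : ContDiffOn ℝ 1 u Ω) (huc : ContinuousOn u (closure Ω)) {V : Space N l → Space N l}
    (hV : ContinuousOn V (closure Ω)) (hVu : ∀ z ∈ Ω, V z = gradient u z)
    (hsol : IsWeakSolution p γ f Ω u)
    (hFdiff : ∀ z ∈ Ω, DifferentiableAt ℝ (fun w => primitive f w (u z)) z)
    (hFz : IntegrableOn (fun z => ⟪gradPrimitive f z (u z), z⟫_ℝ) Ω)
    (hF : IntegrableOn (fun z => primitive f z (u z)) Ω)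
    (hbt : ¬ Bornology.IsBounded Ω →
      IntegrableOn (boundaryTerm p γ Ω u) (frontier Ω) (surfaceMeasure N l)) :
    IntegrableOn (boundaryTerm p γ Ω u) (frontier Ω) (surfaceMeasure N l) ∧
    ∫ z in Ω, pohozaevSource p γ f u z
      = (1 - 1 / p) * ∫ z in frontier Ω, boundaryTerm p γ Ω u z ∂surfaceMeasure N l := by
  obtain ⟨G, hG, -⟩ := id hsol
  have hp0 : (1 - 1 / p) ≠ 0 := by
    have : 1 / p < 1 := (div_lt_one (by linarith)).2 hp
    linarith
  have hE := hG.integrableOn_norm_grushinGrad_rpow hp hγ hΩ hu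
  have hα : IntegrableOn (pohozaevSource p γ f u) Ω :=
    (((hE.const_mul _).sub (hG.integrableOn_degenerateTerm hp hγ hΩ hu)).add
      (hF.const_mul _)).add hFz
  -- The divergence theorem for the Pohozaev field, with its normal component rewritten; dividing by
  -- `1 - 1 / p`, which is nonzero, gives integrability of the boundary term against every `η`.
  have hfl : ∀ η : Space N l → ℝ, ContDiff ℝ 1 η → HasCompactSupport η →
      IntegrableOn (fun z => η z * boundaryTerm p γ Ω u z) (frontier Ω) (surfaceMeasure N l) ∧
      ∫ z in Ω, (η z * pohozaevSource p γ f u z + ⟪pohozaevField p γ f u V z, gradient η z⟫_ℝ)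
        = (1 - 1 / p) * ∫ z in frontier Ω, η z * boundaryTerm p γ Ω u z ∂surfaceMeasure N l :=
    fun η hη hc => by
    obtain ⟨h1, h2⟩ := hC.hasFlux hN hΩ (fun K _ => hα.mono_set inter_subset_left)
      (continuousOn_pohozaevField (f := f) hp hγ hf huc hV) (fun η hη hc hs => by
        rw [← hsol.integral_pohozaev hp hγ (by omega) hf hΩ hu hFdiff hFz hη hc hs]
        refine setIntegral_congr_fun hΩ.measurableSet fun z hz => ?_
        simp only [pohozaevField, hVu z hz]) hη hc
    have e : EqOn (fun z => η z * ⟪pohozaevField p γ f u V z, outerNormal Ω z⟫_ℝ)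
        (fun z => (1 - 1 / p) * (η z * boundaryTerm p γ Ω u z)) (frontier Ω) := fun z hz => by
      simp only
      rw [inner_pohozaevField_outerNormal hp hγ hN f hΩ hC hG hu huc hV hVu hz]
      ring
    constructor
    · have h3 := (h1.congr_fun e isClosed_frontier.measurableSet).const_mul (1 - 1 / p)⁻¹
      simp only [inv_mul_cancel_left₀ hp0] at h3
      exact h3
    · rw [h2, setIntegral_congr_fun isClosed_frontier.measurableSet e, integral_const_mul]
  have hbt' : IntegrableOn (boundaryTerm p γ Ω u) (frontier Ω) (surfaceMeasure N l) := by
    by_cases hb : Bornology.IsBounded Ω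
    · obtain ⟨r, hr⟩ := hb.closure.subset_closedBall 0
      -- A cutoff equal to one on the closure of the bounded set `Ω`; the maximum with `1` makes the
      -- radius positive.
      have hR : 0 < max r 1 := lt_max_of_lt_right one_pos
      refine (hfl _ (contDiff_cutoff (max r 1) (max r 1)) (hasCompactSupport_cutoff hR hR)).1.congr_fun
        (fun z hz => ?_) isClosed_frontier.measurableSet
      have hz' : ‖z‖ ≤ max r 1 :=
        (mem_closedBall_zero_iff.1 (hr (frontier_subset_closure hz))).trans (le_max_left _ _)
      simp only [cutoff_eq_one hR hR hz' hz', one_mul]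
    · exact hbt hb
  refine ⟨hbt', ?_⟩
  obtain ⟨M, hM⟩ := exists_abs_deriv_cutoffTransition_le
  -- Radii at least `1` ensure `R ≤ R^(1+γ)`, so the anisotropic cutoff equals one on the ball of
  -- radius `R`.
  set R : ℕ → ℝ := fun n => n + 1 with hRdef
  have hR : ∀ n, 0 < R n := fun n => by positivity
  have hT : ∀ n, 0 < R n ^ (1 + γ) := fun n => by have := hR n; positivity
  have hRT : ∀ n, R n ≤ R n ^ (1 + γ) := fun n => by
    have h1 : 1 ≤ R n := by simp [hRdef]
    calc R n = R n ^ (1 : ℝ) := (Real.rpow_one _).symm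
      _ ≤ _ := Real.rpow_le_rpow_of_exponent_le h1 (by linarith)
  set η : ℕ → Space N l → ℝ := fun n => cutoff (R n) (R n ^ (1 + γ)) with hη
  have hη1 : ∀ z, ∀ᶠ n in atTop, ∀ᶠ w in 𝓝 z, η n w = 1 := fun z => by
    have hRl : Tendsto R atTop atTop :=
      tendsto_natCast_atTop_atTop.atTop_add tendsto_const_nhds
    filter_upwards [hRl.eventually_gt_atTop ‖z‖] with n hn
    filter_upwards [continuous_norm.continuousAt.eventually_lt continuousAt_const hn] with w hw
    exact cutoff_eq_one (hR n) (hT n) hw.le (hw.le.trans (hRT n))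
  have hηb : ∀ n z, |η n z| ≤ 1 := fun n z => by
    have := cutoff_mem_Icc (R n) (R n ^ (1 + γ)) z
    rw [abs_of_nonneg this.1]
    exact this.2
  have hηd : ∀ n, ContDiff ℝ 1 (η n) := fun n => contDiff_cutoff _ _
  have hL1 : Tendsto (fun n => ∫ z in Ω, (η n z * pohozaevSource p γ f u z
      + ⟪pohozaevField p γ f u V z, gradient (η n) z⟫_ℝ)) atTop
      (𝓝 (∫ z in Ω, pohozaevSource p γ f u z)) := by
    refine tendsto_integral_of_dominated_convergence
      (fun z => |pohozaevSource p γ f u z| + 4 * M * (6 + 2 ^ (1 + γ)) *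
        (‖grushinGrad γ u z‖ ^ p + |primitive f z (u z)|)) (fun n => ?_)
      (hα.abs.add ((hE.add hF.abs).const_mul _)) (fun n => ?_) ?_
    · have hb : ContinuousOn (pohozaevField p γ f u V) Ω :=
        continuousOn_pohozaevField hp hγ hf (huc.mono subset_closure) (hV.mono subset_closure)
      exact ((hηd n).continuous.aestronglyMeasurable.mul hα.aestronglyMeasurable).add
        ((hb.inner (hηd n).continuous_gradient.continuousOn).aestronglyMeasurable hΩ.measurableSet)
    · refine (ae_restrict_iff' hΩ.measurableSet).2 (Eventually.of_forall fun z hz => ?_)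
      have h1 := abs_inner_pohozaevField_cutoff_le (f := f) (u := u) hM hp hγ (hR n) V z
      rw [hVu z hz, ← grushinGrad] at h1
      refine (abs_add_le _ _).trans (add_le_add ?_ h1)
      rw [abs_mul]
      exact mul_le_of_le_one_left (abs_nonneg _) (hηb n z)
    · refine Eventually.of_forall fun z => tendsto_const_nhds.congr' ?_
      filter_upwards [hη1 z] with n hn
      have h0 : gradient (η n) z = 0 := by
        have : η n =ᶠ[𝓝 z] fun _ => 1 := hn
        rw [this.gradient_eq]
        simp [gradient]
      rw [hn.self_of_nhds, h0, inner_zero_right, one_mul, add_zero]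
  have hL2 : Tendsto (fun n => ∫ z in frontier Ω, η n z * boundaryTerm p γ Ω u z
      ∂surfaceMeasure N l) atTop
      (𝓝 (∫ z in frontier Ω, boundaryTerm p γ Ω u z ∂surfaceMeasure N l)) := by
    refine tendsto_integral_of_dominated_convergence (fun z => |boundaryTerm p γ Ω u z|)
      (fun n => (hηd n).continuous.aestronglyMeasurable.mul hbt'.aestronglyMeasurable) hbt'.abs
      (fun n => Eventually.of_forall fun z => ?_) (Eventually.of_forall fun z => ?_)
    · rw [Real.norm_eq_abs, abs_mul]
      exact mul_le_of_le_one_left (abs_nonneg _) (hηb n z)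
    · refine tendsto_const_nhds.congr' ?_
      filter_upwards [hη1 z] with n hn
      rw [hn.self_of_nhds, one_mul]
  exact tendsto_nhds_unique hL1 ((hL2.const_mul _).congr fun n =>
    (hfl _ (hηd n) (hasCompactSupport_cutoff (hR n) (hT n))).2.symm)

/-- The solution is itself an admissible test function. This is also where integrability of `f(z, u)
u` comes from. -/
theorem IsWeakSolution.integral_norm_grushinGrad_rpow (hp : 1 < p) (hγ : 0 ≤ γ) (hΩ : IsOpen Ω)
    (hu : ContDiffOn ℝ 1 u Ω) (hsol : IsWeakSolution p γ f Ω u) :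
    IntegrableOn (fun z => f z (u z) * u z) Ω ∧
    ∫ z in Ω, ‖grushinGrad γ u z‖ ^ p = ∫ z in Ω, f z (u z) * u z := by
  obtain ⟨G, hG, h⟩ := hsol
  refine ⟨(h u G hG).1, ?_⟩
  rw [← (h u G hG).2]
  refine integral_congr_ae ?_
  filter_upwards [hG.ae_eq_grushinGrad hp hγ hΩ hu] with z hz
  rw [hz, real_inner_self_eq_norm_sq, norm_rpow_sub_two_mul_sq (by linarith)]

theorem setIntegral_pohozaevSource_eq (hp : 1 < p) (hγ : 0 ≤ γ) (hΩ : IsOpen Ω)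
    (hu : ContDiffOn ℝ 1 u Ω) (hsol : IsWeakSolution p γ f Ω u)
    (hFz : IntegrableOn (fun z => ⟪gradPrimitive f z (u z), z⟫_ℝ) Ω)
    (hF : IntegrableOn (fun z => primitive f z (u z)) Ω) :
    ∫ z in Ω, pohozaevSource p γ f u z = (1 - (N + l) / p) * (∫ z in Ω, f z (u z) * u z)
      - (∫ z in Ω, degenerateTerm p γ u z) + (N + l) * (∫ z in Ω, primitive f z (u z))
      + ∫ z in Ω, ⟪gradPrimitive f z (u z), z⟫_ℝ := by
  obtain ⟨G, hG, -⟩ := id hsol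
  have h1 : IntegrableOn (fun z => (1 - ((N : ℝ) + l) / p) * ‖grushinGrad γ u z‖ ^ p) Ω :=
    (hG.integrableOn_norm_grushinGrad_rpow hp hγ hΩ hu).const_mul _
  have h2 := hG.integrableOn_degenerateTerm hp hγ hΩ hu
  have h3 : IntegrableOn (fun z => ((N : ℝ) + l) * primitive f z (u z)) Ω := hF.const_mul _
  have h4 : IntegrableOn (fun z => (1 - ((N : ℝ) + l) / p) * ‖grushinGrad γ u z‖ ^ p
      - degenerateTerm p γ u z) Ω := h1.sub h2
  have h5 : IntegrableOn (fun z => (1 - ((N : ℝ) + l) / p) * ‖grushinGrad γ u z‖ ^ p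
      - degenerateTerm p γ u z + ((N : ℝ) + l) * primitive f z (u z)) Ω := h4.add h3
  simp only [pohozaevSource]
  rw [integral_add h5 hFz, integral_add h4 h3, integral_sub h1 h2, integral_const_mul,
    integral_const_mul, (hsol.integral_norm_grushinGrad_rpow hp hγ hΩ hu).2]

end Pohozaev

end Grushin

/-! ### The Pohozaev identity -/

theorem theorem1p3 {N l : ℕ} (hN : 1 ≤ N) (hNl : 3 ≤ N + l) {p γ : ℝ} (hp : 1 < p) (hγ : 0 ≤ γ)
    (f : Grushin.Space N l → ℝ → ℝ) (hf : Continuous (Function.uncurry f))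
    (Ω : Set (Grushin.Space N l)) (hΩ : IsOpen Ω)
    (u : Grushin.Space N l → ℝ) (hu : Grushin.IsC1OnClosure Ω u)
    (hsol : Grushin.IsWeakSolution p γ f Ω u)
    -- `∇_z F(z, u(z))` exists on `Ω`, and the integral of `⟨∇_z F(z, u), z⟩` converges
    (hFdiff : ∀ z ∈ Ω, DifferentiableAt ℝ (fun w => Grushin.primitive f w (u z)) z)
    (hFz : IntegrableOn (fun z => ⟪Grushin.gradPrimitive f z (u z), z⟫_ℝ) Ω)
    -- on an unbounded `Ω`, the integral of `F(z, u)` converges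
    (hF : ¬ Bornology.IsBounded Ω → IntegrableOn (fun z => Grushin.primitive f z (u z)) Ω) :
    -- `∇(F(z, u)) = ∇_z F(z, u) + f(z, u) ∇u`
    (∀ z ∈ Ω, HasGradientAt (fun w => Grushin.primitive f w (u w))
      (Grushin.gradPrimitive f z (u z) + f z (u z) • gradient u z) z) ∧
    -- the volume integrals of the identities converge
    IntegrableOn (fun z => f z (u z) * u z) Ω ∧
    IntegrableOn (Grushin.degenerateTerm p γ u) Ω ∧
    IntegrableOn (fun z => Grushin.primitive f z (u z)) Ω ∧
    -- the identity on a domain with boundary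
    (Grushin.HasC1Boundary Ω →
      (¬ Bornology.IsBounded Ω →
        IntegrableOn (Grushin.boundaryTerm p γ Ω u) (frontier Ω) (Grushin.surfaceMeasure N l)) →
      IntegrableOn (Grushin.boundaryTerm p γ Ω u) (frontier Ω) (Grushin.surfaceMeasure N l) ∧
      (-((N : ℝ) + l) / p + 1) * (∫ z in Ω, f z (u z) * u z)
          + (1 / p - 1) * (∫ z in frontier Ω, Grushin.boundaryTerm p γ Ω u z
              ∂(Grushin.surfaceMeasure N l))
          - ∫ z in Ω, Grushin.degenerateTerm p γ u z
        = -((N : ℝ) + l) * (∫ z in Ω, Grushin.primitive f z (u z))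
          - ∫ z in Ω, ⟪Grushin.gradPrimitive f z (u z), z⟫_ℝ) ∧
    -- the identity on the whole space
    (Ω = univ →
      (-((N : ℝ) + l) / p + 1) * (∫ z, f z (u z) * u z)
          - ∫ z, Grushin.degenerateTerm p γ u z
        = -((N : ℝ) + l) * (∫ z, Grushin.primitive f z (u z))
          - ∫ z, ⟪Grushin.gradPrimitive f z (u z), z⟫_ℝ) := by
  obtain ⟨hud, huc, V, hV, hVu⟩ := hu
  obtain ⟨G, hG, -⟩ := id hsol
  have hF' : IntegrableOn (fun z => Grushin.primitive f z (u z)) Ω := by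
    by_cases hb : Bornology.IsBounded Ω
    · exact Grushin.integrableOn_primitive hf hb huc
    · exact hF hb
  have key := fun hC hbt => Grushin.setIntegral_pohozaevSource hp hγ hN hf hΩ hC hud huc hV hVu
    hsol hFdiff hFz hF' hbt
  have hsrc := Grushin.setIntegral_pohozaevSource_eq hp hγ hΩ hud hsol hFz hF'
  refine ⟨fun z hz => Grushin.hasGradientAt_primitive_comp hf
    ((hud.contDiffAt (hΩ.mem_nhds hz)).differentiableAt one_ne_zero) (hFdiff z hz),
    (hsol.integral_norm_grushinGrad_rpow hp hγ hΩ hud).1,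
    hG.integrableOn_degenerateTerm hp hγ hΩ hud, hF', fun hC hbt => ?_, fun hΩu => ?_⟩
  · obtain ⟨h1, h2⟩ := key hC hbt
    refine ⟨h1, ?_⟩
    rw [hsrc] at h2
    linear_combination h2
  · subst hΩu
    -- The whole space has empty frontier, so the boundary conditions hold vacuously and the surface
    -- integral vanishes.
    have h2 := (key (fun z hz => by simp at hz) (fun _ => by simp)).2
    rw [hsrc] at h2
    simp only [frontier_univ, Measure.restrict_empty, integral_zero_measure, mul_zero,
      setIntegral_univ] at h2
    linear_combination h2
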